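/- Fix integers $d\ge 1$, $k\ge 0$ and a real number $\epsilon>0$. A quantum circuit on $n$ spins of dimension $d$ is a finite sequence of elementary gates acting on $\mathcal H_n\otimes\mathcal A$, where $\mathcal H_n=(\mathbb C^d)^{\otimes n}$ and $\mathcal A$ is a finite register of ancillary qubits with initial state $|0\cdots0\rangle_{\mathcal A}$; an elementary gate is an arbitrary unitary acting on at most two of the subsystems (spins or ancillary qubits), and the quantum complexity is the number of gates. Circuits $\{V(t)\}_t$ simulate $H$ on a subspace $\mathcal S\subseteq\mathcal H_n$ with parameters $(T,\epsilon,G)$ if for all $0\le t\le T$ the complexity of $V(t)$ is at most $G$ and $\|(e^{-itH}\otimes 1_{\mathcal A}-V(t))|\psi\rangle\otimes|0\rangle_{\mathcal A}\|\le\epsilon$ for all unit vectors $|\psi\rangle\in\mathcal S$. For $g\in\mathbb N\cup\{\infty\}$ let $\mathcal C_n$ be the class of operators $\sum_X h_X$ on $\mathcal H_n$, where $X$ runs over a set of subsets of the $n$ spins with $|X|\le k$, each spin lies in at most $g$ of the sets $X$, and $h_X$ is Hermitian, acts on the spins in $X$, and satisfies $\|h_X\|\le 1$. Let $l(n)$ be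 the no-fast-forwarding line of $\mathcal C_n$: the supremum over $H\in\mathcal C_n$ of the least $G$ such that some circuits simulate $H$ on $\mathcal H_n$ with parameters $(T(n),\epsilon,G)$. Circuits $\{V_n(t)\}$ are $(T(n),\epsilon,G(n))$-fast-forwarding $\{H_n\in\mathcal C_n\}$ on subspaces $\mathcal S_n$ if they simulate $H_n$ on $\mathcal S_n$ with these parameters and $G(n)/l(n)\to 0$. There are a constant $C>0$ and exponents $p,q\in\mathbb N$, depending only on $d$, $k$, $\epsilon$, such that the following holds for every $g$. Let $H_n=\sum_X h_X\in\mathcal C_n$ be a sequence of Hamiltonians that are frustration-free (each $h_X\ge 0$, and the lowest eigenvalue of $H_n$ is $0$), let $L(n)$ be the number of terms of $H_n$ (so that $L(n)=\mathrm{poly}(n)$), let $0<T(n)\le d^{2n}$ and $\Delta(n)\le 1/T(n)$, and let $\mathcal S_n$ be the span of all eigenstates of $H_n$ with eigenvalue in $[0,\Delta(n)]$. Then there exist circuits $\{V_n(t)\}_{n,t}$ and a function $G$ such that, for every $n$, the circuits $\{V_n(t)\}_t$ simulate $H_n$ on $\mathcal S_n$ with parameters $(T(n),\epsilon,G(n))$,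 where $$G(n)\le C\,L(n)^2\sqrt{T(n)}\,\log^p(2+L(n)+T(n)),$$ that is, $G(n)=\tilde{\mathcal O}(L(n)^2\sqrt{T(n)})$. Moreover, if $l(n)=\Omega(nT(n))$, then $$\frac{G(n)}{l(n)}=\mathcal O\!\left(\frac{L(n)^2}{n\sqrt{T(n)}}\log^p(2+L(n)+T(n))\right),$$ and if in addition $T(n)=\tilde\Omega(L(n)^4/n^2)$, in the sense that $T(n)\ge c\,\frac{L(n)^4}{n^2}\log^q(2+n+L(n)+T(n))$ for some $c>0$ and all large $n$, then $G(n)/l(n)\to 0$, so that the circuits $\{V_n(t)\}_{n,t}$ are $(T(n),\epsilon,G(n))$-fast-forwarding $\{H_n\}$ on $\{\mathcal S_n\}$. -/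

import Mathlib

open Filter Topology
open scoped ENNReal ComplexOrder Matrix.Norms.L2Operator

noncomputable section

namespace QSim

/-! ### Finite collections of quantum subsystems -/

section Subsystems

variable {ι : Type} [Fintype ι] [DecidableEq ι]

/-- Labels of the product basis of `⨂ i, ℂ^(D i)`. -/
abbrev Config (D : ι → ℕ) : Type := (i : ι) → Fin (D i)

/-- The Hilbert space `⨂ i, ℂ^(D i)`, written in the product basis. -/
abbrev HilbertSp (D : ι → ℕ) : Type := EuclideanSpace ℂ (Config D)

/-- Operators on `⨂ i, ℂ^(D i)`, written in the product basis. -/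
abbrev Op (D : ι → ℕ) : Type := Matrix (Config D) (Config D) ℂ

/-- Operators on the tensor product of the subsystems in `X` only. -/
abbrev OpOn (D : ι → ℕ) (X : Finset ι) : Type :=
  Matrix ((i : X) → Fin (D i)) ((i : X) → Fin (D i)) ℂ

/-- `A` on the subsystems in `X`, tensored with the identity on all the others. -/
def extend (D : ι → ℕ) (X : Finset ι) (A : OpOn D X) : Op D :=
  fun x y => if ∀ i, i ∉ X → x i = y i then A (fun i => x i) (fun i => y i) else 0

end Subsystems

/-! ### The standard gate model -/

/-- An elementary gate: an arbitrary unitary acting on at most two of the subsystems. -/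
structure Gate {ι : Type} [Fintype ι] [DecidableEq ι] (D : ι → ℕ) where
  /-- the subsystems acted upon -/
  support : Finset ι
  card_support_le : support.card ≤ 2
  /-- the unitary that is applied to them -/
  mat : OpOn D support
  mat_unitary : mat ∈ Matrix.unitaryGroup ((i : support) → Fin (D i)) ℂ

/-- A system of `n` spins of dimension `d`. -/
abbrev spinDims (d n : ℕ) : Fin n → ℕ := fun _ => d

/-- A system of `n` spins of dimension `d`, together with `a` ancillary qubits. -/
abbrev regDims (d n a : ℕ) : Fin n ⊕ Fin a → ℕ := Sum.elim (fun _ => d) (fun _ => 2)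

/-- A quantum circuit on `n` spins of dimension `d`: a number of ancillary qubits, and a sequence
of elementary gates on the spins and the ancillary qubits. -/
structure Circuit (d n : ℕ) where
  /-- the number of ancillary qubits -/
  ancillas : ℕ
  /-- the gates; the head of the list is applied last -/
  gates : List (Gate (regDims d n ancillas))

/-- The quantum complexity of a circuit: its number of elementary gates. -/
def Circuit.complexity {d n : ℕ} (V : Circuit d n) : ℕ := V.gates.length

/-- The unitary that a circuit implements on spins and ancillas. -/
def Circuit.toOp {d n : ℕ} (V : Circuit d n) : Op (regDims d n V.ancillas) :=
  (V.gates.map fun g => extend (regDims d n V.ancillas) g.support g.mat).prod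

/-- The state `|ψ⟩ ⊗ |0 … 0⟩`, with `a` ancillary qubits in the state `|0⟩`. -/
def withAncilla {d n : ℕ} (a : ℕ) (ψ : HilbertSp (spinDims d n)) : HilbertSp (regDims d n a) :=
  WithLp.toLp 2 fun z => if ∀ j : Fin a, (z (Sum.inr j)).val = 0
    then ψ (fun i => z (Sum.inl i)) else 0

/-! ### Hamiltonian simulation and fast-forwarding -/

/-- The evolution operator `e^{-itH}`. -/
def evolution {d n : ℕ} (H : Op (spinDims d n)) (t : ℝ) : Op (spinDims d n) :=
  NormedSpace.exp ((-(Complex.I * (t : ℂ))) • H)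

/-- The circuits `V t` simulate `H` on the subspace `S` with parameters `(T, ε, G)`. Note that
`(e^{-itH} ⊗ 1) (|ψ⟩ ⊗ |0⟩) = (e^{-itH} |ψ⟩) ⊗ |0⟩`. -/
def Simulates {d n : ℕ} (V : ℝ → Circuit d n) (H : Op (spinDims d n))
    (S : Submodule ℂ (HilbertSp (spinDims d n))) (T ε G : ℝ) : Prop :=
  ∀ t : ℝ, 0 ≤ t → t ≤ T →
    ((V t).complexity : ℝ) ≤ G ∧
    ∀ ψ ∈ S, ‖ψ‖ = 1 →
      ‖withAncilla (V t).ancillas (Matrix.toEuclideanLin (evolution H t) ψ)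
        - Matrix.toEuclideanLin (V t).toOp (withAncilla (V t).ancillas ψ)‖ ≤ ε

/-- The least `G` such that `H` can be simulated (on the whole Hilbert space) with parameters
`(T, ε, G)`. -/
def minComplexity {d n : ℕ} (H : Op (spinDims d n)) (T ε : ℝ) : ℕ∞ :=
  ⨅ (G : ℕ) (_ : ∃ V : ℝ → Circuit d n, Simulates V H ⊤ T ε (G : ℝ)), (G : ℕ∞)

/-- The value of the no-fast-forwarding line for a class `C` of Hamiltonians of `n` spins: the
worst-case complexity of simulation with time and error parameters `T` and `ε`. -/
def noFFLine {d n : ℕ} (C : Set (Op (spinDims d n))) (T ε : ℝ) : ℕ∞ :=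
  ⨆ H ∈ C, minComplexity H T ε

/-- The ratio `G / l` for `G ≥ 0` and `l ∈ {0, 1, …, ∞}`. -/
def ratio (G : ℝ) (l : ℕ∞) : ℝ≥0∞ := ENNReal.ofReal G / (l : ℝ≥0∞)

/-- The circuits `V n t` are `(T(n), ε(n), G(n))`-fast-forwarding the sequence `H` on the subspaces
`S`, relative to the classes `C`. -/
def FastForwards {d : ℕ} (C : (n : ℕ) → Set (Op (spinDims d n)))
    (V : (n : ℕ) → ℝ → Circuit d n) (H : (n : ℕ) → Op (spinDims d n))
    (S : (n : ℕ) → Submodule ℂ (HilbertSp (spinDims d n))) (T ε G : ℕ → ℝ) : Prop :=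
  (∀ n, H n ∈ C n) ∧
  (∀ n, Simulates (V n) (H n) (S n) (T n) (ε n) (G n)) ∧
  Tendsto (fun n => ratio (G n) (noFFLine (C n) (T n) (ε n))) atTop (𝓝 0)

/-! ### Local and frustration-free Hamiltonians -/

/-- A Hamiltonian of `n` spins given as a sum of terms `h_X`, where `X` runs over finitely many sets
of spins and `h_X` acts on the spins in `X`. -/
structure LocalSum (d n : ℕ) where
  /-- the sets `X` that appear in the sum -/
  terms : Finset (Finset (Fin n))
  /-- the interaction terms -/
  h : (X : Finset (Fin n)) → OpOn (spinDims d n) X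

/-- The number `L` of terms. -/
def LocalSum.numTerms {d n : ℕ} (K : LocalSum d n) : ℕ := K.terms.card

/-- The operator `∑ X, h_X` on the Hilbert space of all spins. -/
def LocalSum.toOp {d n : ℕ} (K : LocalSum d n) : Op (spinDims d n) :=
  ∑ X ∈ K.terms, extend (spinDims d n) X (K.h X)

/-- The terms are Hermitian, of norm at most one, each of them acts on at most `k` spins, and each
spin takes part in at most `g` of them (no restriction if `g = ⊤`). -/
structure LocalSum.IsLocal {d n : ℕ} (K : LocalSum d n) (k : ℕ) (g : ℕ∞) : Prop where
  hermitian : ∀ X ∈ K.terms, (K.h X).IsHermitian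
  norm_le : ∀ X ∈ K.terms, ‖K.h X‖ ≤ 1
  card_le : ∀ X ∈ K.terms, X.card ≤ k
  degree_le : ∀ i : Fin n, ((K.terms.filter fun X => i ∈ X).card : ℕ∞) ≤ g

/-- The terms are positive semidefinite and the lowest eigenvalue of their sum is zero. -/
def LocalSum.FrustrationFree {d n : ℕ} (K : LocalSum d n) : Prop :=
  (∀ X ∈ K.terms, (K.h X).PosSemidef) ∧
  IsLeast {E : ℝ | Module.End.HasEigenvalue (Matrix.toEuclideanLin K.toOp) (E : ℂ)} 0

/-- The class of the `k`-local Hamiltonians of `n` spins of dimension `d`, with degree at most `g`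
and terms of norm at most one. -/
def localClass (d k : ℕ) (g : ℕ∞) (n : ℕ) : Set (Op (spinDims d n)) :=
  {H | ∃ K : LocalSum d n, K.IsLocal k g ∧ K.toOp = H}

/-- The span of all eigenstates with eigenvalue in `[0, Δ]`. -/
def lowEnergy {d n : ℕ} (H : Op (spinDims d n)) (Δ : ℝ) :
    Submodule ℂ (HilbertSp (spinDims d n)) :=
  ⨆ E ∈ Set.Icc (0 : ℝ) Δ, Module.End.eigenspace (Matrix.toEuclideanLin H) (E : ℂ)

end QSim

end

/-! Only energies up to 1/T matter, and a quantum walk built from H turns by an angle proportional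
to the square root of a small energy. This square root replaces T by √T. Write L for the number of
terms.

Each term is a positive contraction, so there are commuting Hermitian a, b with a² = σh and b² = 1 -
σh, and (a, b) defines a unitary rotation of one ancillary qubit. The L rotations are selected by
the words of a one-hot register in uniform superposition. Wrapped around a Pauli Z they give an
involution B; if P detects the base state of the ancillas, then B has the block 1 - 2σH/L there
(`exists_reflection`). On an eigenvector of energy E the walk W = (2P - 1)B therefore has the angle
φ = 2 arcsin √(σE/L), in the sense that (W^D + W^(-D))η = 2 cos(Dφ)η (`IsWalkPair.walk_pow_add`).

A round conjugates the phase rotation 1 + c(1 - P) by D steps of the walk, once in each direction.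
To first order in c it multiplies η by exactly 1 + 2c sin²(Dφ), because the parts outside the line
of η cancel (`IsWalkPair.compl_walk_pow`). For D about √(LT) and 4D²σ/L = κT, the value sin²(Dφ) is
κTE up to O(κ²) as long as TE ≤ 1. With c = e^(-iδ) - 1 and δ = t/(2RκT), a round thus approximates
e^(-itE/R). The total error of R rounds is at most 1/(Rκ²) + 4κ, so R and κ depend on ε alone
(`LocalSum.exists_circuit`).

Every controlled rotation involves at most k + 2 subsystems, hence a number of gates bounded in
terms of d and k (`exists_len_extend`). This rests on elimination by two-level rotations, on moving
along paths of configurations that change one coordinate at a time, and on commutators in SU(2),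
which add controls. So a walk step costs O(L) gates, and the circuit O(L√(LT)), which is at most
O(L²√T). If LT ≤ ε, the empty circuit already works (`exists_simulation`).

Division by cnT gives L²/(n√T), and the logarithm in the lower bound on T sends this to zero
(`tendsto_sq_div_mul_sqrt`). -/

noncomputable section

namespace QSim

set_option linter.unusedSectionVars false

/-! ### Operators acting on a few subsystems -/

section Extend

open Matrix

variable {ι : Type} [Fintype ι] [DecidableEq ι] {D : ι → ℕ}

/-- The configuration that is `p` on `X` and `z` elsewhere. -/
def glue (X : Finset ι) (p : (i : X) → Fin (D i)) (z : Config D) : Config D :=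
  fun i => if h : i ∈ X then p ⟨i, h⟩ else z i

/-- The restriction of a configuration to `X`. -/
def restr (X : Finset ι) (z : Config D) : (i : X) → Fin (D i) := fun i => z i

@[simp] lemma restr_glue (X : Finset ι) (p : (i : X) → Fin (D i)) (z : Config D) :
    restr X (glue X p z) = p := by
  ext i; simp [restr, glue]

@[simp] lemma glue_glue (X : Finset ι) (p q : (i : X) → Fin (D i)) (z : Config D) :
    glue X p (glue X q z) = glue X p z := by
  ext i; by_cases h : i ∈ X <;> simp [glue, h]

@[simp] lemma glue_restr (X : Finset ι) (z : Config D) : glue X (restr X z) z = z := by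
  ext i; by_cases h : i ∈ X <;> simp [glue, restr, h]

lemma glue_of_notMem {X : Finset ι} (p : (i : X) → Fin (D i)) (z : Config D) {i : ι}
    (h : i ∉ X) : glue X p z i = z i := by simp [glue, h]

lemma glue_restr_of_agree {X : Finset ι} {x y : Config D} (h : ∀ i, i ∉ X → x i = y i) :
    glue X (restr X y) x = y := by
  ext i; by_cases hi : i ∈ X
  · simp [glue, restr, hi]
  · simp [glue, hi, h i hi]

lemma extend_apply (X : Finset ι) (A : OpOn D X) (x y : Config D) :
    extend D X A x y = if ∀ i, i ∉ X → x i = y i then A (restr X x) (restr X y) else 0 := rfl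

lemma extend_mulVec (X : Finset ι) (A : OpOn D X) (f : Config D → ℂ) (x : Config D) :
    (extend D X A *ᵥ f) x = ∑ p, A (restr X x) p * f (glue X p x) := by
  simp only [mulVec, dotProduct, extend_apply, ite_mul, zero_mul]
  rw [← Finset.sum_filter]
  refine Finset.sum_nbij' (fun y => restr X y) (fun p => glue X p x) ?_ ?_ ?_ ?_ ?_
  · simp
  · intro p _
    simp only [Finset.mem_filter, Finset.mem_univ, true_and]
    intro i hi; rw [glue_of_notMem _ _ hi]
  · intro y hy
    exact glue_restr_of_agree (by simpa using hy)
  · simp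
  · intro y hy
    rw [glue_restr_of_agree (by simpa using hy)]

lemma extend_mul (X : Finset ι) (A B : OpOn D X) :
    extend D X (A * B) = extend D X A * extend D X B := by
  rw [ext_iff_mulVec]
  intro f
  ext x
  rw [← mulVec_mulVec, extend_mulVec, extend_mulVec]
  simp only [extend_mulVec, restr_glue, glue_glue, Finset.mul_sum, mul_apply, Finset.sum_mul]
  rw [Finset.sum_comm]
  simp [mul_assoc]

lemma extend_one (X : Finset ι) : extend D X 1 = 1 := by
  ext x y
  rw [extend_apply]
  by_cases hxy : x = y
  · subst hxy; simp
  · rw [one_apply_ne hxy]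
    split_ifs with h
    · refine one_apply_ne fun h' => hxy ?_
      rw [← glue_restr_of_agree h, ← h', glue_restr]
    · rfl

lemma extend_smul (X : Finset ι) (c : ℂ) (A : OpOn D X) :
    extend D X (c • A) = c • extend D X A := by
  ext x y; simp [extend_apply]

lemma extend_add (X : Finset ι) (A B : OpOn D X) :
    extend D X (A + B) = extend D X A + extend D X B := by
  ext x y; simp only [extend_apply, Matrix.add_apply]; split_ifs <;> simp

lemma extend_star (X : Finset ι) (A : OpOn D X) :
    extend D X (star A) = star (extend D X A) := by
  ext x y
  simp only [extend_apply, star_apply]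
  by_cases h : ∀ i, i ∉ X → x i = y i
  · rw [if_pos h, if_pos fun i hi => (h i hi).symm]
  · rw [if_neg h, if_neg fun h' => h fun i hi => (h' i hi).symm]; simp

lemma extend_injective [Nonempty (Config D)] (X : Finset ι) :
    Function.Injective (extend D X) := by
  intro A B h
  obtain ⟨z⟩ := ‹Nonempty (Config D)›
  ext p q
  have := congrFun (congrFun h (glue X p z)) (glue X q z)
  simp only [extend_apply, restr_glue] at this
  rwa [if_pos, if_pos] at this <;> intro i hi <;> rw [glue_of_notMem _ _ hi, glue_of_notMem _ _ hi]

lemma extend_mem_unitary (X : Finset ι) {A : OpOn D X} (hA : A ∈ unitary (OpOn D X)) :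
    extend D X A ∈ unitary (Op D) := by
  rw [Unitary.mem_iff] at hA ⊢
  rw [← extend_star, ← extend_mul, ← extend_mul, hA.1, hA.2, extend_one]
  exact ⟨rfl, rfl⟩

/-- The operator `O` acts on the subsystems in `X` only. -/
def ActsOn (X : Finset ι) (O : Op D) : Prop :=
  (∀ x y, (∃ i, i ∉ X ∧ x i ≠ y i) → O x y = 0) ∧
  ∀ x y x' y', (∀ i, i ∉ X → x i = y i) → (∀ i, i ∉ X → x' i = y' i) →
    (∀ i ∈ X, x i = x' i) → (∀ i ∈ X, y i = y' i) → O x y = O x' y'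

lemma actsOn_extend (X : Finset ι) (A : OpOn D X) : ActsOn X (extend D X A) := by
  constructor
  · rintro x y ⟨i, hi, hxy⟩
    rw [extend_apply, if_neg fun h => hxy (h i hi)]
  · intro x y x' y' h h' hx hy
    rw [extend_apply, extend_apply, if_pos h, if_pos h']
    congr 1 <;> ext i <;> simp [restr, hx i i.2, hy i i.2]

lemma ActsOn.exists_extend [Nonempty (Config D)] {X : Finset ι} {O : Op D} (h : ActsOn X O) :
    ∃ A : OpOn D X, extend D X A = O := by
  obtain ⟨z⟩ := ‹Nonempty (Config D)›
  refine ⟨of fun p q => O (glue X p z) (glue X q z), ?_⟩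
  ext x y
  rw [extend_apply, of_apply]
  split_ifs with hxy
  · refine h.2 _ _ _ _ ?_ hxy ?_ ?_
    · intro i hi; rw [glue_of_notMem _ _ hi, glue_of_notMem _ _ hi]
    · intro i hi; simp [glue, restr, hi]
    · intro i hi; simp [glue, restr, hi]
  · push Not at hxy
    exact (h.1 x y hxy).symm

/-- `extend D X` is an injective *-homomorphism, so unitarity descends to the local matrix. This
turns an operator known through its matrix entries into a gate. -/
lemma ActsOn.exists_unitary [Nonempty (Config D)] {X : Finset ι} {O : Op D} (h : ActsOn X O)
    (hO : O ∈ unitary (Op D)) : ∃ A ∈ unitary (OpOn D X), extend D X A = O := by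
  obtain ⟨A, rfl⟩ := h.exists_extend
  refine ⟨A, ?_, rfl⟩
  rw [Unitary.mem_iff] at hO ⊢
  rw [← extend_star, ← extend_mul, ← extend_mul, ← extend_one X] at hO
  exact ⟨extend_injective X hO.1, extend_injective X hO.2⟩

lemma ActsOn.mono {X Y : Finset ι} {O : Op D} (h : ActsOn X O) (hXY : X ⊆ Y) : ActsOn Y O := by
  refine ⟨fun x y ⟨i, hi, hxy⟩ => h.1 x y ⟨i, fun h' => hi (hXY h'), hxy⟩, ?_⟩
  intro x y x' y' e e' hx hy
  by_cases hxy : ∀ i, i ∉ X → x i = y i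
  · have hxy' : ∀ i, i ∉ X → x' i = y' i := by
      intro i hi
      by_cases hiY : i ∈ Y
      · rw [← hx i hiY, ← hy i hiY, hxy i hi]
      · exact e' i hiY
    exact h.2 _ _ _ _ hxy hxy' (fun i hi => hx i (hXY hi)) fun i hi => hy i (hXY hi)
  · push Not at hxy
    obtain ⟨i, hi, hne⟩ := hxy
    have hiY : i ∈ Y := by
      by_contra hiY
      exact hne (e i hiY)
    rw [h.1 x y ⟨i, hi, hne⟩, h.1 x' y' ⟨i, hi, by rwa [← hx i hiY, ← hy i hiY]⟩]

lemma ActsOn.add {X : Finset ι} {O O' : Op D} (h : ActsOn X O) (h' : ActsOn X O') :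
    ActsOn X (O + O') := by
  refine ⟨fun x y hxy => by simp [h.1 x y hxy, h'.1 x y hxy], ?_⟩
  intro x y x' y' e e' hx hy
  rw [Matrix.add_apply, Matrix.add_apply, h.2 x y x' y' e e' hx hy, h'.2 x y x' y' e e' hx hy]

lemma ActsOn.smul {X : Finset ι} {O : Op D} (c : ℂ) (h : ActsOn X O) : ActsOn X (c • O) := by
  refine ⟨fun x y hxy => by simp [h.1 x y hxy], ?_⟩
  intro x y x' y' e e' hx hy
  rw [Matrix.smul_apply, Matrix.smul_apply, h.2 x y x' y' e e' hx hy]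

lemma actsOn_one (X : Finset ι) : ActsOn X (1 : Op D) := by
  rw [← extend_one X]; exact actsOn_extend _ _

lemma ActsOn.mul [Nonempty (Config D)] {X : Finset ι} {O O' : Op D} (h : ActsOn X O)
    (h' : ActsOn X O') : ActsOn X (O * O') := by
  obtain ⟨A, rfl⟩ := h.exists_extend
  obtain ⟨B, rfl⟩ := h'.exists_extend
  rw [← extend_mul]; exact actsOn_extend _ _

/-! ### Products of a bounded number of gates -/

/-- The operator implemented by a list of gates. -/
def gatesOp (l : List (Gate D)) : Op D := (l.map fun g => extend D g.support g.mat).prod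

/-- `U` is a product of at most `N` elementary gates. -/
def Len (N : ℕ) (U : Op D) : Prop := ∃ l : List (Gate D), l.length ≤ N ∧ gatesOp l = U

lemma Len.one : Len 0 (1 : Op D) := ⟨[], by simp, by simp [gatesOp]⟩

lemma Len.mono {N M : ℕ} {U : Op D} (h : Len N U) (hNM : N ≤ M) : Len M U := by
  obtain ⟨l, hl, rfl⟩ := h
  exact ⟨l, hl.trans hNM, rfl⟩

lemma Len.mul {N M : ℕ} {U V : Op D} (hU : Len N U) (hV : Len M V) : Len (N + M) (U * V) := by
  obtain ⟨l, hl, rfl⟩ := hU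
  obtain ⟨l', hl', rfl⟩ := hV
  exact ⟨l ++ l', by simp; omega, by simp [gatesOp]⟩

lemma Len.pow {N : ℕ} {U : Op D} (hU : Len N U) (m : ℕ) : Len (m * N) (U ^ m) := by
  induction m with
  | zero => simpa using Len.one
  | succ m ih => rw [pow_succ, Nat.succ_mul]; exact ih.mul hU

lemma Len.list_prod {N : ℕ} (l : List (Op D)) (h : ∀ U ∈ l, Len N U) :
    Len (l.length * N) l.prod := by
  induction l with
  | nil => simpa using Len.one
  | cons U l ih =>
    rw [List.prod_cons, List.length_cons, Nat.succ_mul, add_comm]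
    exact (h U (by simp)).mul (ih fun V hV => h V (by simp [hV]))

lemma Len.of_extend {X : Finset ι} (hX : X.card ≤ 2) {A : OpOn D X}
    (hA : A ∈ unitary (OpOn D X)) : Len 1 (extend D X A) :=
  ⟨[⟨X, hX, A, hA⟩], by simp, by simp [gatesOp]⟩

lemma Len.of_actsOn [Nonempty (Config D)] {X : Finset ι} (hX : X.card ≤ 2) {O : Op D}
    (h : ActsOn X O) (hO : O ∈ unitary (Op D)) : Len 1 O := by
  obtain ⟨A, hA, rfl⟩ := h.exists_unitary hO
  exact Len.of_extend hX hA

lemma Len.mem_unitary {N : ℕ} {U : Op D} (h : Len N U) : U ∈ unitary (Op D) := by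
  obtain ⟨l, -, rfl⟩ := h
  refine list_prod_mem ?_
  simp only [List.mem_map, forall_exists_index, and_imp, forall_apply_eq_imp_iff₂]
  exact fun g _ => extend_mem_unitary _ g.mat_unitary

lemma Len.star {N : ℕ} {U : Op D} (h : Len N U) : Len N (star U) := by
  obtain ⟨l, hl, rfl⟩ := h
  induction l generalizing N with
  | nil => exact ⟨[], by simp, by simp [gatesOp]⟩
  | cons g l ih =>
    have h1 := ih (N := l.length) le_rfl
    have h2 : Len 1 (extend D g.support (Star.star g.mat)) :=
      Len.of_extend g.card_support_le (Unitary.star_mem g.mat_unitary)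
    rw [extend_star] at h2
    have h3 := h1.mul h2
    rw [← star_mul] at h3
    have h4 : gatesOp (g :: l) = extend D g.support g.mat * gatesOp l := by simp [gatesOp]
    rw [h4]
    exact h3.mono (by simpa using hl)

/-- A global phase is a gate with empty support. -/
lemma Len.phase {z : ℂ} (hz : ‖z‖ = 1) : Len 1 (z • (1 : Op D)) := by
  have : extend D ∅ (z • 1) = z • 1 := by rw [extend_smul, extend_one]
  rw [← this]
  refine Len.of_extend (by simp) ?_
  have hz' : starRingEnd ℂ z * z = 1 := by
    rw [mul_comm, Complex.mul_conj, Complex.normSq_eq_norm_sq, hz]; simp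
  rw [Unitary.mem_iff]
  constructor <;> simp [smul_smul, hz', mul_comm z]

end Extend

/-! ### Two-level unitaries and elimination -/

section TwoLevel

open Matrix ComplexConjugate

variable {κ : Type} [Fintype κ] [DecidableEq κ]

/-- The matrix `u` acting on the span of the basis vectors `x` and `y`. -/
def twoLevel (x y : κ) (u : Matrix (Fin 2) (Fin 2) ℂ) : Matrix κ κ ℂ :=
  of fun a b =>
    if a = x then (if b = x then u 0 0 else if b = y then u 0 1 else 0)
    else if a = y then (if b = x then u 1 0 else if b = y then u 1 1 else 0)
    else if a = b then 1 else 0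

lemma twoLevel_mulVec {x y : κ} (hxy : x ≠ y) (u : Matrix (Fin 2) (Fin 2) ℂ) (f : κ → ℂ) (a : κ) :
    (twoLevel x y u *ᵥ f) a = if a = x then u 0 0 * f x + u 0 1 * f y
      else if a = y then u 1 0 * f x + u 1 1 * f y else f a := by
  have key : ∀ s t : ℂ, ∑ b, (if b = x then s else if b = y then t else 0) * f b
      = s * f x + t * f y := by
    intro s t
    have : ∀ b, (if b = x then s else if b = y then t else 0) * f b
        = (if b = x then s * f x else 0) + (if b = y then t * f y else 0) := by
      intro b
      by_cases h : b = x
      · subst h; simp [hxy]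
      · by_cases h' : b = y
        · subst h'; simp [h]
        · simp [h, h']
    simp [this, Finset.sum_add_distrib]
  simp only [mulVec, dotProduct, twoLevel, of_apply]
  split_ifs with h h'
  · exact key _ _
  · exact key _ _
  · simp

lemma twoLevel_mul {x y : κ} (hxy : x ≠ y) (u v : Matrix (Fin 2) (Fin 2) ℂ) :
    twoLevel x y (u * v) = twoLevel x y u * twoLevel x y v := by
  rw [ext_iff_mulVec]
  intro f
  ext a
  rw [← mulVec_mulVec, twoLevel_mulVec hxy, twoLevel_mulVec hxy]
  simp only [twoLevel_mulVec hxy, if_true, if_neg hxy.symm, mul_apply, Fin.sum_univ_two]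
  split_ifs <;> ring

lemma twoLevel_one {x y : κ} (hxy : x ≠ y) : twoLevel x y 1 = 1 := by
  rw [ext_iff_mulVec]
  intro f
  ext a
  rw [twoLevel_mulVec hxy]
  simp only [one_mulVec, one_apply_eq, one_mul]
  split_ifs <;> simp [*]

lemma twoLevel_star {x y : κ} (hxy : x ≠ y) (u : Matrix (Fin 2) (Fin 2) ℂ) :
    twoLevel x y (star u) = star (twoLevel x y u) := by
  ext a b
  simp only [twoLevel, of_apply, star_apply]
  by_cases h1 : a = x
  · subst h1
    by_cases h2 : b = a
    · simp [h2]
    · by_cases h3 : b = y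
      · simp [h3, hxy.symm]
      · simp [h2, h3]
  · by_cases h1' : a = y
    · subst h1'
      by_cases h2 : b = x
      · simp [h2, h1]
      · by_cases h3 : b = a
        · subst h3; simp [h1]
        · simp [h1, h2, h3]
    · by_cases h2 : b = x
      · simp [h2, h1, h1']
      · by_cases h3 : b = y
        · simp [h1, h1', h3, hxy.symm]
        · by_cases h4 : a = b
          · simp [h4, h2, h3]
          · simp [h1, h1', h2, h3, h4, Ne.symm h4]

lemma twoLevel_mem_unitary {x y : κ} (hxy : x ≠ y) {u : Matrix (Fin 2) (Fin 2) ℂ}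
    (hu : u ∈ unitary (Matrix (Fin 2) (Fin 2) ℂ)) : twoLevel x y u ∈ unitary (Matrix κ κ ℂ) := by
  rw [Unitary.mem_iff] at hu ⊢
  rw [← twoLevel_star hxy, ← twoLevel_mul hxy, ← twoLevel_mul hxy, hu.1, hu.2, twoLevel_one hxy]
  exact ⟨rfl, rfl⟩

/-- The general form of a matrix in `SU(2)`. -/
def su (α β : ℂ) : Matrix (Fin 2) (Fin 2) ℂ := !![α, -conj β; β, conj α]

lemma su_mul (α β α' β' : ℂ) :
    su α β * su α' β' = su (α * α' - conj β * β') (β * α' + conj α * β') := by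
  ext i j
  fin_cases i <;> fin_cases j <;> simp [su] <;> ring

lemma su_star (α β : ℂ) : star (su α β) = su (conj α) (-β) := by
  ext i j
  fin_cases i <;> fin_cases j <;> simp [su]

lemma su_one : su 1 0 = 1 := by
  ext i j
  fin_cases i <;> fin_cases j <;> simp [su]

lemma su_mem_unitary {α β : ℂ} (h : ‖α‖ ^ 2 + ‖β‖ ^ 2 = 1) :
    su α β ∈ unitary (Matrix (Fin 2) (Fin 2) ℂ) := by
  have h' : conj α * α + conj β * β = 1 := by
    rw [mul_comm, Complex.mul_conj, mul_comm, Complex.mul_conj, Complex.normSq_eq_norm_sq,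
      Complex.normSq_eq_norm_sq]
    exact_mod_cast h
  rw [Unitary.mem_iff, su_star, su_mul, su_mul, ← su_one]
  constructor
  · congr 1
    · simp [h']
    · simp; ring
  · congr 1
    · rw [← h']; simp; ring
    · simp; ring

/-- The quarter turn in the plane of y and z carries level y to level z, so two-level rotations can
be transported along paths of basis vectors. -/
lemma twoLevel_conj {x y z : κ} (hxy : x ≠ y) (hyz : y ≠ z) (hxz : x ≠ z)
    (u : Matrix (Fin 2) (Fin 2) ℂ) :
    twoLevel y z (su 0 1) * twoLevel x y u * twoLevel y z (su 0 (-1)) = twoLevel x z u := by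
  rw [ext_iff_mulVec]
  intro f
  ext a
  rw [← mulVec_mulVec, ← mulVec_mulVec, twoLevel_mulVec hyz, twoLevel_mulVec hxz]
  simp only [twoLevel_mulVec hxy, twoLevel_mulVec hyz, su, if_true, if_neg hxy.symm,
    if_neg hyz.symm, if_neg hxz.symm, if_neg hyz, if_neg hxy, if_neg hxz]
  by_cases h : a = x
  · subst h; simp [hxy, hxz]
  · by_cases h' : a = y
    · subst h'; simp [h, hyz]
    · by_cases h'' : a = z
      · subst h''; simp [h, h']
      · simp [h, h', h'']

/-- An abstract length function on matrices: `ℓ N U` says that `U` has length at most `N`. -/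
structure IsLength (ℓ : ℕ → Matrix κ κ ℂ → Prop) : Prop where
  one : ℓ 0 1
  mono : ∀ {N M U}, ℓ N U → N ≤ M → ℓ M U
  mul : ∀ {N M U V}, ℓ N U → ℓ M V → ℓ (N + M) (U * V)
  star : ∀ {N U}, ℓ N U → ℓ N (star U)

variable {ℓ : ℕ → Matrix κ κ ℂ → Prop} {N : ℕ}

lemma exists_su_eliminate (a b : ℂ) : ∃ α β : ℂ, ‖α‖ ^ 2 + ‖β‖ ^ 2 = 1 ∧ β * a + conj α * b = 0 := by
  by_cases h : ‖a‖ ^ 2 + ‖b‖ ^ 2 = 0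
  · have hb : b = 0 := by
      have : ‖b‖ ^ 2 = 0 := by nlinarith [sq_nonneg ‖a‖, sq_nonneg ‖b‖]
      simpa using this
    exact ⟨1, 0, by simp, by simp [hb]⟩
  · have hpos : 0 < ‖a‖ ^ 2 + ‖b‖ ^ 2 := lt_of_le_of_ne (by positivity) (Ne.symm h)
    set r := √(‖a‖ ^ 2 + ‖b‖ ^ 2) with hr
    have hrpos : 0 < r := Real.sqrt_pos.2 hpos
    refine ⟨conj a / r, -b / r, ?_, ?_⟩
    · simp only [norm_div, norm_neg, RCLike.norm_conj, Complex.norm_real, Real.norm_eq_abs,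
        abs_of_pos hrpos, div_pow]
      rw [← add_div, hr, Real.sq_sqrt hpos.le, div_self h]
    · simp only [map_div₀, Complex.conj_conj, Complex.conj_ofReal]
      ring

/-- The entries on Z are rotated into x₀ one by one. The last clause allows a column to be cleared
without spoiling those that are already basis vectors. -/
lemma IsLength.eliminate (hℓ : IsLength ℓ) {x₀ : κ}
    (hT : ∀ y, x₀ ≠ y → ∀ α β : ℂ, ‖α‖ ^ 2 + ‖β‖ ^ 2 = 1 → ℓ N (twoLevel x₀ y (su α β)))
    (Z : Finset κ) (hZ : x₀ ∉ Z) (v : κ → ℂ) :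
    ∃ W ∈ unitary (Matrix κ κ ℂ), ℓ (Z.card * N) W ∧ (∀ x ∈ Z, (W *ᵥ v) x = 0) ∧
      (∀ y, y ∉ Z → y ≠ x₀ → (W *ᵥ v) y = v y) ∧
      ∀ f : κ → ℂ, (∀ x ∈ Z, f x = 0) → f x₀ = 0 → W *ᵥ f = f := by
  induction Z using Finset.induction_on with
  | empty => exact ⟨1, one_mem _, by simpa using hℓ.one, by simp, by simp, by simp⟩
  | insert y Z hy ih =>
    simp only [Finset.mem_insert, not_or] at hZ
    obtain ⟨W, hW, hWℓ, h0, h1, h2⟩ := ih hZ.2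
    obtain ⟨α, β, hαβ, hab⟩ := exists_su_eliminate ((W *ᵥ v) x₀) ((W *ᵥ v) y)
    refine ⟨twoLevel x₀ y (su α β) * W,
      mul_mem (twoLevel_mem_unitary hZ.1 (su_mem_unitary hαβ)) hW, ?_, ?_, ?_, ?_⟩
    · rw [Finset.card_insert_of_notMem hy, Nat.succ_mul, add_comm]
      exact hℓ.mul (hT y hZ.1 α β hαβ) hWℓ
    · intro x hx
      rw [← mulVec_mulVec, twoLevel_mulVec hZ.1]
      rcases Finset.mem_insert.1 hx with rfl | hx
      · rw [if_neg (Ne.symm hZ.1), if_pos rfl]; simpa [su] using hab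
      · rw [if_neg (fun e : x = x₀ => hZ.2 (e ▸ hx)),
          if_neg (fun e : x = y => hy (e ▸ hx)), h0 x hx]
    · intro x hx hx0
      simp only [Finset.mem_insert, not_or] at hx
      rw [← mulVec_mulVec, twoLevel_mulVec hZ.1, if_neg hx0, if_neg hx.1, h1 x hx.2 hx0]
    · intro f hf hf0
      rw [← mulVec_mulVec, h2 f (fun x hx => hf x (Finset.mem_insert_of_mem hx)) hf0]
      ext a
      rw [twoLevel_mulVec hZ.1, hf0, hf y (Finset.mem_insert_self _ _)]
      split_ifs with h h'
      · simp [h, hf0]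
      · simp [h', hf y (Finset.mem_insert_self _ _)]
      · rfl

lemma twoLevel_diagonal {x y : κ} (hxy : x ≠ y) (ζ : ℂ) :
    twoLevel x y (su ζ 0) = diagonal fun a => if a = x then ζ else if a = y then conj ζ else 1 := by
  rw [ext_iff_mulVec]
  intro f
  ext a
  rw [twoLevel_mulVec hxy, mulVec_diagonal]
  split_ifs with h h' <;> simp [su, *]

/-- Special rotations have determinant one, so a root ζ of order `Fintype.card κ` of z is used. The
rotations diag(ζ, conj ζ) of x₀ against every other level leave ζ^(card - 1) at x₀ and conj ζ
elsewhere; the global phase ζ corrects both. -/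
lemma IsLength.phase (hℓ : IsLength ℓ) (hφ : ∀ z : ℂ, ‖z‖ = 1 → ℓ 1 (z • 1)) {x₀ : κ}
    (hT : ∀ y, x₀ ≠ y → ∀ α β : ℂ, ‖α‖ ^ 2 + ‖β‖ ^ 2 = 1 → ℓ N (twoLevel x₀ y (su α β)))
    {z : ℂ} (hz : ‖z‖ = 1) :
    ℓ (Fintype.card κ * N + 1) (diagonal fun a => if a = x₀ then z else 1) := by
  have hcard : Fintype.card κ ≠ 0 := (Fintype.card_pos_iff.2 ⟨x₀⟩).ne'
  obtain ⟨ζ, hζ⟩ := IsAlgClosed.exists_pow_nat_eq z (Nat.pos_of_ne_zero hcard)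
  have hζ1 : ‖ζ‖ = 1 := by
    have : ‖ζ‖ ^ Fintype.card κ = 1 := by rw [← norm_pow, hζ, hz]
    exact (pow_eq_one_iff_of_nonneg (norm_nonneg _) hcard).1 this
  have hζζ : ζ * conj ζ = 1 := by
    rw [Complex.mul_conj, Complex.normSq_eq_norm_sq, hζ1]; simp
  have key : ∀ Z : Finset κ, x₀ ∉ Z → ℓ (Z.card * N)
      (diagonal fun a => if a = x₀ then ζ ^ Z.card else if a ∈ Z then conj ζ else 1) := by
    intro Z
    induction Z using Finset.induction_on with
    | empty => intro _; convert hℓ.one using 1 <;> simp [← diagonal_one]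
    | insert y Z hy ih =>
      intro hZ
      simp only [Finset.mem_insert, not_or] at hZ
      have h := hℓ.mul (ih hZ.2) (hT y hZ.1 ζ 0 (by simp [hζ1]))
      rw [twoLevel_diagonal hZ.1, diagonal_mul_diagonal] at h
      rw [Finset.card_insert_of_notMem hy, Nat.succ_mul]
      refine (congrArg (fun g => ℓ _ (diagonal g)) (funext fun a => ?_)).mp h
      by_cases h1 : a = x₀
      · simp [h1, pow_succ]
      · by_cases h2 : a = y
        · subst h2; simp [h1, hy]
        · simp [h1, h2]
  have h := hℓ.mul (key (Finset.univ.erase x₀) (by simp)) (hφ ζ hζ1)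
  rw [mul_smul_comm, mul_one] at h
  refine hℓ.mono (U := _) ?_ (Nat.add_le_add_right
    (Nat.mul_le_mul_right N (Finset.card_le_univ (Finset.univ.erase x₀))) 1)
  convert h using 1
  ext a b
  rw [Matrix.smul_apply, diagonal_apply, diagonal_apply]
  by_cases hab : a = b
  · subst hab
    by_cases h1 : a = x₀
    · simp only [h1, if_true, smul_eq_mul]
      rw [← pow_succ', Finset.card_erase_of_mem (Finset.mem_univ _), Finset.card_univ,
        Nat.sub_add_cancel (Nat.pos_of_ne_zero hcard), hζ]
    · simp [h1, hζζ]
  · simp [hab]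

/-- Every unitary is a product of two-level special unitaries and phases. -/
lemma IsLength.of_mem_unitary (hℓ : IsLength ℓ) (hφ : ∀ z : ℂ, ‖z‖ = 1 → ℓ 1 (z • 1))
    (hT : ∀ x y, x ≠ y → ∀ α β : ℂ, ‖α‖ ^ 2 + ‖β‖ ^ 2 = 1 → ℓ N (twoLevel x y (su α β)))
    {U : Matrix κ κ ℂ} (hU : U ∈ unitary (Matrix κ κ ℂ)) :
    ℓ (Fintype.card κ * (Fintype.card κ * N + (Fintype.card κ * N + 1))) U := by
  -- Z contains the basis vectors that U may still move; each induction step makes one more of them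
  -- fixed.
  suffices H : ∀ (Z : Finset κ) (U : Matrix κ κ ℂ), U ∈ unitary (Matrix κ κ ℂ) →
      (∀ y, y ∉ Z → U *ᵥ Pi.single y 1 = Pi.single y 1) →
      ℓ (Z.card * (Fintype.card κ * N + (Fintype.card κ * N + 1))) U from
    H Finset.univ U hU (by simp)
  intro Z
  induction Z using Finset.induction_on with
  | empty =>
    intro U _ h
    have : U = 1 := ext_of_mulVec_single fun y => by rw [h y (by simp), one_mulVec]
    rw [this]; simpa using hℓ.one
  | insert x₀ Z hx₀ ih =>
    intro U hU h
    set v := U *ᵥ Pi.single x₀ 1 with hv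
    obtain ⟨W, hW, hWℓ, h0, h1, h2⟩ := hℓ.eliminate (hT x₀) Z hx₀ v
    have hvU : ∀ a, v a = U a x₀ := fun a => by simp [hv]
    -- The columns outside `insert x₀ Z` are basis vectors, and column x₀ is orthogonal to them.
    have hv0 : ∀ y, y ∉ Z → y ≠ x₀ → v y = 0 := by
      intro y hy hyx
      have e := congrFun (congrFun hU.1 y) x₀
      have hcol : ∀ a, U a y = if a = y then 1 else 0 := by
        intro a
        have := congrFun (h y (by simp [hy, hyx])) a
        simpa [Pi.single_apply] using this
      rw [mul_apply, one_apply_ne hyx] at e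
      simp only [star_apply, hcol] at e
      simpa [hvU, apply_ite] using e
    set w := W *ᵥ v with hw
    have hw0 : ∀ a, a ≠ x₀ → w a = 0 := by
      intro a ha
      by_cases haZ : a ∈ Z
      · exact h0 a haZ
      · rw [h1 a haZ ha, hv0 a haZ ha]
    have hWU : W * U ∈ unitary (Matrix κ κ ℂ) := mul_mem hW hU
    have hz : ‖w x₀‖ = 1 := by
      have e := congrFun (congrFun hWU.1 x₀) x₀
      have hcol : ∀ a, (W * U) a x₀ = w a := by
        intro a
        rw [hw, hv, mulVec_mulVec]; simp
      rw [mul_apply, one_apply_eq, Finset.sum_eq_single x₀] at e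
      · rw [star_apply, hcol, Complex.star_def, mul_comm, Complex.mul_conj,
          Complex.normSq_eq_norm_sq] at e
        have e' : ‖w x₀‖ ^ 2 = 1 := by exact_mod_cast e
        exact (pow_eq_one_iff_of_nonneg (norm_nonneg _) two_ne_zero).1 e'
      · intro b _ hb
        rw [hcol, hw0 b hb, mul_zero]
      · simp
    set Dg : Matrix κ κ ℂ := diagonal fun a => if a = x₀ then w x₀ else 1 with hDg
    have hDℓ := hℓ.phase hφ (hT x₀) hz
    have hzz : w x₀ * conj (w x₀) = 1 := by
      rw [Complex.mul_conj, Complex.normSq_eq_norm_sq, hz]; simp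
    have hDu : Dg ∈ unitary (Matrix κ κ ℂ) := by
      rw [Unitary.mem_iff, star_eq_conjTranspose, hDg, diagonal_conjTranspose,
        diagonal_mul_diagonal, diagonal_mul_diagonal, ← diagonal_one]
      constructor <;> congr 1 <;> ext a <;> by_cases ha : a = x₀ <;>
        simp [ha, hzz, mul_comm (conj (w x₀))]
    have hU' : Star.star Dg * (W * U) ∈ unitary (Matrix κ κ ℂ) :=
      mul_mem (Unitary.star_mem hDu) hWU
    have hfix := ih _ hU' ?_
    · have hprod := hℓ.mul (hℓ.mul (hℓ.star hWℓ) hDℓ) hfix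
      have e : Star.star W * Dg * (Star.star Dg * (W * U)) = U := by
        rw [mul_assoc, ← mul_assoc Dg, hDu.2, one_mul, ← mul_assoc, hW.1, one_mul]
      rw [e] at hprod
      refine hℓ.mono hprod ?_
      rw [Finset.card_insert_of_notMem hx₀]
      have : Z.card * N ≤ Fintype.card κ * N := Nat.mul_le_mul_right N (Finset.card_le_univ Z)
      nlinarith
    · intro y hy
      rw [star_eq_conjTranspose, hDg, diagonal_conjTranspose]
      by_cases hyx : y = x₀
      · subst hyx
        rw [← mulVec_mulVec, ← mulVec_mulVec, ← hv, ← hw]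
        ext a
        rw [mulVec_diagonal]
        by_cases ha : a = y
        · subst ha; simp [mul_comm (conj (w a)), hzz]
        · simp [ha, hw0 a ha]
      · rw [← mulVec_mulVec, ← mulVec_mulVec, h y (by simp [hy, hyx]), h2]
        · ext a
          rw [mulVec_diagonal]
          by_cases ha : a = x₀
          · subst ha; simp [Ne.symm hyx]
          · simp [ha]
        · intro x hx
          simp [show x ≠ y from fun e => hy (e ▸ hx)]
        · simp [Ne.symm hyx]

end TwoLevel

/-! ### Commutators in `SU(2)` -/

section Commutators

open Matrix ComplexConjugate

/-- `u` is a commutator of two elements of `SU(2)`. -/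
def IsSUCommutator (u : Matrix (Fin 2) (Fin 2) ℂ) : Prop :=
  ∃ α β α' β' : ℂ, ‖α‖ ^ 2 + ‖β‖ ^ 2 = 1 ∧ ‖α'‖ ^ 2 + ‖β'‖ ^ 2 = 1 ∧
    u = su α β * su α' β' * (star (su α β) * star (su α' β'))

/-- Conjugation by the quarter turn inverts diagonal rotations, so its commutator with the one of
angle s/2 doubles that angle. -/
lemma isSUCommutator_phase (s : ℝ) : IsSUCommutator (su (Complex.exp (s * Complex.I)) 0) := by
  refine ⟨Complex.exp ((s / 2 : ℝ) * Complex.I), 0, 0, 1, ?_, by simp, ?_⟩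
  · rw [Complex.norm_exp_ofReal_mul_I]; simp
  · rw [su_star, su_star, su_mul, su_mul, su_mul]
    congr 1
    · simp only [RingHom.map_zero, mul_zero, zero_mul, zero_sub, sub_zero, zero_add, mul_one, mul_neg, neg_neg, Complex.conj_conj]
      rw [← Complex.exp_add]
      congr 1
      push_cast
      ring
    · simp

/-- Likewise diag(i, -i) inverts the real rotations, and the commutator doubles φ/2. -/
lemma isSUCommutator_rotation (φ : ℝ) :
    IsSUCommutator (su (Real.cos φ : ℝ) (Real.sin φ : ℝ)) := by
  have hI : Complex.I ^ 2 = -1 := Complex.I_sq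
  refine ⟨(Real.cos (φ / 2) : ℝ), (Real.sin (φ / 2) : ℝ), Complex.I, 0, ?_, by simp, ?_⟩
  · rw [Complex.norm_real, Complex.norm_real, Real.norm_eq_abs, Real.norm_eq_abs, sq_abs, sq_abs]
    exact Real.cos_sq_add_sin_sq _
  · rw [su_star, su_star, su_mul, su_mul, su_mul]
    have e : φ = φ / 2 + φ / 2 := by ring
    congr 1
    · conv_lhs => rw [e, Real.cos_add]
      simp only [RingHom.map_zero, RingHom.map_neg, RingHom.map_mul, RingHom.map_add,
        Complex.conj_ofReal, Complex.conj_I]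
      push_cast
      ring_nf
      rw [hI]
      ring
    · conv_lhs => rw [e, Real.sin_add]
      simp only [RingHom.map_zero, RingHom.map_neg, RingHom.map_mul, RingHom.map_sub,
        Complex.conj_ofReal, Complex.conj_I]
      push_cast
      ring_nf
      rw [hI]
      ring

/-- Euler angles: the moduli of α and β determine the middle rotation, half the difference and half
the sum of their arguments the diagonal factors. Commutators are wanted because a further control
can be attached to them. -/
lemma exists_commutator_factors {α β : ℂ} (h : ‖α‖ ^ 2 + ‖β‖ ^ 2 = 1) :
    ∃ u v w, IsSUCommutator u ∧ IsSUCommutator v ∧ IsSUCommutator w ∧ su α β = u * v * w := by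
  refine ⟨_, _, _, isSUCommutator_phase ((α.arg - β.arg) / 2),
    isSUCommutator_rotation (Real.arccos ‖α‖), isSUCommutator_phase ((α.arg + β.arg) / 2), ?_⟩
  have hα : ‖α‖ ≤ 1 := by nlinarith [norm_nonneg α, sq_nonneg ‖β‖]
  have hsin : Real.sin (Real.arccos ‖α‖) = ‖β‖ := by
    rw [Real.sin_arccos, show 1 - ‖α‖ ^ 2 = ‖β‖ ^ 2 by linarith, Real.sqrt_sq (norm_nonneg _)]
  rw [su_mul, su_mul, Real.cos_arccos (by linarith [norm_nonneg α]) hα, hsin]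
  congr 1
  · simp only [map_zero, zero_mul, sub_zero, mul_zero]
    rw [mul_right_comm, ← Complex.exp_add]
    conv_lhs => rw [← Complex.norm_mul_exp_arg_mul_I α]
    rw [mul_comm]
    congr 2
    push_cast
    ring
  · simp only [map_zero, zero_mul, zero_add, mul_zero, add_zero, sub_zero,
      ← Complex.exp_conj, map_mul, Complex.conj_ofReal, Complex.conj_I]
    rw [mul_right_comm, ← Complex.exp_add]
    conv_lhs => rw [← Complex.norm_mul_exp_arg_mul_I β]
    rw [mul_comm]
    congr 2
    push_cast
    ring

end Commutators

/-! ### Controlled operations on a single subsystem -/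

section Site

open Matrix

variable {ι : Type} [Fintype ι] [DecidableEq ι] {D : ι → ℕ}

/-- The operation `f z` on the subsystem `i`, controlled by the configuration `z`. -/
def siteOp (i : ι) (f : Config D → Matrix (Fin (D i)) (Fin (D i)) ℂ) : Op D :=
  of fun x y => if ∀ j, j ≠ i → x j = y j then f x (x i) (y i) else 0

/-- The control `f` does not depend on the configuration of subsystem `i`. -/
def Insensitive (i : ι) (f : Config D → Matrix (Fin (D i)) (Fin (D i)) ℂ) : Prop :=
  ∀ x y : Config D, (∀ j, j ≠ i → x j = y j) → f x = f y

lemma siteOp_mulVec (i : ι) (f : Config D → Matrix (Fin (D i)) (Fin (D i)) ℂ) (ψ : Config D → ℂ)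
    (x : Config D) :
    (siteOp i f *ᵥ ψ) x = (f x *ᵥ fun s => ψ (Function.update x i s)) (x i) := by
  have hup : ∀ y : Config D, (∀ j, j ≠ i → x j = y j) → Function.update x i (y i) = y := by
    intro y hy
    ext j
    by_cases hj : j = i
    · subst hj; simp
    · simp [hj, hy j hj]
  simp only [mulVec, dotProduct, siteOp, of_apply, ite_mul, zero_mul]
  rw [← Finset.sum_filter]
  refine Finset.sum_nbij' (fun y => y i) (fun s => Function.update x i s) ?_ ?_ ?_ ?_ ?_
  · simp
  · intro s _
    simp only [Finset.mem_filter, Finset.mem_univ, true_and]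
    intro j hj; simp [hj]
  · intro y hy
    exact hup y (by simpa using hy)
  · simp
  · intro y hy
    rw [hup y (by simpa using hy)]

lemma siteOp_mul (i : ι) (f g : Config D → Matrix (Fin (D i)) (Fin (D i)) ℂ)
    (hg : Insensitive i g) : siteOp i f * siteOp i g = siteOp i fun x => f x * g x := by
  rw [ext_iff_mulVec]
  intro ψ
  ext x
  rw [← mulVec_mulVec, siteOp_mulVec, siteOp_mulVec, ← mulVec_mulVec]
  congr 2
  ext s
  rw [siteOp_mulVec, hg (Function.update x i s) x (fun j hj => by simp [hj])]
  simp

lemma siteOp_one (i : ι) : siteOp (D := D) i (fun _ => 1) = 1 := by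
  rw [ext_iff_mulVec]
  intro ψ
  ext x
  rw [siteOp_mulVec]
  simp

lemma siteOp_star (i : ι) (f : Config D → Matrix (Fin (D i)) (Fin (D i)) ℂ)
    (hf : Insensitive i f) : star (siteOp i f) = siteOp i fun x => star (f x) := by
  ext x y
  simp only [siteOp, of_apply, star_apply]
  by_cases h : ∀ j, j ≠ i → x j = y j
  · rw [if_pos h, if_pos fun j hj => (h j hj).symm, hf x y h]
  · rw [if_neg h, if_neg fun h' => h fun j hj => (h' j hj).symm, star_zero]

lemma siteOp_mem_unitary (i : ι) (f : Config D → Matrix (Fin (D i)) (Fin (D i)) ℂ)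
    (hf : Insensitive i f) (hu : ∀ x, f x ∈ unitary (Matrix (Fin (D i)) (Fin (D i)) ℂ)) :
    siteOp i f ∈ unitary (Op D) := by
  have hf' : Insensitive i fun x => star (f x) := fun x y h => by
    change star (f x) = star (f y)
    rw [hf x y h]
  rw [Unitary.mem_iff, siteOp_star i f hf, siteOp_mul _ _ _ hf, siteOp_mul _ _ _ hf', ← siteOp_one i]
  constructor <;> congr 1 <;> ext1 x
  exacts [(hu x).1, (hu x).2]

lemma siteOp_actsOn (i : ι) (Y : Finset ι) (f : Config D → Matrix (Fin (D i)) (Fin (D i)) ℂ)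
    (hf : ∀ x y : Config D, (∀ j ∈ Y, x j = y j) → f x = f y) :
    ActsOn (insert i Y) (siteOp i f) := by
  constructor
  · rintro x y ⟨j, hj, hxy⟩
    rw [siteOp, of_apply, if_neg]
    exact fun h => hxy (h j fun e => hj (by simp [e]))
  · intro x y x' y' e e' hx hy
    have hiff : (∀ j, j ≠ i → x j = y j) ↔ ∀ j, j ≠ i → x' j = y' j := by
      refine forall_congr' fun j => imp_congr_right fun hj => ?_
      by_cases hjY : j ∈ insert i Y
      · rw [hx j hjY, hy j hjY]
      · simp [e j hjY, e' j hjY]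
    simp only [siteOp, of_apply, hiff, hf x x' fun j hj => hx j (by simp [hj]), hx i (by simp),
      hy i (by simp)]

/-- `u` if the subsystems in `Y` are in the configuration `x₀`, the identity otherwise. -/
def controlled {i : ι} (Y : Finset ι) (x₀ : Config D) (u : Matrix (Fin (D i)) (Fin (D i)) ℂ) :
    Config D → Matrix (Fin (D i)) (Fin (D i)) ℂ :=
  fun x => if ∀ j ∈ Y, x j = x₀ j then u else 1

lemma controlled_congr {i : ι} (Y : Finset ι) (x₀ : Config D)
    (u : Matrix (Fin (D i)) (Fin (D i)) ℂ) (x y : Config D) (h : ∀ j ∈ Y, x j = y j) :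
    controlled Y x₀ u x = controlled Y x₀ u y := by
  have : (∀ j ∈ Y, x j = x₀ j) ↔ ∀ j ∈ Y, y j = x₀ j :=
    forall_congr' fun j => imp_congr_right fun hj => by rw [h j hj]
  simp only [controlled, this]

lemma controlled_insensitive {i : ι} {Y : Finset ι} (hi : i ∉ Y) (x₀ : Config D)
    (u : Matrix (Fin (D i)) (Fin (D i)) ℂ) : Insensitive i (controlled Y x₀ u) :=
  fun x y h => controlled_congr Y x₀ u x y fun j hj => h j fun e => hi (e ▸ hj)

lemma controlled_mem_unitary {i : ι} (Y : Finset ι) (x₀ : Config D)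
    {u : Matrix (Fin (D i)) (Fin (D i)) ℂ} (hu : u ∈ unitary (Matrix (Fin (D i)) (Fin (D i)) ℂ))
    (x : Config D) : controlled Y x₀ u x ∈ unitary (Matrix (Fin (D i)) (Fin (D i)) ℂ) := by
  unfold controlled
  split_ifs
  exacts [hu, one_mem _]

lemma controlled_mul {i : ι} {Y : Finset ι} (hi : i ∉ Y) (x₀ : Config D)
    (u v : Matrix (Fin (D i)) (Fin (D i)) ℂ) :
    siteOp i (controlled Y x₀ (u * v))
      = siteOp i (controlled Y x₀ u) * siteOp i (controlled Y x₀ v) := by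
  rw [siteOp_mul _ _ _ (controlled_insensitive hi _ _)]
  congr 1
  ext1 x
  simp only [controlled]
  split_ifs <;> simp

lemma controlled_star {i : ι} {Y : Finset ι} (hi : i ∉ Y) (x₀ : Config D)
    (u : Matrix (Fin (D i)) (Fin (D i)) ℂ) :
    siteOp i (controlled Y x₀ (star u)) = star (siteOp i (controlled Y x₀ u)) := by
  rw [siteOp_star _ _ (controlled_insensitive hi _ _)]
  congr 1
  ext1 x
  simp only [controlled]
  split_ifs <;> simp

/-- If one of the two controls fails, its operation is the identity and the commutator collapses. So
operations controlled by Y and by j produce one controlled by both. -/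
lemma controlled_commutator {i j : ι} {Y : Finset ι} (hi : i ∉ Y) (hij : i ≠ j) (x₀ : Config D)
    {u v : Matrix (Fin (D i)) (Fin (D i)) ℂ} (hu : u ∈ unitary (Matrix (Fin (D i)) (Fin (D i)) ℂ))
    (hv : v ∈ unitary (Matrix (Fin (D i)) (Fin (D i)) ℂ)) :
    siteOp i (controlled (insert j Y) x₀ (u * v * (star u * star v)))
      = siteOp i (controlled Y x₀ u) * siteOp i (controlled {j} x₀ v) *
        (star (siteOp i (controlled Y x₀ u)) * star (siteOp i (controlled {j} x₀ v))) := by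
  have hj : i ∉ ({j} : Finset ι) := by simpa using hij
  have h1 := controlled_insensitive hi x₀ (star u)
  have h2 := controlled_insensitive hj x₀ (star v)
  have h3 := controlled_insensitive hj x₀ v
  rw [← controlled_star hi, ← controlled_star hj, siteOp_mul _ _ _ h3, siteOp_mul _ _ _ h2,
    siteOp_mul]
  · congr 1
    ext1 x
    simp only [controlled, Finset.forall_mem_insert, Finset.mem_singleton, forall_eq]
    by_cases hjx : x j = x₀ j
    · simp only [hjx, true_and, if_true]
      split_ifs <;> simp [hv.2]
    · simp only [hjx, false_and, if_false]
      split_ifs <;> simp [hu.2]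
  · intro x y h
    change _ * _ = _ * _
    rw [h1 x y h, h2 x y h]

/-- The number of gates of a special two-level unitary with `m` controls. -/
def controlCost : ℕ → ℕ
  | 0 => 1
  | 1 => 1
  | m + 2 => 3 * (2 * controlCost (m + 1) + 2)

lemma one_le_controlCost (m : ℕ) : 1 ≤ controlCost m := by
  match m with
  | 0 => simp [controlCost]
  | 1 => simp [controlCost]
  | m + 2 => simp [controlCost]; omega

lemma controlCost_mono {m m' : ℕ} (h : m ≤ m') : controlCost m ≤ controlCost m' := by
  refine monotone_nat_of_le_succ (fun m => ?_) h
  match m with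
  | 0 => simp [controlCost]
  | m + 1 => simp only [controlCost]; omega

lemma len_controlled_of_card_le_one [Nonempty (Config D)] {i : ι} (Y : Finset ι)
    (hY : Y.card ≤ 1) (hi : i ∉ Y) (x₀ : Config D) {u : Matrix (Fin (D i)) (Fin (D i)) ℂ}
    (hu : u ∈ unitary (Matrix (Fin (D i)) (Fin (D i)) ℂ)) :
    Len 1 (siteOp i (controlled Y x₀ u)) := by
  refine Len.of_actsOn (X := insert i Y) ?_ (siteOp_actsOn i Y _ (controlled_congr Y x₀ u)) ?_
  · exact (Finset.card_insert_le _ _).trans (by omega)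
  · exact siteOp_mem_unitary _ _ (controlled_insensitive hi _ _) (controlled_mem_unitary _ _ hu)

lemma len_controlled [Nonempty (Config D)] {i : ι} {p q : Fin (D i)} (hpq : p ≠ q)
    (x₀ : Config D) (m : ℕ) : ∀ (Y : Finset ι), Y.card = m → i ∉ Y →
    ∀ α β : ℂ, ‖α‖ ^ 2 + ‖β‖ ^ 2 = 1 →
      Len (controlCost m) (siteOp i (controlled Y x₀ (twoLevel p q (su α β)))) := by
  induction m with
  | zero =>
    intro Y hY hi α β h
    exact len_controlled_of_card_le_one Y (by omega) hi x₀
      (twoLevel_mem_unitary hpq (su_mem_unitary h))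
  | succ m ih =>
    cases m with
    | zero =>
      intro Y hY hi α β h
      exact len_controlled_of_card_le_one Y (by omega) hi x₀
        (twoLevel_mem_unitary hpq (su_mem_unitary h))
    | succ m =>
      intro Y hY hi α β h
      obtain ⟨j, Y, hjY, rfl, hYc⟩ := Finset.card_eq_succ.1 hY
      simp only [Finset.mem_insert, not_or] at hi
      have hi' : i ∉ insert j Y := by simp [hi]
      have hcomm : ∀ u, IsSUCommutator u → Len (2 * controlCost (m + 1) + 2)
          (siteOp i (controlled (insert j Y) x₀ (twoLevel p q u))) := by
        rintro u ⟨a, b, a', b', hab, hab', rfl⟩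
        have hV : Len 1 (siteOp i (controlled {j} x₀ (twoLevel p q (su a' b')))) :=
          len_controlled_of_card_le_one {j} (by simp) (by simpa using hi.1) x₀
            (twoLevel_mem_unitary hpq (su_mem_unitary hab'))
        have hU := ih Y hYc hi.2 a b hab
        rw [twoLevel_mul hpq, twoLevel_mul hpq, twoLevel_mul hpq, twoLevel_star hpq,
          twoLevel_star hpq, controlled_commutator hi.2 hi.1 x₀
            (twoLevel_mem_unitary hpq (su_mem_unitary hab))
            (twoLevel_mem_unitary hpq (su_mem_unitary hab'))]
        exact ((hU.mul hV).mul (hU.star.mul hV.star)).mono (by omega)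
      obtain ⟨u, v, w, hu, hv, hw, e⟩ := exists_commutator_factors h
      rw [e, twoLevel_mul hpq, twoLevel_mul hpq, controlled_mul hi', controlled_mul hi']
      exact (((hcomm u hu).mul (hcomm v hv)).mul (hcomm w hw)).mono
        (by simp only [controlCost]; omega)

/-! ### Every unitary on a few subsystems is a product of boundedly many gates -/

/-- For configurations that differ at i alone, all the other subsystems in X merely serve as
controls. -/
lemma extend_twoLevel_eq_siteOp {X : Finset ι} {i : ι} (hiX : i ∈ X) (z : Config D)
    {x y : (i : X) → Fin (D i)} (hne : x ⟨i, hiX⟩ ≠ y ⟨i, hiX⟩)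
    (hxy : ∀ j : X, j ≠ ⟨i, hiX⟩ → x j = y j) (u : Matrix (Fin 2) (Fin 2) ℂ) :
    extend D X (twoLevel x y u)
      = siteOp i (controlled (X.erase i) (glue X x z) (twoLevel (x ⟨i, hiX⟩) (y ⟨i, hiX⟩) u)) := by
  have hxney : x ≠ y := fun h => hne (by rw [h])
  rw [ext_iff_mulVec]
  intro f
  ext a
  have hL : (extend D X (twoLevel x y u) *ᵥ f) a
      = (twoLevel x y u *ᵥ fun p => f (glue X p a)) (restr X a) := by
    rw [extend_mulVec]; rfl
  rw [hL, twoLevel_mulVec hxney, siteOp_mulVec]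
  by_cases hc : ∀ j ∈ X.erase i, a j = glue X x z j
  · have hax : ∀ j : X, j ≠ ⟨i, hiX⟩ → a j = x j := by
      intro j hj
      rw [hc j (Finset.mem_erase.2 ⟨fun e => hj (Subtype.ext e), j.2⟩)]
      simp [glue]
    have hupd : ∀ w : (i : X) → Fin (D i), (∀ j : X, j ≠ ⟨i, hiX⟩ → x j = w j) →
        glue X w a = Function.update a i (w ⟨i, hiX⟩) := by
      intro w hw
      ext j
      by_cases hj : j = i
      · subst hj; simp [glue, hiX]
      · by_cases hjX : j ∈ X
        · have hj' : (⟨j, hjX⟩ : X) ≠ ⟨i, hiX⟩ := fun e => hj (congrArg Subtype.val e)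
          simp [glue, hjX, hj, hax ⟨j, hjX⟩ hj', hw ⟨j, hjX⟩ hj']
        · simp [glue, hjX, hj]
    have hrestr : ∀ w : (i : X) → Fin (D i), (∀ j : X, j ≠ ⟨i, hiX⟩ → x j = w j) →
        (restr X a = w ↔ a i = w ⟨i, hiX⟩) := by
      intro w hw
      constructor
      · rintro rfl; rfl
      · intro h
        ext1 j
        by_cases hj : j = ⟨i, hiX⟩
        · subst hj; exact h
        · rw [← hw j hj]; exact hax j hj
    rw [controlled, if_pos hc, twoLevel_mulVec hne, hupd x (fun _ _ => rfl), hupd y hxy]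
    simp only [hrestr x (fun _ _ => rfl), hrestr y hxy, glue_restr, Function.update_eq_self]
  · have hx : ∀ w : (i : X) → Fin (D i), (∀ j : X, j ≠ ⟨i, hiX⟩ → x j = w j) → restr X a ≠ w := by
      rintro w hw rfl
      refine hc fun j hj => ?_
      have hjX := Finset.mem_of_mem_erase hj
      have hj' : (⟨j, hjX⟩ : X) ≠ ⟨i, hiX⟩ :=
        fun e => Finset.ne_of_mem_erase hj (congrArg Subtype.val e)
      simp [glue, hjX, hw ⟨j, hjX⟩ hj', restr]
    rw [controlled, if_neg hc, if_neg (hx x fun _ _ => rfl), if_neg (hx y hxy)]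
    simp

/-- One passes from x to y by changing one coordinate at a time. Each edge is a controlled operation
on one subsystem, and each edge after the first needs two conjugating quarter turns, whence 2m + 1.
-/
lemma len_extend_twoLevel [Nonempty (Config D)] (X : Finset ι) (m : ℕ) :
    ∀ x y : (i : X) → Fin (D i), x ≠ y → (Finset.univ.filter fun i => x i ≠ y i).card ≤ m + 1 →
    ∀ α β : ℂ, ‖α‖ ^ 2 + ‖β‖ ^ 2 = 1 →
      Len ((2 * m + 1) * controlCost X.card) (extend D X (twoLevel x y (su α β))) := by
  obtain ⟨z⟩ := ‹Nonempty (Config D)›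
  have edge : ∀ (i : X) (x y : (i : X) → Fin (D i)), x i ≠ y i → (∀ j, j ≠ i → x j = y j) →
      ∀ α β : ℂ, ‖α‖ ^ 2 + ‖β‖ ^ 2 = 1 →
        Len (controlCost X.card) (extend D X (twoLevel x y (su α β))) := by
    intro i x y hne hxy α β h
    have : Nonempty (Config D) := ⟨z⟩
    rw [extend_twoLevel_eq_siteOp i.2 z hne hxy]
    exact (len_controlled hne (glue X x z) _ _ rfl (by simp) α β h).mono
      (controlCost_mono Finset.card_erase_le)
  induction m with
  | zero =>
    intro x y hne hcard α β h
    obtain ⟨i, hi⟩ := Function.ne_iff.1 hne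
    have := edge i x y hi ?_ α β h
    · simpa using this
    · intro j hj
      by_contra hj'
      have h2 := Finset.card_le_one.1 hcard i (by simpa using hi) j (by simpa using hj')
      exact hj h2.symm
  | succ m ih =>
    intro x y hne hcard α β h
    obtain ⟨i, hi⟩ := Function.ne_iff.1 hne
    by_cases hx : x = Function.update y i (x i)
    · have := edge i x y hi ?_ α β h
      · exact this.mono (by nlinarith [one_le_controlCost X.card])
      · intro j hj
        have := congrFun hx j
        simpa [hj] using this
    · have hc : (Finset.univ.filter fun j => x j ≠ Function.update y i (x i) j).card ≤ m + 1 := by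
        have hss : (Finset.univ.filter fun j => x j ≠ Function.update y i (x i) j)
            ⊂ Finset.univ.filter fun j => x j ≠ y j := by
          rw [Finset.ssubset_iff_of_subset]
          · exact ⟨i, by simpa using hi, by simp⟩
          · intro j
            simp only [Finset.mem_filter, Finset.mem_univ, true_and]
            by_cases hj : j = i
            · subst hj; simp
            · simp [hj]
        have := Finset.card_lt_card hss
        omega
      have h1 := ih x _ hx hc α β h
      have hy : Function.update y i (x i) i ≠ y i := by simpa using hi
      have hy' : ∀ j, j ≠ i → Function.update y i (x i) j = y j := fun j hj => by simp [hj]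
      have h2 := edge i _ y hy hy' 0 1 (by simp)
      have h3 := edge i _ y hy hy' 0 (-1) (by simp)
      have := (h2.mul h1).mul h3
      rw [← extend_mul, ← extend_mul, twoLevel_conj hx (fun e => hy (congrFun e i)) hne] at this
      exact this.mono (by ring_nf; omega)

/-- Every unitary on at most `m` subsystems of dimension at most `q` is a product of a number of
elementary gates that is bounded in terms of `m` and `q`. -/
theorem exists_len_extend (m q : ℕ) : ∃ N : ℕ, ∀ {ι : Type} [Fintype ι] [DecidableEq ι]
    (D : ι → ℕ) [Nonempty (Config D)] (X : Finset ι), X.card ≤ m → (∀ i, D i ≤ q) →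
    ∀ A ∈ unitary (OpOn D X), Len N (extend D X A) := by
  -- A bound for the dimension of the local space; the base q + 1 is positive, so the power is
  -- monotone in the exponent.
  set c := (q + 1) ^ m
  set M := (2 * m + 1) * controlCost m
  refine ⟨c * (c * M + (c * M + 1)), ?_⟩
  intro ι _ _ D _ X hX hD A hA
  have hℓ : IsLength fun N (U : OpOn D X) => Len N (extend D X U) := by
    refine ⟨?_, fun h hNM => h.mono hNM, fun h h' => ?_, fun h => ?_⟩
    · rw [extend_one]; exact Len.one
    · rw [extend_mul]; exact h.mul h'
    · rw [extend_star]; exact h.star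
  have h := hℓ.of_mem_unitary (N := M) ?_ ?_ hA
  · have hc : Fintype.card ((i : X) → Fin (D i)) ≤ c := by
      rw [Fintype.card_pi]
      calc ∏ i : X, Fintype.card (Fin (D i)) ≤ ∏ _i : X, (q + 1) :=
            Finset.prod_le_prod' fun i _ => by simpa using (hD i).trans (Nat.le_succ q)
        _ = (q + 1) ^ X.card := by simp
        _ ≤ c := Nat.pow_le_pow_right (Nat.succ_pos q) hX
    exact h.mono (by gcongr)
  · intro z hz
    rw [extend_smul, extend_one]
    exact Len.phase hz
  · intro x y hxy α β hαβ
    have := len_extend_twoLevel X m x y hxy ?_ α β hαβ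
    · exact this.mono (Nat.mul_le_mul_left _ (controlCost_mono hX))
    · refine (Finset.card_le_univ _).trans ?_
      simp; omega

end Site

/-! ### Quantum walks -/

section Walk

variable {E : Type*} [NormedAddCommGroup E] [InnerProductSpace ℂ E]

/-- A projection `P` and an involution `B` such that `2 P - 1` and `B` are isometric. -/
structure IsWalkPair (P B : Module.End ℂ E) : Prop where
  proj : P * P = P
  invol : B * B = 1
  norm_refl : ∀ v, ‖(2 * P - 1) v‖ = ‖v‖
  norm_invol : ∀ v, ‖B v‖ = ‖v‖

/-- A step of the quantum walk. -/
def walk (P B : Module.End ℂ E) : Module.End ℂ E := (2 * P - 1) * B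

/-- The inverse of a step of the quantum walk. -/
def walkInv (P B : Module.End ℂ E) : Module.End ℂ E := B * (2 * P - 1)

/-- Two phase rotations about the range of `P`, as seen after `D` steps of the quantum walk in
either direction. -/
def walkPhase (P B : Module.End ℂ E) (D : ℕ) (c : ℂ) : Module.End ℂ E :=
  (walk P B ^ D * (1 + c • (1 - P)) * walkInv P B ^ D) *
    (walkInv P B ^ D * (1 + c • (1 - P)) * walk P B ^ D)

variable {P B : Module.End ℂ E} (h : IsWalkPair P B)

lemma norm_sq_sum_smul_of_orthonormal {I : Type*} [Fintype I] {η : I → E}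
    (hη : Orthonormal ℂ η) (b : I → ℂ) : ‖∑ i, b i • η i‖ ^ 2 = ∑ i, ‖b i‖ ^ 2 := by
  have := hη.inner_sum b b Finset.univ
  rw [inner_self_eq_norm_sq_to_K] at this
  have h3 : ((‖∑ i, b i • η i‖ ^ 2 : ℝ) : ℂ) = ((∑ i, ‖b i‖ ^ 2 : ℝ) : ℂ) := by
    push_cast
    rw [← Complex.coe_algebraMap] at *
    rw [show ((algebraMap ℝ ℂ) ‖∑ i, b i • η i‖ : ℂ) = ((‖∑ i, b i • η i‖ : ℝ) : ℂ) from rfl]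
    refine Eq.trans this (Finset.sum_congr rfl fun i _ => ?_)
    rw [mul_comm, Complex.mul_conj, Complex.normSq_eq_norm_sq]
    push_cast
    rfl
  exact_mod_cast h3

include h

lemma IsWalkPair.refl_mul_refl : (2 * P - 1) * (2 * P - 1) = 1 := by
  have : (2 * P - 1) * (2 * P - 1) = 4 * (P * P) - 4 * P + 1 := by noncomm_ring
  rw [this, h.proj]; noncomm_ring

lemma IsWalkPair.walk_mul_walkInv : walk P B * walkInv P B = 1 := by
  rw [walk, walkInv, mul_assoc, ← mul_assoc B, h.invol, one_mul, h.refl_mul_refl]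

lemma IsWalkPair.walkInv_mul_walk : walkInv P B * walk P B = 1 := by
  rw [walk, walkInv, mul_assoc, ← mul_assoc (2 * P - 1), h.refl_mul_refl, one_mul, h.invol]

lemma IsWalkPair.commute : Commute (walk P B) (walkInv P B) :=
  h.walk_mul_walkInv.trans h.walkInv_mul_walk.symm

lemma IsWalkPair.walk_pow_mul (D : ℕ) : walk P B ^ D * walkInv P B ^ D = 1 := by
  rw [← h.commute.mul_pow, h.walk_mul_walkInv, one_pow]

lemma IsWalkPair.walkInv_pow_mul (D : ℕ) : walkInv P B ^ D * walk P B ^ D = 1 := by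
  rw [← h.commute.symm.mul_pow, h.walkInv_mul_walk, one_pow]

/-- The reflection 2P - 1 conjugates the walk into its inverse. As it fixes the range of P, both
directions have the same projection there. -/
lemma IsWalkPair.walkInv_pow_eq (D : ℕ) :
    walkInv P B ^ D = (2 * P - 1) * walk P B ^ D * (2 * P - 1) := by
  induction D with
  | zero => simp [h.refl_mul_refl]
  | succ D ih =>
    have e : walkInv P B = (2 * P - 1) * walk P B * (2 * P - 1) := by
      rw [walk, walkInv, ← mul_assoc, h.refl_mul_refl, one_mul]
    rw [pow_succ, ih, e]
    simp only [mul_assoc]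
    rw [← mul_assoc (2 * P - 1) (2 * P - 1), h.refl_mul_refl, one_mul, pow_succ]
    simp only [mul_assoc]

lemma IsWalkPair.norm_walk_pow (D : ℕ) (v : E) : ‖(walk P B ^ D) v‖ = ‖v‖ := by
  induction D generalizing v with
  | zero => simp
  | succ D ih =>
    rw [pow_succ, Module.End.mul_apply, ih, walk, Module.End.mul_apply, h.norm_refl, h.norm_invol]

lemma IsWalkPair.norm_walkInv_pow (D : ℕ) (v : E) : ‖(walkInv P B ^ D) v‖ = ‖v‖ := by
  induction D generalizing v with
  | zero => simp
  | succ D ih =>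
    rw [pow_succ, Module.End.mul_apply, ih, walkInv, Module.End.mul_apply, h.norm_invol, h.norm_refl]

/-- 1 - P is half the difference of the identity and an isometry. -/
lemma IsWalkPair.norm_compl (v : E) : ‖(1 - P) v‖ ≤ ‖v‖ := by
  have e : (1 - P) v = (1 / 2 : ℂ) • (v - (2 * P - 1) v) := by
    simp only [two_mul, LinearMap.sub_apply, LinearMap.add_apply, Module.End.one_apply]
    module
  rw [e, norm_smul]
  have := norm_sub_le v ((2 * P - 1) v)
  rw [h.norm_refl] at this
  rw [show ‖(1 / 2 : ℂ)‖ = 1 / 2 by norm_num]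
  linarith

variable {η : E} {φ : ℝ} (hη : P η = η) (hφ : P (B η) = (Real.cos φ : ℂ) • η)

include hη hφ

omit h in
-- Here W⁻¹η = Bη and Wη = 2 cos φ η - Bη, so the part outside the line of η cancels.
lemma walk_add_walkInv : walk P B η + walkInv P B η = (2 * Real.cos φ : ℂ) • η := by
  have h1 : (2 * P - 1) η = η := by
    simp only [two_mul, LinearMap.sub_apply, LinearMap.add_apply, Module.End.one_apply, hη]
    abel
  rw [walk, walkInv, Module.End.mul_apply, Module.End.mul_apply, h1]
  simp only [two_mul, LinearMap.sub_apply, LinearMap.add_apply, Module.End.one_apply, hφ]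
  module

/-- The Chebyshev recursion W^(j+2) = W^(j+1)(W + W⁻¹) - W^j, applied to η, is the one satisfied by
cos(jφ). -/
lemma IsWalkPair.walk_pow_add (j : ℕ) :
    (walk P B ^ j) η + (walkInv P B ^ j) η = (2 * Real.cos (j * φ) : ℂ) • η := by
  induction j using Nat.twoStepInduction with
  | zero => simp; module
  | one => simpa using walk_add_walkInv hη hφ
  | more j ih1 ih2 =>
    have e1 : (walk P B ^ (j + 2)) η
        = (walk P B ^ (j + 1)) (walk P B η + walkInv P B η) - (walk P B ^ j) η := by
      rw [map_add, ← Module.End.mul_apply, ← Module.End.mul_apply, ← pow_succ, pow_succ (walk P B) j,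
        mul_assoc, h.walk_mul_walkInv, mul_one]
      abel
    have e2 : (walkInv P B ^ (j + 2)) η
        = (walkInv P B ^ (j + 1)) (walk P B η + walkInv P B η) - (walkInv P B ^ j) η := by
      rw [map_add, ← Module.End.mul_apply, ← Module.End.mul_apply, ← pow_succ,
        pow_succ (walkInv P B) j, mul_assoc, h.walkInv_mul_walk, mul_one]
      abel
    rw [e1, e2, walk_add_walkInv hη hφ, map_smul, map_smul]
    have e3 : ∀ a b c d : E, (2 * Real.cos φ : ℂ) • a - b + ((2 * Real.cos φ : ℂ) • c - d)
        = (2 * Real.cos φ : ℂ) • (a + c) - (b + d) := fun a b c d => by module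
    rw [e3, ih1, ih2, smul_smul, ← sub_smul]
    congr 1
    have : Real.cos ((j + 2 : ℕ) * φ)
        = 2 * Real.cos φ * Real.cos ((j + 1 : ℕ) * φ) - Real.cos (j * φ) := by
      have a1 : ((j + 2 : ℕ) : ℝ) * φ = (j + 1 : ℕ) * φ + φ := by push_cast; ring
      have a2 : (j : ℝ) * φ = (j + 1 : ℕ) * φ - φ := by push_cast; ring
      rw [a1, a2, Real.cos_add, Real.cos_sub]
      ring
    rw [this]
    push_cast
    ring

lemma IsWalkPair.proj_walk_pow (j : ℕ) : P ((walk P B ^ j) η) = (Real.cos (j * φ) : ℂ) • η ∧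
    P ((walkInv P B ^ j) η) = (Real.cos (j * φ) : ℂ) • η := by
  have hS : (2 * P - 1) η = η := by
    simp only [two_mul, LinearMap.sub_apply, LinearMap.add_apply, Module.End.one_apply, hη]
    abel
  have hPS : P * (2 * P - 1) = P := by
    have : P * (2 * P - 1) = 2 * (P * P) - P := by noncomm_ring
    rw [this, h.proj]; noncomm_ring
  have heq : P ((walkInv P B ^ j) η) = P ((walk P B ^ j) η) := by
    rw [h.walkInv_pow_eq, Module.End.mul_apply, hS, Module.End.mul_apply,
      ← Module.End.mul_apply P, hPS]
  have hsum := congrArg P (h.walk_pow_add hη hφ j)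
  rw [map_add, heq, map_smul, hη] at hsum
  have : P ((walk P B ^ j) η) = (Real.cos (j * φ) : ℂ) • η := by
    have h2 : (2 : ℂ) • P ((walk P B ^ j) η) = (2 : ℂ) • ((Real.cos (j * φ) : ℂ) • η) := by
      rw [two_smul, hsum, smul_smul]
    exact (IsUnit.mk0 (2 : ℂ) two_ne_zero).smul_left_cancel.1 h2
  exact ⟨this, heq.trans this⟩

/-- Inserting the projections cos(Dφ)η gives 2η - cos(Dφ)(W^D + W^(-D))η = 2(1 - cos²(Dφ))η. A
single summand need not be a multiple of η, which is why `walkPhase` uses both directions. -/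
lemma IsWalkPair.compl_walk_pow (D : ℕ) :
    (walk P B ^ D) ((1 - P) ((walkInv P B ^ D) η)) + (walkInv P B ^ D) ((1 - P) ((walk P B ^ D) η))
      = (2 * Real.sin (D * φ) ^ 2 : ℂ) • η := by
  obtain ⟨h1, h2⟩ := h.proj_walk_pow hη hφ D
  rw [LinearMap.sub_apply, LinearMap.sub_apply, Module.End.one_apply, Module.End.one_apply, h1, h2,
    map_sub, map_sub, map_smul, map_smul, ← Module.End.mul_apply, ← Module.End.mul_apply,
    h.walk_pow_mul, h.walkInv_pow_mul, Module.End.one_apply]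
  have e : η - (Real.cos (D * φ) : ℂ) • (walk P B ^ D) η
        + (η - (Real.cos (D * φ) : ℂ) • (walkInv P B ^ D) η)
      = (2 : ℂ) • η - (Real.cos (D * φ) : ℂ) • ((walk P B ^ D) η + (walkInv P B ^ D) η) := by
    module
  rw [e, h.walk_pow_add hη hφ, smul_smul, ← sub_smul]
  congr 1
  have : Real.sin (D * φ) ^ 2 = 1 - Real.cos (D * φ) ^ 2 := by
    rw [← Real.sin_sq_add_cos_sq (D * φ)]; ring
  rw [← Complex.ofReal_pow, this]
  push_cast
  ring

omit hη hφ

lemma IsWalkPair.walkPhase_apply (D : ℕ) (c : ℂ) (v : E) :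
    walkPhase P B D c v = v
      + c • ((walk P B ^ D) ((1 - P) ((walkInv P B ^ D) v))
        + (walkInv P B ^ D) ((1 - P) ((walk P B ^ D) v)))
      + c ^ 2 • (walk P B ^ D) ((1 - P) ((walkInv P B ^ D)
        ((walkInv P B ^ D) ((1 - P) ((walk P B ^ D) v))))) := by
  have e1 : walk P B ^ D * (1 + c • (1 - P)) * walkInv P B ^ D
      = 1 + c • (walk P B ^ D * (1 - P) * walkInv P B ^ D) := by
    rw [mul_add, add_mul, mul_one, h.walk_pow_mul, mul_smul_comm, smul_mul_assoc]
  have e2 : walkInv P B ^ D * (1 + c • (1 - P)) * walk P B ^ D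
      = 1 + c • (walkInv P B ^ D * (1 - P) * walk P B ^ D) := by
    rw [mul_add, add_mul, mul_one, h.walkInv_pow_mul, mul_smul_comm, smul_mul_assoc]
  rw [walkPhase, e1, e2]
  generalize hQ : walk P B ^ D * (1 - P) * walkInv P B ^ D = Q
  generalize hQ' : walkInv P B ^ D * (1 - P) * walk P B ^ D = Q'
  have a1 : ∀ w, (walk P B ^ D) ((1 - P) ((walkInv P B ^ D) w)) = Q w := fun w => by rw [← hQ]; rfl
  have a2 : ∀ w, (walkInv P B ^ D) ((1 - P) ((walk P B ^ D) w)) = Q' w := fun w => by rw [← hQ']; rfl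
  rw [a1, a2, a1]
  simp only [Module.End.mul_apply, LinearMap.add_apply, Module.End.one_apply, LinearMap.smul_apply,
    map_add, map_smul]
  module

/-- The error of one round of phase rotations on a superposition of eigenvectors. -/
lemma IsWalkPair.norm_walkPhase_sub_le {I : Type*} [Fintype I] {η : I → E} (hη : Orthonormal ℂ η)
    {φ : I → ℝ} (h1 : ∀ i, P (η i) = η i) (h2 : ∀ i, P (B (η i)) = (Real.cos (φ i) : ℂ) • η i)
    (D : ℕ) (c : ℂ) (a e : I → ℂ) {r : ℝ} (hr : 0 ≤ r)
    (he : ∀ i, a i ≠ 0 → ‖1 + 2 * c * Real.sin (D * φ i) ^ 2 - e i‖ ≤ r) :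
    ‖walkPhase P B D c (∑ i, a i • η i) - ∑ i, (a i * e i) • η i‖
      ≤ (r + ‖c‖ ^ 2) * ‖∑ i, a i • η i‖ := by
  set v := ∑ i, a i • η i with hv
  have hlin : (walk P B ^ D) ((1 - P) ((walkInv P B ^ D) v))
      + (walkInv P B ^ D) ((1 - P) ((walk P B ^ D) v))
      = ∑ i, (a i * (2 * Real.sin (D * φ i) ^ 2 : ℂ)) • η i := by
    simp only [hv, map_sum, map_smul]
    rw [← Finset.sum_add_distrib]
    refine Finset.sum_congr rfl fun i _ => ?_
    rw [← smul_add, h.compl_walk_pow (h1 i) (h2 i), smul_smul]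
  rw [h.walkPhase_apply, hlin]
  have hsplit : ∀ w : E, v + c • ∑ i, (a i * (2 * Real.sin (D * φ i) ^ 2 : ℂ)) • η i + w
      - ∑ i, (a i * e i) • η i
      = (∑ i, (a i * (1 + 2 * c * Real.sin (D * φ i) ^ 2 - e i)) • η i) + w := by
    intro w
    have : (∑ i, (a i * (1 + 2 * c * Real.sin (D * φ i) ^ 2 - e i)) • η i)
        = v + c • ∑ i, (a i * (2 * Real.sin (D * φ i) ^ 2 : ℂ)) • η i - ∑ i, (a i * e i) • η i := by
      rw [hv, Finset.smul_sum, ← Finset.sum_add_distrib, ← Finset.sum_sub_distrib]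
      exact Finset.sum_congr rfl fun i _ => by module
    rw [this]; abel
  rw [hsplit, add_mul]
  refine (norm_add_le _ _).trans (add_le_add ?_ ?_)
  · rw [← abs_of_nonneg (norm_nonneg (∑ i, _)), ← abs_of_nonneg (mul_nonneg hr (norm_nonneg v)),
      ← sq_le_sq, norm_sq_sum_smul_of_orthonormal hη, mul_pow, hv,
      norm_sq_sum_smul_of_orthonormal hη, Finset.mul_sum]
    refine Finset.sum_le_sum fun i _ => ?_
    rw [norm_mul, mul_pow, mul_comm]
    by_cases hi : a i = 0
    · simp [hi]
    · gcongr
      exact he i hi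
  -- The remaining term is of second order in c: a product of isometries and contractions times c².
  · rw [norm_smul, norm_pow]
    gcongr
    rw [h.norm_walk_pow]
    refine (h.norm_compl _).trans ?_
    rw [h.norm_walkInv_pow, h.norm_walkInv_pow]
    refine (h.norm_compl _).trans ?_
    rw [h.norm_walk_pow]

end Walk

/-! ### Spins together with ancillary qubits -/

section Register

open Matrix
open scoped Kronecker

variable {d n a : ℕ}

/-- A register of `a` qubits. -/
abbrev qubitDims (a : ℕ) : Fin a → ℕ := fun _ => 2

/-- A configuration of spins and ancillas is a pair of configurations. -/
def regEquiv (d n a : ℕ) :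
    Config (regDims d n a) ≃ Config (spinDims d n) × Config (qubitDims a) where
  toFun w := (fun i => w (Sum.inl i), fun j => w (Sum.inr j))
  invFun p := fun i => match i with
    | Sum.inl i => p.1 i
    | Sum.inr j => p.2 j
  left_inv w := by ext i; cases i <;> rfl
  right_inv p := rfl

/-- The tensor product of an operator on the spins and an operator on the ancillas. -/
def kr (M : Op (spinDims d n)) (F : Op (qubitDims a)) : Op (regDims d n a) :=
  (M ⊗ₖ F).submatrix (regEquiv d n a) (regEquiv d n a)

lemma kr_apply (M : Op (spinDims d n)) (F : Op (qubitDims a)) (w w' : Config (regDims d n a)) :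
    kr M F w w' = M (regEquiv d n a w).1 (regEquiv d n a w').1
      * F (regEquiv d n a w).2 (regEquiv d n a w').2 := rfl

lemma kr_mul (M M' : Op (spinDims d n)) (F F' : Op (qubitDims a)) :
    kr (M * M') (F * F') = kr M F * kr M' F' := by
  rw [kr, kr, kr, submatrix_mul_equiv, ← mul_kronecker_mul]

lemma kr_one : kr (1 : Op (spinDims d n)) (1 : Op (qubitDims a)) = 1 := by
  rw [kr, one_kronecker_one, submatrix_one_equiv]

lemma kr_star (M : Op (spinDims d n)) (F : Op (qubitDims a)) :
    star (kr M F) = kr (star M) (star F) := by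
  ext w w'; simp [kr_apply, star_apply]

lemma kr_add_left (M M' : Op (spinDims d n)) (F : Op (qubitDims a)) :
    kr (M + M') F = kr M F + kr M' F := by
  ext w w'; simp [kr_apply, add_mul]

lemma kr_add_right (M : Op (spinDims d n)) (F F' : Op (qubitDims a)) :
    kr M (F + F') = kr M F + kr M F' := by
  ext w w'; simp [kr_apply, mul_add]

lemma kr_smul_right (M : Op (spinDims d n)) (c : ℂ) (F : Op (qubitDims a)) :
    kr M (c • F) = c • kr M F := by
  ext w w'; simp [kr_apply, mul_left_comm]

lemma kr_neg_right (M : Op (spinDims d n)) (F : Op (qubitDims a)) : kr M (-F) = -kr M F := by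
  ext w w'; simp [kr_apply]

lemma kr_zero_right (M : Op (spinDims d n)) : kr M (0 : Op (qubitDims a)) = 0 := by
  ext w w'; simp [kr_apply]

lemma kr_mem_unitary {F : Op (qubitDims a)} (hF : F ∈ unitary (Op (qubitDims a))) :
    kr (1 : Op (spinDims d n)) F ∈ unitary (Op (regDims d n a)) := by
  rw [Unitary.mem_iff, kr_star, star_one, ← kr_mul, ← kr_mul, hF.1, hF.2, mul_one, kr_one]
  exact ⟨rfl, rfl⟩

lemma ActsOn.kr {X : Finset (Fin n)} {Z : Finset (Fin a)} {M : Op (spinDims d n)}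
    {F : Op (qubitDims a)} (hM : ActsOn X M) (hF : ActsOn Z F) :
    ActsOn (X.disjSum Z) (kr M F) := by
  constructor
  · rintro w w' ⟨i, hi, hne⟩
    rw [kr_apply]
    cases i with
    | inl i => rw [hM.1 _ _ ⟨i, by simpa using hi, hne⟩, zero_mul]
    | inr j => rw [hF.1 _ _ ⟨j, by simpa using hi, hne⟩, mul_zero]
  · intro x y x' y' e e' hx hy
    rw [kr_apply, kr_apply]
    congr 1
    · exact hM.2 _ _ _ _ (fun i hi => e (Sum.inl i) (by simpa using hi))
        (fun i hi => e' (Sum.inl i) (by simpa using hi)) (fun i hi => hx (Sum.inl i) (by simpa using hi))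
        fun i hi => hy (Sum.inl i) (by simpa using hi)
    · exact hF.2 _ _ _ _ (fun i hi => e (Sum.inr i) (by simpa using hi))
        (fun i hi => e' (Sum.inr i) (by simpa using hi)) (fun i hi => hx (Sum.inr i) (by simpa using hi))
        fun i hi => hy (Sum.inr i) (by simpa using hi)

lemma nonempty_regConfig (hd : 1 ≤ d) : Nonempty (Config (regDims d n a)) :=
  ⟨(regEquiv d n a).symm (fun _ => ⟨0, hd⟩, fun _ => 0)⟩

lemma len_kr_one (hd : 1 ≤ d) {Z : Finset (Fin a)} (hZ : Z.card ≤ 2) {F : Op (qubitDims a)}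
    (hF : ActsOn Z F) (hFu : F ∈ unitary (Op (qubitDims a))) :
    Len 1 (kr (1 : Op (spinDims d n)) F) := by
  have := nonempty_regConfig (n := n) (a := a) hd
  exact Len.of_actsOn (by simpa using hZ) ((actsOn_one ∅).kr hF) (kr_mem_unitary hFu)

/-- The product of a spin state and an ancilla state. -/
def tv (ψ : HilbertSp (spinDims d n)) (f : Config (qubitDims a) → ℂ) : HilbertSp (regDims d n a) :=
  WithLp.toLp 2 fun w => ψ (regEquiv d n a w).1 * f (regEquiv d n a w).2

lemma tv_apply (ψ : HilbertSp (spinDims d n)) (f : Config (qubitDims a) → ℂ)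
    (w : Config (regDims d n a)) :
    tv ψ f w = ψ (regEquiv d n a w).1 * f (regEquiv d n a w).2 := rfl

lemma tv_add_left (ψ ψ' : HilbertSp (spinDims d n)) (f : Config (qubitDims a) → ℂ) :
    tv (ψ + ψ') f = tv ψ f + tv ψ' f := by
  ext w; simp [tv_apply, add_mul]

lemma tv_smul_left (c : ℂ) (ψ : HilbertSp (spinDims d n)) (f : Config (qubitDims a) → ℂ) :
    tv (c • ψ) f = c • tv ψ f := by
  ext w; simp [tv_apply, mul_assoc]

lemma tv_zero_left (f : Config (qubitDims a) → ℂ) : tv (0 : HilbertSp (spinDims d n)) f = 0 := by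
  ext w; simp [tv_apply]

lemma tv_zero_right (ψ : HilbertSp (spinDims d n)) : tv ψ (0 : Config (qubitDims a) → ℂ) = 0 := by
  ext w; simp [tv_apply]

lemma tv_neg_right (ψ : HilbertSp (spinDims d n)) (f : Config (qubitDims a) → ℂ) :
    tv ψ (-f) = -tv ψ f := by
  ext w; simp [tv_apply]

lemma tv_neg_left (ψ : HilbertSp (spinDims d n)) (f : Config (qubitDims a) → ℂ) :
    tv (-ψ) f = -tv ψ f := by
  ext w; simp [tv_apply]

lemma tv_sum_smul_right {I : Type*} (s : Finset I) (ψ : HilbertSp (spinDims d n)) (c : I → ℂ)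
    (f : I → Config (qubitDims a) → ℂ) : tv ψ (∑ i ∈ s, c i • f i) = ∑ i ∈ s, c i • tv ψ (f i) := by
  ext w; simp [tv_apply, Finset.mul_sum, mul_left_comm]

lemma kr_tv (M : Op (spinDims d n)) (F : Op (qubitDims a)) (ψ : HilbertSp (spinDims d n))
    (f : Config (qubitDims a) → ℂ) :
    toEuclideanLin (kr M F) (tv ψ f) = tv (toEuclideanLin M ψ) (F *ᵥ f) := by
  ext w
  rw [tv_apply, toLpLin_apply, toLpLin_apply]
  simp only [mulVec, dotProduct, kr_apply, tv_apply]
  rw [Finset.sum_mul_sum, ← Fintype.sum_prod_type', ← (regEquiv d n a).sum_comp]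
  exact Finset.sum_congr rfl fun w' _ => by ring

lemma withAncilla_eq_tv (ψ : HilbertSp (spinDims d n)) :
    withAncilla a ψ = tv ψ (Pi.single (0 : Config (qubitDims a)) 1) := by
  ext w
  have : (∀ j : Fin a, (w (Sum.inr j)).val = 0) ↔ (regEquiv d n a w).2 = 0 := by
    rw [funext_iff]
    exact forall_congr' fun j => (Fin.ext_iff (a := w (Sum.inr j)) (b := (0 : Fin 2))).symm
  rw [tv_apply, Pi.single_apply]
  simp only [withAncilla, this]
  split_ifs
  · rw [mul_one]; rfl
  · rw [mul_zero]

/-- Adjoining ancillas in the state `|0 … 0⟩` as a linear isometry. -/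
def ancillaIsometry (d n a : ℕ) : HilbertSp (spinDims d n) →ₗᵢ[ℂ] HilbertSp (regDims d n a) where
  toFun ψ := withAncilla a ψ
  map_add' ψ ψ' := by simp only [withAncilla_eq_tv, tv_add_left]
  map_smul' c ψ := by simp only [withAncilla_eq_tv, tv_smul_left, RingHom.id_apply]
  norm_map' ψ := by
    change ‖withAncilla a ψ‖ = ‖ψ‖
    rw [withAncilla_eq_tv, EuclideanSpace.norm_eq, EuclideanSpace.norm_eq]
    congr 1
    simp only [tv_apply]
    rw [(regEquiv d n a).sum_comp (fun p => ‖ψ p.1 * (Pi.single (0 : Config (qubitDims a)) 1 :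
      Config (qubitDims a) → ℂ) p.2‖ ^ 2), Fintype.sum_prod_type]
    refine Finset.sum_congr rfl fun x _ => ?_
    rw [Finset.sum_eq_single 0]
    · simp
    · intro z _ hz; simp [hz]
    · simp

lemma ancillaIsometry_apply (ψ : HilbertSp (spinDims d n)) :
    ancillaIsometry d n a ψ = withAncilla a ψ := rfl

end Register

/-! ### Spreading a single excitation over the ancillary qubits -/

section OneHot

open Matrix

variable {d n L : ℕ}

/-- The code words of a one-hot code, with bit `j₀` flipped. -/
def codeBit (j₀ i k : Fin L) : Fin 2 := if (k = i) ↔ (k = j₀) then 0 else 1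

/-- Bit k alone tells code word k from all the others, so a control on a code word needs a single
qubit. -/
lemma codeBit_self_ne {j₀ i k : Fin L} (h : i ≠ k) : codeBit j₀ i k ≠ codeBit j₀ k k := by
  unfold codeBit
  by_cases hk : k = j₀ <;> simp [hk, h.symm]
  subst hk; simp [h.symm]

lemma codeBit_eq {j₀ i j k : Fin L} (hi : k ≠ i) (hj : k ≠ j) :
    codeBit j₀ i k = codeBit j₀ j k := by
  simp [codeBit, hi, hj]

lemma codeBit_base (j₀ k : Fin L) : codeBit j₀ j₀ k = 0 := by simp [codeBit]

/-- The code word `i`, preceded by the bit `s`. -/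
def codeWord (j₀ i : Fin L) (s : Fin 2) : Config (qubitDims (L + 1)) :=
  Fin.cons s (codeBit j₀ i)

@[simp] lemma codeWord_zero (j₀ i : Fin L) (s : Fin 2) : codeWord j₀ i s 0 = s := rfl

@[simp] lemma codeWord_succ (j₀ i k : Fin L) (s : Fin 2) :
    codeWord j₀ i s k.succ = codeBit j₀ i k := rfl

/-- The flipped bit makes the base word the initial state of the ancillas, so no preparation is
needed. -/
lemma codeWord_base (j₀ : Fin L) : codeWord j₀ j₀ 0 = 0 := by
  ext k
  refine Fin.cases ?_ (fun k => ?_) k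
  · simp
  · simp [codeBit_base]

lemma codeWord_injective (j₀ : Fin L) (s : Fin 2) : Function.Injective fun i => codeWord j₀ i s := by
  intro i j h
  by_contra hij
  exact codeBit_self_ne hij (by simpa using congrFun h j.succ)

/-- The matrix whose columns are the code words. -/
def codeMat (j₀ : Fin L) (s : Fin 2) : Matrix (Config (qubitDims (L + 1))) (Fin L) ℂ :=
  of fun z i => if z = codeWord j₀ i s then 1 else 0

/-- `F` acts as `p` on the code words. -/
def ActsAs (j₀ : Fin L) (F : Op (qubitDims (L + 1))) (p : Matrix (Fin L) (Fin L) ℂ) : Prop :=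
  ∀ s, F * codeMat j₀ s = codeMat j₀ s * p

lemma ActsAs.adjoint {j₀ : Fin L} {F : Op (qubitDims (L + 1))} {p : Matrix (Fin L) (Fin L) ℂ}
    (h : ActsAs j₀ F p) (hF : F ∈ unitary (Op (qubitDims (L + 1))))
    (hp : p ∈ unitary (Matrix (Fin L) (Fin L) ℂ)) : ActsAs j₀ (star F) (star p) := by
  intro s
  calc star F * codeMat j₀ s = star F * (codeMat j₀ s * (p * star p)) := by rw [hp.2, Matrix.mul_one]
    _ = star F * (F * codeMat j₀ s) * star p := by rw [h s]; simp only [Matrix.mul_assoc]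
    _ = (star F * F) * codeMat j₀ s * star p := by simp only [Matrix.mul_assoc]
    _ = codeMat j₀ s * star p := by rw [hF.1, Matrix.one_mul]

lemma ActsAs.mulVec_code {j₀ : Fin L} {F : Op (qubitDims (L + 1))} {p : Matrix (Fin L) (Fin L) ℂ}
    (h : ActsAs j₀ F p) (j : Fin L) (s : Fin 2) :
    F *ᵥ Pi.single (codeWord j₀ j s) 1 = ∑ i, p i j • Pi.single (codeWord j₀ i s) (1 : ℂ) := by
  have hcol : ∀ k, (Pi.single (codeWord j₀ k s) 1 : Config (qubitDims (L + 1)) → ℂ)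
      = codeMat j₀ s *ᵥ Pi.single k 1 := by
    intro k
    ext z
    simp [codeMat, Pi.single_apply]
  rw [hcol, mulVec_mulVec, h s, ← mulVec_mulVec]
  ext z
  simp [codeMat, Matrix.mulVec, dotProduct, Pi.single_apply]

/-- At the bits (j₀, y) the words j₀ and y read 00 and 11, while all other code words read 10. So a
gate on these two qubits rotates the two words into each other and fixes the rest, whatever the
leading bit. -/
lemma actsAs_twoLevel {j₀ y : Fin L} (hy : j₀ ≠ y) (u : Matrix (Fin 2) (Fin 2) ℂ) :
    ActsAs j₀ (extend (qubitDims (L + 1)) {j₀.succ, y.succ}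
      (twoLevel (restr {j₀.succ, y.succ} (codeWord j₀ j₀ 0))
        (restr {j₀.succ, y.succ} (codeWord j₀ y 0)) u)) (twoLevel j₀ y u) := by
  intro s
  set Z : Finset (Fin (L + 1)) := {j₀.succ, y.succ} with hZ
  have hmem : ∀ k : Fin L, k.succ ∈ Z ↔ k = j₀ ∨ k = y := by
    intro k; simp [hZ, Fin.succ_inj]
  have h0 : (0 : Fin (L + 1)) ∉ Z := by simp [hZ, Fin.succ_ne_zero, eq_comm]
  have hr : ∀ i (t t' : Fin 2), restr Z (codeWord j₀ i t) = restr Z (codeWord j₀ i t') := by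
    intro i t t'
    ext ⟨k, hk⟩
    revert hk
    refine Fin.cases (fun hk => absurd hk h0) (fun k hk => ?_) k
    simp [restr]
  have hrne : ∀ i j (t t' : Fin 2), (j = j₀ ∨ j = y) → i ≠ j →
      restr Z (codeWord j₀ i t) ≠ restr Z (codeWord j₀ j t') := by
    intro i j t t' hj hij he
    have := congrFun he ⟨j.succ, (hmem j).2 hj⟩
    exact codeBit_self_ne hij (by simpa [restr] using this)
  have hglue : ∀ i j (t t' : Fin 2), (i = j₀ ∨ i = y) → (j = j₀ ∨ j = y) →
      glue Z (restr Z (codeWord j₀ i t')) (codeWord j₀ j t) = codeWord j₀ i t := by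
    intro i j t t' hi hj
    ext k
    refine Fin.cases ?_ (fun k => ?_) k
    · simp [glue, h0]
    · by_cases hk : k = j₀ ∨ k = y
      · simp [glue, restr, (hmem k).2 hk]
      · have hk' : k.succ ∉ Z := fun h => hk ((hmem k).1 h)
        simp only [glue, hk', dif_neg, not_false_iff, codeWord_succ]
        rw [codeBit_eq (i := j) (j := i)]
        · rintro rfl; exact hk hj
        · rintro rfl; exact hk hi
  have hne : restr Z (codeWord j₀ j₀ 0) ≠ restr Z (codeWord j₀ y 0) :=
    hrne _ _ _ _ (Or.inr rfl) hy
  have hL : ∀ (f : Config (qubitDims (L + 1)) → ℂ) z, (extend (qubitDims (L + 1)) Z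
      (twoLevel (restr Z (codeWord j₀ j₀ 0)) (restr Z (codeWord j₀ y 0)) u) *ᵥ f) z
      = (twoLevel (restr Z (codeWord j₀ j₀ 0)) (restr Z (codeWord j₀ y 0)) u *ᵥ
        fun p => f (glue Z p z)) (restr Z z) := by
    intro f z
    rw [extend_mulVec]; rfl
  have hcode : ∀ (v : Fin L → ℂ) i, (codeMat j₀ s *ᵥ v) (codeWord j₀ i s) = v i := by
    intro v i
    simp only [codeMat, Matrix.mulVec, dotProduct, of_apply]
    rw [Finset.sum_eq_single i]
    · simp
    · intro j _ hj
      rw [if_neg fun e => hj (codeWord_injective j₀ s e).symm, zero_mul]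
    · simp
  have hcode' : ∀ (v : Fin L → ℂ) z, (∀ i, z ≠ codeWord j₀ i s) → (codeMat j₀ s *ᵥ v) z = 0 := by
    intro v z hz
    simp only [codeMat, Matrix.mulVec, dotProduct, of_apply]
    exact Finset.sum_eq_zero fun i _ => by rw [if_neg (hz i), zero_mul]
  rw [ext_iff_mulVec]
  intro v
  ext z
  rw [← mulVec_mulVec, ← mulVec_mulVec, hL, twoLevel_mulVec hne, glue_restr]
  have back : ∀ i j, (i = j₀ ∨ i = y) → (j = j₀ ∨ j = y) → restr Z z = restr Z (codeWord j₀ i 0) →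
      glue Z (restr Z (codeWord j₀ j 0)) z = codeWord j₀ j s → z = codeWord j₀ i s := by
    intro i j hi hj hz hg
    have h1 : z = glue Z (restr Z z) (glue Z (restr Z (codeWord j₀ j 0)) z) := by simp
    rw [h1, hg, hz, hglue i j s 0 hi hj]
  have hzero : ∀ i j, (i = j₀ ∨ i = y) → (j = j₀ ∨ j = y) → restr Z z = restr Z (codeWord j₀ i 0) →
      z ≠ codeWord j₀ i s → (codeMat j₀ s *ᵥ v) (glue Z (restr Z (codeWord j₀ j 0)) z) = 0 := by
    intro i j hi hj hz hne
    refine hcode' _ _ fun k hk => ?_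
    have hkj : k = j := by
      by_contra hkj
      refine hrne k j s 0 hj hkj ?_
      rw [← hk, restr_glue]
    subst hkj
    exact hne (back i k hi hj hz hk)
  have hzero' : ∀ i (w : Fin L → ℂ), (i = j₀ ∨ i = y) → restr Z z = restr Z (codeWord j₀ i 0) →
      z ≠ codeWord j₀ i s → (codeMat j₀ s *ᵥ w) z = 0 := by
    intro i w hi hz hne
    refine hcode' _ _ fun k hk => ?_
    have hki : k = i := by
      by_contra hki
      refine hrne k i s 0 hi hki ?_
      rw [← hk, hz]
    subst hki
    exact hne hk
  split_ifs with h1 h2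
  · by_cases hz : z = codeWord j₀ j₀ s
    · subst hz
      rw [hglue _ _ _ _ (Or.inl rfl) (Or.inl rfl), hglue _ _ _ _ (Or.inr rfl) (Or.inl rfl), hcode,
        hcode, hcode, twoLevel_mulVec hy, if_pos rfl]
    · rw [hzero j₀ j₀ (Or.inl rfl) (Or.inl rfl) h1 hz, hzero j₀ y (Or.inl rfl) (Or.inr rfl) h1 hz,
        hzero' j₀ _ (Or.inl rfl) h1 hz]
      simp
  · by_cases hz : z = codeWord j₀ y s
    · subst hz
      rw [hglue _ _ _ _ (Or.inl rfl) (Or.inr rfl), hglue _ _ _ _ (Or.inr rfl) (Or.inr rfl), hcode,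
        hcode, hcode, twoLevel_mulVec hy, if_neg hy.symm, if_pos rfl]
    · rw [hzero y j₀ (Or.inr rfl) (Or.inl rfl) h2 hz, hzero y y (Or.inr rfl) (Or.inr rfl) h2 hz,
        hzero' y _ (Or.inr rfl) h2 hz]
      simp
  · by_cases hz : ∃ i, z = codeWord j₀ i s
    · obtain ⟨i, rfl⟩ := hz
      rw [hcode, hcode, twoLevel_mulVec hy, if_neg, if_neg]
      · rintro rfl; exact h2 (hr _ _ _)
      · rintro rfl; exact h1 (hr _ _ _)
    · push Not at hz
      rw [hcode' _ _ hz, hcode' _ _ hz]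

/-- The excitation can be spread uniformly by linearly many gates. -/
lemma exists_uniform (hd : 1 ≤ d) (j₀ : Fin L) :
    ∃ F ∈ unitary (Op (qubitDims (L + 1))), ∃ p ∈ unitary (Matrix (Fin L) (Fin L) ℂ),
      Len L (kr (1 : Op (spinDims d n)) F) ∧ ActsAs j₀ F p ∧ ∀ i, ‖p i j₀‖ ^ 2 = 1 / L := by
  -- This length measures an L × L matrix by the gates of a register operator realising it on the
  -- code words, so that elimination on the small matrices yields circuits.
  set ℓ : ℕ → Matrix (Fin L) (Fin L) ℂ → Prop := fun N p =>
    p ∈ unitary (Matrix (Fin L) (Fin L) ℂ) ∧ ∃ F ∈ unitary (Op (qubitDims (L + 1))),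
      Len N (kr (1 : Op (spinDims d n)) F) ∧ ActsAs j₀ F p with hℓdef
  have hℓ : IsLength ℓ := by
    refine ⟨?_, ?_, ?_, ?_⟩
    · exact ⟨one_mem _, 1, one_mem _, by rw [kr_one]; exact Len.one,
        fun s => by rw [Matrix.one_mul, Matrix.mul_one]⟩
    · rintro N M U ⟨hU, F, hF, hlen, hact⟩ hNM
      exact ⟨hU, F, hF, hlen.mono hNM, hact⟩
    · rintro N M U V ⟨hU, F, hF, hlen, hact⟩ ⟨hV, F', hF', hlen', hact'⟩
      refine ⟨mul_mem hU hV, F * F', mul_mem hF hF', ?_, fun s => ?_⟩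
      · have := hlen.mul hlen'
        rwa [← kr_mul, mul_one] at this
      · rw [Matrix.mul_assoc, hact' s, ← Matrix.mul_assoc, hact s, Matrix.mul_assoc]
    · rintro N U ⟨hU, F, hF, hlen, hact⟩
      refine ⟨Unitary.star_mem hU, star F, Unitary.star_mem hF, ?_, hact.adjoint hF hU⟩
      have := hlen.star
      rwa [kr_star, star_one] at this
  have hL : 0 < L := Fin.pos j₀
  have hT : ∀ y, j₀ ≠ y → ∀ α β : ℂ, ‖α‖ ^ 2 + ‖β‖ ^ 2 = 1 → ℓ 1 (twoLevel j₀ y (su α β)) := by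
    intro y hy α β h
    have hne : restr {j₀.succ, y.succ} (codeWord j₀ j₀ 0)
        ≠ restr {j₀.succ, y.succ} (codeWord j₀ y 0) := by
      intro he
      have := congrFun he ⟨y.succ, by simp⟩
      exact codeBit_self_ne hy (by simpa [restr] using this)
    refine ⟨twoLevel_mem_unitary hy (su_mem_unitary h), _,
      extend_mem_unitary _ (twoLevel_mem_unitary hne (su_mem_unitary h)), ?_, actsAs_twoLevel hy _⟩
    exact len_kr_one hd Finset.card_le_two (actsOn_extend _ _)
      (extend_mem_unitary _ (twoLevel_mem_unitary hne (su_mem_unitary h)))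
  set v : Fin L → ℂ := fun _ => ((1 / √L : ℝ) : ℂ) with hv
  -- Elimination concentrates the uniform vector at the base word; the adjoint therefore spreads the
  -- base word uniformly.
  obtain ⟨W, hW, hWℓ, h0, -, -⟩ := hℓ.eliminate hT (Finset.univ.erase j₀) (by simp) v
  have hWs := hℓ.star hWℓ
  obtain ⟨hp, F, hF, hlen, hact⟩ := hWs
  refine ⟨F, hF, star W, hp, hlen.mono ?_, hact, ?_⟩
  · rw [mul_one]
    exact (Finset.card_le_univ _).trans (by simp)
  set z := (W *ᵥ v) j₀ with hz
  have hWv : W *ᵥ v = z • Pi.single j₀ 1 := by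
    ext i
    by_cases hi : i = j₀
    · subst hi; simp [hz]
    · rw [h0 i (by simp [hi])]; simp [hi]
  have hvW : ∀ i, v i = z * (star W) i j₀ := by
    intro i
    have : v = star W *ᵥ (W *ᵥ v) := by rw [mulVec_mulVec, hW.1, one_mulVec]
    rw [this, hWv, mulVec_smul]
    simp
  have hsq : ∀ i, 1 / (L : ℝ) = ‖z‖ ^ 2 * ‖(star W) i j₀‖ ^ 2 := by
    intro i
    rw [← mul_pow, ← norm_mul, ← hvW i, hv, Complex.norm_real, Real.norm_eq_abs, sq_abs, div_pow,
      Real.sq_sqrt (Nat.cast_nonneg L), one_pow]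
  have hcol : ∑ i, ‖(star W) i j₀‖ ^ 2 = 1 := by
    have e := congrFun (congrFun hW.2 j₀) j₀
    rw [mul_apply, one_apply_eq] at e
    have e2 : ∀ i, W j₀ i * (star W) i j₀ = ((‖(star W) i j₀‖ ^ 2 : ℝ) : ℂ) := by
      intro i
      rw [star_apply, Complex.star_def, Complex.mul_conj, Complex.normSq_eq_norm_sq,
        RCLike.norm_conj]
    simp only [e2] at e
    exact_mod_cast e
  have hzz : ‖z‖ ^ 2 = 1 := by
    have : ∑ _i : Fin L, 1 / (L : ℝ) = ∑ i, ‖z‖ ^ 2 * ‖(star W) i j₀‖ ^ 2 :=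
      Finset.sum_congr rfl fun i _ => hsq i
    rw [← Finset.mul_sum, hcol, mul_one, Finset.sum_const, Finset.card_univ, Fintype.card_fin,
      nsmul_eq_mul, mul_one_div_cancel (by positivity)] at this
    exact this.symm
  intro i
  rw [hsq i, hzz, one_mul]

end OneHot

/-! ### Operators acting on states -/

section Act

open Matrix

variable {κ : Type} [Fintype κ] [DecidableEq κ]

/-- A matrix as an endomorphism of Euclidean space. -/
abbrev act (A : Matrix κ κ ℂ) : Module.End ℂ (EuclideanSpace ℂ κ) := toEuclideanLin A

lemma act_mul (A B : Matrix κ κ ℂ) : act (A * B) = act A * act B := toLpLin_mul_same 2 A B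

lemma act_mul_apply (A B : Matrix κ κ ℂ) (v : EuclideanSpace ℂ κ) :
    act (A * B) v = act A (act B v) := by rw [act_mul, Module.End.mul_apply]

lemma act_one : act (1 : Matrix κ κ ℂ) = 1 := toLpLin_one 2

lemma act_pow (A : Matrix κ κ ℂ) (m : ℕ) : act (A ^ m) = act A ^ m :=
  map_pow (toLpLinAlgEquiv 2) A m

lemma act_add (A B : Matrix κ κ ℂ) : act (A + B) = act A + act B := map_add _ A B

lemma act_sub (A B : Matrix κ κ ℂ) : act (A - B) = act A - act B := map_sub _ A B

lemma act_smul (c : ℂ) (A : Matrix κ κ ℂ) : act (c • A) = c • act A := map_smul _ c A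

lemma act_add_apply (A B : Matrix κ κ ℂ) (v : EuclideanSpace ℂ κ) :
    act (A + B) v = act A v + act B v := by rw [act_add, LinearMap.add_apply]

lemma act_smul_apply (c : ℂ) (A : Matrix κ κ ℂ) (v : EuclideanSpace ℂ κ) :
    act (c • A) v = c • act A v := by rw [act_smul, LinearMap.smul_apply]

lemma norm_act_of_mem_unitary {U : Matrix κ κ ℂ} (hU : U ∈ unitary (Matrix κ κ ℂ))
    (v : EuclideanSpace ℂ κ) : ‖act U v‖ = ‖v‖ := by
  have h : inner ℂ (act U v) (act U v) = inner ℂ v v := by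
    rw [← LinearMap.adjoint_inner_left, ← toEuclideanLin_conjTranspose_eq_adjoint,
      ← star_eq_conjTranspose]
    change inner ℂ (act (star U) (act U v)) v = _
    rw [← act_mul_apply, hU.1, act_one, Module.End.one_apply]
  rw [inner_self_eq_norm_sq_to_K, inner_self_eq_norm_sq_to_K] at h
  have h' : ‖act U v‖ ^ 2 = ‖v‖ ^ 2 := by exact_mod_cast h
  exact (sq_eq_sq₀ (norm_nonneg _) (norm_nonneg _)).1 h'

end Act

/-! ### Block encoding of a sum of local terms -/

section Encoding

open Matrix

variable {d n L : ℕ}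

/-- The operator on the register that is diagonal on the ancillas. -/
def krDiag (d n : ℕ) {a : ℕ} (g : Config (qubitDims a) → ℂ) : Op (regDims d n a) :=
  kr 1 (diagonal g)

lemma krDiag_mul {a : ℕ} (g g' : Config (qubitDims a) → ℂ) :
    krDiag d n g * krDiag d n g' = krDiag d n (g * g') := by
  rw [krDiag, krDiag, krDiag, ← kr_mul, diagonal_mul_diagonal, mul_one]; rfl

lemma krDiag_one {a : ℕ} : krDiag d n (1 : Config (qubitDims a) → ℂ) = 1 := by
  rw [krDiag, show diagonal (1 : Config (qubitDims a) → ℂ) = 1 from diagonal_one, kr_one]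

lemma krDiag_add {a : ℕ} (g g' : Config (qubitDims a) → ℂ) :
    krDiag d n g + krDiag d n g' = krDiag d n (g + g') := by
  rw [krDiag, krDiag, krDiag, ← kr_add_right, diagonal_add]; rfl

lemma krDiag_smul {a : ℕ} (c : ℂ) (g : Config (qubitDims a) → ℂ) :
    c • krDiag d n g = krDiag d n (c • g) := by
  rw [krDiag, krDiag, ← kr_smul_right, ← diagonal_smul]

lemma actsOn_diagonal {a : ℕ} {Z : Finset (Fin a)} {g : Config (qubitDims a) → ℂ}
    (hg : ∀ z z', (∀ i ∈ Z, z i = z' i) → g z = g z') : ActsOn Z (diagonal g : Op (qubitDims a)) := by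
  constructor
  · rintro x y ⟨i, -, hne⟩
    exact diagonal_apply_ne _ fun e => hne (by rw [e])
  · intro x y x' y' e e' hx hy
    by_cases hxy : x = y
    · have : x' = y' := by
        ext1 i
        by_cases hi : i ∈ Z
        · rw [← hx i hi, ← hy i hi, hxy]
        · exact e' i hi
      subst hxy; subst this
      rw [diagonal_apply_eq, diagonal_apply_eq, hg x x' hx]
    · have : x' ≠ y' := by
        rintro rfl
        refine hxy ?_
        ext1 i
        by_cases hi : i ∈ Z
        · rw [hx i hi, hy i hi]
        · exact e i hi
      rw [diagonal_apply_ne _ hxy, diagonal_apply_ne _ this]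

lemma diagonal_mem_unitary {κ : Type} [Fintype κ] [DecidableEq κ] {g : κ → ℂ}
    (hg : ∀ z, ‖g z‖ = 1) : diagonal g ∈ unitary (Matrix κ κ ℂ) := by
  have h : ∀ z, g z * star (g z) = 1 := fun z => by
    rw [Complex.star_def, Complex.mul_conj, Complex.normSq_eq_norm_sq, hg z]; simp
  rw [Unitary.mem_iff, star_eq_conjTranspose, diagonal_conjTranspose, diagonal_mul_diagonal,
    diagonal_mul_diagonal, ← diagonal_one]
  constructor <;> congr 1 <;> ext z
  · rw [Pi.star_apply, mul_comm, h]
  · rw [Pi.star_apply, h]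

lemma len_krDiag (hd : 1 ≤ d) {a : ℕ} {Z : Finset (Fin a)} (hZ : Z.card ≤ 2)
    {g : Config (qubitDims a) → ℂ} (hg : ∀ z z', (∀ i ∈ Z, z i = z' i) → g z = g z')
    (hg1 : ∀ z, ‖g z‖ = 1) : Len 1 (krDiag d n g) :=
  len_kr_one hd hZ (actsOn_diagonal hg) (diagonal_mem_unitary hg1)

/-- The projection onto the configurations that agree with code word `j` at bit `j`. -/
def codeProj (j₀ j : Fin L) : Op (qubitDims (L + 1)) :=
  diagonal fun z => if z j.succ = codeBit j₀ j j then 1 else 0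

/-- The rotation by a right angle of the leading qubit. -/
def flipOp (L : ℕ) : Op (qubitDims (L + 1)) :=
  siteOp (D := qubitDims (L + 1)) 0 fun _ => su 0 1

lemma codeProj_mul_self (j₀ j : Fin L) : codeProj j₀ j * codeProj j₀ j = codeProj j₀ j := by
  rw [codeProj, diagonal_mul_diagonal]
  congr 1; ext z; split_ifs <;> simp

lemma codeProj_star (j₀ j : Fin L) : star (codeProj j₀ j) = codeProj j₀ j := by
  rw [codeProj, star_eq_conjTranspose, diagonal_conjTranspose]
  congr 1; ext z; rw [Pi.star_apply]; split_ifs <;> simp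

lemma codeProj_actsOn (j₀ j : Fin L) : ActsOn {j.succ} (codeProj j₀ j) :=
  actsOn_diagonal fun z z' h => by rw [h j.succ (by simp)]

lemma codeProj_code (j₀ j i : Fin L) (s : Fin 2) :
    codeProj j₀ j *ᵥ Pi.single (codeWord j₀ i s) 1
      = if i = j then Pi.single (codeWord j₀ i s) (1 : ℂ) else 0 := by
  ext z
  rw [codeProj, mulVec_diagonal]
  by_cases hz : z = codeWord j₀ i s
  · subst hz
    by_cases hij : i = j
    · simp [hij]
    · simp [hij, codeBit_self_ne hij]
  · split_ifs <;> simp [hz]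

lemma flipOp_star (L : ℕ) : star (flipOp L) = -flipOp L := by
  rw [flipOp, siteOp_star _ _ fun _ _ _ => rfl]
  ext x y
  rw [neg_apply]
  simp only [siteOp, of_apply, su_star]
  split_ifs
  · generalize x 0 = s
    generalize y 0 = t
    fin_cases s <;> fin_cases t <;> simp [su]
  · simp

lemma flipOp_mul_self (L : ℕ) : flipOp L * flipOp L = -1 := by
  have h : (flipOp L) ∈ unitary (Op (qubitDims (L + 1))) :=
    siteOp_mem_unitary _ _ (fun _ _ _ => rfl) fun _ => su_mem_unitary (by simp)
  have := h.1
  rw [flipOp_star, neg_mul] at this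
  rw [← this, neg_neg]

lemma flipOp_actsOn (L : ℕ) : ActsOn {0} (flipOp L) := by
  exact siteOp_actsOn (D := qubitDims (L + 1)) 0 ∅ (fun _ => su 0 1) fun _ _ _ => rfl

lemma codeProj_mul_flipOp (j₀ j : Fin L) :
    codeProj j₀ j * flipOp L = flipOp L * codeProj j₀ j := by
  ext x y
  rw [codeProj, diagonal_mul, mul_diagonal, flipOp, siteOp, of_apply, mul_comm]
  by_cases h : ∀ k, k ≠ 0 → x k = y k
  · rw [h j.succ (Fin.succ_ne_zero j)]
  · rw [if_neg h, zero_mul, zero_mul]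

lemma flipOp_code (j₀ i : Fin L) :
    flipOp L *ᵥ Pi.single (codeWord j₀ i 0) 1 = Pi.single (codeWord j₀ i 1) 1 ∧
    flipOp L *ᵥ Pi.single (codeWord j₀ i 1) 1 = -Pi.single (codeWord j₀ i 0) (1 : ℂ) := by
  have hagree : ∀ (z : Config (qubitDims (L + 1))) s,
      (∀ k, k ≠ 0 → z k = codeWord j₀ i s k) ↔ z = codeWord j₀ i (z 0) := by
    intro z s
    constructor
    · intro h
      ext1 k
      refine Fin.cases rfl (fun k => ?_) k
      rw [h _ (Fin.succ_ne_zero k)]; rfl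
    · intro h k hk
      obtain ⟨k, rfl⟩ := Fin.exists_succ_eq.2 hk
      rw [h]; rfl
  constructor <;>
  · ext z
    rw [mulVec_single_one, col_apply, flipOp, siteOp, of_apply]
    simp only [hagree]
    by_cases hz : z = codeWord j₀ i (z 0)
    · rw [if_pos hz, hz]
      generalize (z 0 : Fin 2) = s
      change su _ _ s _ = _
      fin_cases s <;> simp [su, funext_iff, Fin.forall_fin_succ]
    · rw [if_neg hz]
      have h0 : z ≠ codeWord j₀ i 0 := fun e => hz (by rw [e]; rfl)
      have h1 : z ≠ codeWord j₀ i 1 := fun e => hz (by rw [e]; rfl)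
      simp [h0, h1]

/-- A superposition of spin states that are tagged by code word `j`. -/
def coded (j₀ j : Fin L) (ψ χ : HilbertSp (spinDims d n)) : HilbertSp (regDims d n (L + 1)) :=
  tv ψ (Pi.single (codeWord j₀ j 0) 1) + tv χ (Pi.single (codeWord j₀ j 1) 1)

/-- The rotation by `a` and `b` of the leading qubit, controlled by code bit `j`. -/
def ctrlRot (j₀ j : Fin L) (a b : Op (spinDims d n)) : Op (regDims d n (L + 1)) :=
  kr 1 (1 - codeProj j₀ j) + kr b (codeProj j₀ j) + kr a (codeProj j₀ j * flipOp L)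

lemma ctrlRot_apply (j₀ j i : Fin L) (a b : Op (spinDims d n)) (ψ χ : HilbertSp (spinDims d n)) :
    act (ctrlRot j₀ j a b) (coded j₀ i ψ χ) = if i = j then
      coded j₀ i (act b ψ - act a χ) (act a ψ + act b χ) else coded j₀ i ψ χ := by
  obtain ⟨h0, h1⟩ := flipOp_code j₀ i
  have hone : ∀ v, act (1 : Op (spinDims d n)) v = v := fun v => by rw [act_one]; rfl
  rw [ctrlRot, act_add_apply, act_add_apply, coded, map_add, map_add, map_add]
  simp only [act, kr_tv, ← mulVec_mulVec, h0, h1, sub_mulVec, one_mulVec, mulVec_neg, codeProj_code]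
  simp only [show ∀ v, toEuclideanLin (1 : Op (spinDims d n)) v = v from hone]
  split_ifs with hij
  · simp only [sub_self, tv_zero_right, tv_neg_right, coded, sub_eq_add_neg, tv_add_left,
      tv_neg_left]
    abel
  · simp [tv_zero_right]

lemma ctrlRot_star (j₀ j : Fin L) {a b : Op (spinDims d n)} (ha : star a = a) (hb : star b = b) :
    star (ctrlRot j₀ j a b) = ctrlRot j₀ j (-a) b := by
  have hneg : ∀ (M : Op (spinDims d n)) (F : Op (qubitDims (L + 1))), kr (-M) F = -kr M F := by
    intro M F; ext w w'; simp [kr_apply]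
  rw [ctrlRot, ctrlRot, star_add, star_add, kr_star, kr_star, kr_star, ha, hb, star_mul, star_sub,
    codeProj_star, flipOp_star, star_one, star_one, neg_mul, kr_neg_right, hneg,
    codeProj_mul_flipOp]

/-- The flip squares to -1 and commutes with the control, so the controlled block multiplies like b
+ aY with Y as imaginary unit. -/
lemma ctrlRot_mul (j₀ j : Fin L) (a b a' b' : Op (spinDims d n)) :
    ctrlRot j₀ j a b * ctrlRot j₀ j a' b' = ctrlRot j₀ j (a * b' + b * a') (b * b' - a * a') := by
  have hsub : ∀ (M M' : Op (spinDims d n)) (F : Op (qubitDims (L + 1))),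
      kr (M - M') F = kr M F - kr M' F := by
    intro M M' F; ext w w'; simp [kr_apply, sub_mul]
  set N := codeProj j₀ j with hN
  set Y := flipOp L with hY
  have hNN : N * N = N := codeProj_mul_self j₀ j
  have hNY : N * Y = Y * N := codeProj_mul_flipOp j₀ j
  have hYY : Y * Y = -1 := flipOp_mul_self L
  have e1 : N * (N * Y) = N * Y := by rw [← mul_assoc, hNN]
  have e2 : N * Y * N = N * Y := by rw [mul_assoc, ← hNY, e1]
  have e3 : N * Y * (N * Y) = -N := by rw [← mul_assoc, e2, mul_assoc, hYY, mul_neg_one]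
  have f1 : (1 - N) * (1 - N) = 1 - N := by
    rw [mul_sub, mul_one, sub_mul, one_mul, hNN, sub_self, sub_zero]
  have f2 : (1 - N) * N = 0 := by rw [sub_mul, one_mul, hNN, sub_self]
  have f3 : N * (1 - N) = 0 := by rw [mul_sub, mul_one, hNN, sub_self]
  have f4 : (1 - N) * (N * Y) = 0 := by rw [← mul_assoc, f2, zero_mul]
  have f5 : N * Y * (1 - N) = 0 := by rw [mul_sub, mul_one, e2, sub_self]
  simp only [ctrlRot, ← hN, ← hY, mul_add, add_mul, ← kr_mul, one_mul, mul_one, f1, f2, f3, f4, f5,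
    hNN, e1, e2, e3, kr_zero_right, kr_neg_right, kr_add_left, hsub]
  abel

lemma ctrlRot_zero_one (j₀ j : Fin L) :
    ctrlRot j₀ j (0 : Op (spinDims d n)) 1 = 1 := by
  have hz : ∀ (F : Op (qubitDims (L + 1))), kr (0 : Op (spinDims d n)) F = 0 := by
    intro F; ext w w'; simp [kr_apply]
  rw [ctrlRot, hz, add_zero, ← kr_add_right, sub_add_cancel, kr_one]

lemma ctrlRot_mem_unitary (j₀ j : Fin L) {a b : Op (spinDims d n)} (ha : star a = a)
    (hb : star b = b) (hab : a * b = b * a) (h : a * a + b * b = 1) :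
    ctrlRot j₀ j a b ∈ unitary (Op (regDims d n (L + 1))) := by
  rw [Unitary.mem_iff, ctrlRot_star j₀ j ha hb, ctrlRot_mul, ctrlRot_mul, ← ctrlRot_zero_one j₀ j]
  constructor <;> congr 1
  · rw [neg_mul, hab]; abel
  · rw [neg_mul, sub_neg_eq_add, add_comm, h]
  · rw [mul_neg, hab]; abel
  · rw [mul_neg, sub_neg_eq_add, add_comm, h]

/-- Two ancillas suffice, whatever L is; this keeps the cost of a controlled rotation independent of
L and n. -/
lemma ctrlRot_actsOn (j₀ j : Fin L) {X : Finset (Fin n)} {a b : Op (spinDims d n)}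
    (ha : ActsOn X a) (hb : ActsOn X b) :
    ActsOn (X.disjSum {0, j.succ}) (ctrlRot j₀ j a b) := by
  have h1 : ActsOn {0, j.succ} (codeProj j₀ j) := (codeProj_actsOn j₀ j).mono (by simp)
  have h2 : ActsOn {0, j.succ} (flipOp L) := (flipOp_actsOn L).mono (by simp)
  have : Nonempty (Config (qubitDims (L + 1))) := ⟨fun _ => 0⟩
  have h3 : ActsOn {0, j.succ} (1 - codeProj j₀ j) := by
    have := (actsOn_one (D := qubitDims (L + 1)) {0, j.succ}).add (h1.smul (-1))
    simpa [sub_eq_add_neg] using this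
  exact (((actsOn_one X).kr h3).add (hb.kr h1)).add (ha.kr (h1.mul h2))

end Encoding

/-! ### The reflection whose base block is the average of the terms -/

section Encoding

open Matrix

variable {d n L : ℕ}

lemma coded_base (j₀ : Fin L) (ψ : HilbertSp (spinDims d n)) :
    coded j₀ j₀ ψ 0 = withAncilla (L + 1) ψ := by
  rw [coded, codeWord_base, tv_zero_left, add_zero, withAncilla_eq_tv]

lemma ActsAs.act_coded {j₀ : Fin L} {F : Op (qubitDims (L + 1))} {p : Matrix (Fin L) (Fin L) ℂ}
    (h : ActsAs j₀ F p) (j : Fin L) (ψ χ : HilbertSp (spinDims d n)) :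
    act (kr (1 : Op (spinDims d n)) F) (coded j₀ j ψ χ) = ∑ i, p i j • coded j₀ i ψ χ := by
  have hone : ∀ v, toEuclideanLin (1 : Op (spinDims d n)) v = v := fun v => by
    change act 1 v = v
    rw [act_one]; rfl
  rw [coded, map_add]
  simp only [act, kr_tv, hone, h.mulVec_code, tv_sum_smul_right, coded, smul_add,
    Finset.sum_add_distrib]

lemma act_krDiag_coded (g : Config (qubitDims (L + 1)) → ℂ) (j₀ j : Fin L)
    (ψ χ : HilbertSp (spinDims d n)) :
    act (krDiag d n g) (coded j₀ j ψ χ)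
      = coded j₀ j (g (codeWord j₀ j 0) • ψ) (g (codeWord j₀ j 1) • χ) := by
  have hone : ∀ v, toEuclideanLin (1 : Op (spinDims d n)) v = v := fun v => by
    change act 1 v = v
    rw [act_one]; rfl
  have hd : ∀ s (v : HilbertSp (spinDims d n)),
      tv v (diagonal g *ᵥ Pi.single (codeWord j₀ j s) 1)
        = tv (g (codeWord j₀ j s) • v) (Pi.single (codeWord j₀ j s) 1) := by
    intro s v
    ext w
    rw [tv_apply, tv_apply, mulVec_diagonal]
    by_cases hw : (regEquiv d n (L + 1) w).2 = codeWord j₀ j s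
    · rw [hw]; simp [mul_comm]
    · simp [hw]
  rw [coded, map_add]
  simp only [act, krDiag, kr_tv, hone, hd]
  rfl

/-- The function that takes the value `s` on the base code word and `t` elsewhere. -/
def baseSwitch (j₀ : Fin L) (s t : ℂ) (z : Config (qubitDims (L + 1))) : ℂ :=
  if z 0 = 0 ∧ z j₀.succ = 0 then s else t

lemma len_baseSwitch (hd : 1 ≤ d) (j₀ : Fin L) {s t : ℂ} (hs : ‖s‖ = 1) (ht : ‖t‖ = 1) :
    Len 1 (krDiag d n (baseSwitch j₀ s t)) := by
  refine len_krDiag hd (Z := {0, j₀.succ}) Finset.card_le_two ?_ ?_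
  · intro z z' h
    rw [baseSwitch, baseSwitch, h 0 (by simp), h j₀.succ (by simp)]
  · intro z
    unfold baseSwitch
    split_ifs
    exacts [hs, ht]

/-- Among code words, testing the leading bit and bit j₀ singles out the base state. Hence
reflections and phases about it are single two-qubit gates. -/
lemma act_base_coded (j₀ j : Fin L) (ψ χ : HilbertSp (spinDims d n)) :
    act (krDiag d n (baseSwitch j₀ 1 0)) (coded j₀ j ψ χ)
      = if j = j₀ then coded j₀ j₀ ψ 0 else 0 := by
  rw [act_krDiag_coded]
  have h1 : baseSwitch j₀ 1 0 (codeWord j₀ j 1) = 0 := by simp [baseSwitch]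
  rw [h1, zero_smul]
  split_ifs with hj
  · subst hj
    simp [baseSwitch, codeBit_base]
  · have h0 : baseSwitch j₀ 1 0 (codeWord j₀ j 0) = 0 := by
      have := codeBit_self_ne (j₀ := j₀) hj
      rw [codeBit_base] at this
      simp [baseSwitch, this]
    rw [h0, zero_smul, coded, tv_zero_left, tv_zero_left, add_zero]

/-- A state tagged by a code word is affected only by the factor with the same tag, and keeps its
tag. -/
lemma act_ctrlRot_prod (j₀ : Fin L) (a b : Fin L → Op (spinDims d n)) (l : List (Fin L))
    (hl : l.Nodup) (i : Fin L) (ψ χ : HilbertSp (spinDims d n)) :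
    act (l.map fun j => ctrlRot j₀ j (a j) (b j)).prod (coded j₀ i ψ χ) = if i ∈ l then
      act (ctrlRot j₀ i (a i) (b i)) (coded j₀ i ψ χ) else coded j₀ i ψ χ := by
  induction l with
  | nil => simp only [List.map_nil, List.prod_nil, act_one, List.not_mem_nil, if_false]; rfl
  | cons j l ih =>
    rw [List.nodup_cons] at hl
    rw [List.map_cons, List.prod_cons, act_mul_apply, ih hl.2]
    by_cases hij : i = j
    · subst hij
      rw [if_neg hl.1, if_pos (by simp)]
    · by_cases hil : i ∈ l
      · rw [if_pos hil, if_pos (by simp [hil]), ctrlRot_apply, if_pos rfl, ctrlRot_apply, if_neg hij]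
      · rw [if_neg hil, if_neg (by simp [hil, hij]), ctrlRot_apply, if_neg hij]

/-- A reflection that encodes the average of `b j ^ 2 - a j ^ 2` in its base block. -/
theorem exists_reflection (hd : 1 ≤ d) (j₀ : Fin L) (a b : Fin L → Op (spinDims d n))
    (ha : ∀ j, star (a j) = a j) (hb : ∀ j, star (b j) = b j) (hab : ∀ j, a j * b j = b j * a j)
    (h1 : ∀ j, a j * a j + b j * b j = 1) {N : ℕ}
    (hN : ∀ j, Len N (ctrlRot j₀ j (a j) (b j))) :
    ∃ B : Op (regDims d n (L + 1)), B * B = 1 ∧ Len (2 * (L * N) + 2 * L + 1) B ∧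
      ∀ ψ, act (krDiag d n (baseSwitch j₀ 1 0)) (act B (withAncilla (L + 1) ψ))
        = withAncilla (L + 1) (act ((1 / L : ℂ) • ∑ j, (b j * b j - a j * a j)) ψ) := by
  obtain ⟨F, hF, p, hp, hFlen, hFp, hunif⟩ := exists_uniform (d := d) (n := n) hd j₀
  set Q := kr (1 : Op (spinDims d n)) F with hQ
  have hQu : Q ∈ unitary (Op (regDims d n (L + 1))) := kr_mem_unitary hF
  set G := ((List.finRange L).map fun j => ctrlRot j₀ j (a j) (b j)).prod with hG
  have hGlen : Len (L * N) G := by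
    have := Len.list_prod ((List.finRange L).map fun j => ctrlRot j₀ j (a j) (b j)) (N := N)
      (by simpa using hN)
    simpa using this
  have hGu := hGlen.mem_unitary
  set Z := krDiag d n (fun z : Config (qubitDims (L + 1)) => if z 0 = 0 then (1 : ℂ) else -1) with hZ
  have hZlen : Len 1 Z := by
    refine len_krDiag hd (Z := {0}) (by simp) ?_ ?_
    · intro z z' h
      rw [h 0 (by simp)]
    · intro z
      split_ifs <;> simp
  have hZZ : Z * Z = 1 := by
    rw [hZ, krDiag_mul, ← krDiag_one]
    congr 1
    ext z
    rw [Pi.mul_apply, Pi.one_apply]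
    split_ifs <;> simp
  have hGact : ∀ i ψ χ, act G (coded j₀ i ψ χ)
      = coded j₀ i (act (b i) ψ - act (a i) χ) (act (a i) ψ + act (b i) χ) := by
    intro i ψ χ
    rw [hG, act_ctrlRot_prod j₀ a b _ (List.nodup_finRange L), if_pos (List.mem_finRange i),
      ctrlRot_apply, if_pos rfl]
  -- Unitarity of G gives its adjoint on tagged states, with no need to reverse the product.
  have hGstar : ∀ i ψ χ, act (star G) (coded j₀ i ψ χ)
      = act (star (ctrlRot j₀ i (a i) (b i))) (coded j₀ i ψ χ) := by
    intro i ψ χ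
    have hu := ctrlRot_mem_unitary j₀ i (ha i) (hb i) (hab i) (h1 i)
    have e1 : ∃ ψ' χ', act (star (ctrlRot j₀ i (a i) (b i))) (coded j₀ i ψ χ)
        = coded j₀ i ψ' χ' := by
      rw [ctrlRot_star j₀ i (ha i) (hb i), ctrlRot_apply, if_pos rfl]
      exact ⟨_, _, rfl⟩
    obtain ⟨ψ', χ', e⟩ := e1
    have e2 : act G (coded j₀ i ψ' χ') = coded j₀ i ψ χ := by
      have : act (ctrlRot j₀ i (a i) (b i)) (coded j₀ i ψ' χ') = coded j₀ i ψ χ := by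
        rw [← e, ← act_mul_apply, hu.2, act_one, Module.End.one_apply]
      rw [ctrlRot_apply, if_pos rfl] at this
      rw [hGact, this]
    rw [e, ← e2, ← act_mul_apply, hGu.1, act_one, Module.End.one_apply]
  have hZact : ∀ i ψ χ, act Z (coded j₀ i ψ χ) = coded j₀ i ψ (-χ) := by
    intro i ψ χ
    rw [hZ, act_krDiag_coded]
    simp
  -- G sends (ψ, 0) to (bψ, aψ), Z flips the second sign, and the adjoint rotation returns b²ψ - a²ψ
  -- in the first slot. The second slot χ is later removed by the base projection.
  have hmid : ∀ i ψ, ∃ χ, act (star G) (act Z (act G (coded j₀ i ψ 0)))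
      = coded j₀ i (act (b i * b i - a i * a i) ψ) χ := by
    intro i ψ
    rw [hGact, hZact, hGstar, ctrlRot_star j₀ i (ha i) (hb i), ctrlRot_apply, if_pos rfl]
    refine ⟨_, congrArg₂ _ ?_ rfl⟩
    rw [act_sub, act_mul, act_mul, show act (-a i) = -act (a i) from map_neg _ _]
    simp
  -- A unitary conjugate of Z, hence an involution; Q contributes the weights |p i j₀|² = 1/L.
  refine ⟨star Q * (star G * (Z * (G * Q))), ?_, ?_, ?_⟩
  · have e1 : ∀ M, Q * (star Q * M) = M := fun M => by rw [← mul_assoc, hQu.2, one_mul]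
    have e2 : ∀ M, G * (star G * M) = M := fun M => by rw [← mul_assoc, hGu.2, one_mul]
    have e3 : ∀ M, Z * (Z * M) = M := fun M => by rw [← mul_assoc, hZZ, one_mul]
    have e4 : ∀ M, star G * (G * M) = M := fun M => by rw [← mul_assoc, hGu.1, one_mul]
    simp only [mul_assoc, e1, e2, e3, e4, hQu.1]
  · exact (hFlen.star.mul (hGlen.star.mul (hZlen.mul (hGlen.mul hFlen)))).mono (by omega)
  · intro ψ
    have hstar : act (star Q) = act (kr 1 (star F)) := by rw [hQ, kr_star, star_one]
    rw [← coded_base j₀, act_mul_apply, act_mul_apply, act_mul_apply, act_mul_apply,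
      hFp.act_coded]
    simp only [map_sum, map_smul]
    have hterm : ∀ i, act (krDiag d n (baseSwitch j₀ 1 0)) (act (star Q) (act (star G) (act Z
        (act G (coded j₀ i ψ 0))))) = (star p) j₀ i • coded j₀ j₀ (act (b i * b i - a i * a i) ψ) 0 := by
      intro i
      obtain ⟨χ, hχ⟩ := hmid i ψ
      rw [hχ, hstar, (hFp.adjoint hF hp).act_coded, map_sum, Finset.sum_eq_single j₀]
      · rw [map_smul, act_base_coded, if_pos rfl]
      · intro j _ hj
        rw [map_smul, act_base_coded, if_neg hj, smul_zero]
      · simp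
    simp only [hterm, smul_smul]
    have hpp : ∀ i, p i j₀ * (star p) j₀ i = (1 / L : ℂ) := by
      intro i
      rw [star_apply, Complex.star_def, Complex.mul_conj, Complex.normSq_eq_norm_sq, hunif i]
      push_cast
      rfl
    simp only [hpp, coded_base]
    rw [LinearMap.smul_apply, LinearMap.sum_apply, ← ancillaIsometry_apply, map_smul, map_sum,
      Finset.smul_sum]
    rfl

/-! ### Square roots -/

/-- A positive semidefinite contraction has commuting Hermitian square roots of itself and of its
complement, also after scaling. -/
lemma exists_sqrt_pair {κ : Type} [Fintype κ] [DecidableEq κ] {h : Matrix κ κ ℂ}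
    (hh : h.PosSemidef) (hn : ‖h‖ ≤ 1) {σ : ℝ} (hσ0 : 0 ≤ σ) (hσ1 : σ ≤ 1) :
    ∃ a b : Matrix κ κ ℂ, star a = a ∧ star b = b ∧ a * b = b * a ∧
      a * a = (σ : ℂ) • h ∧ b * b = 1 - (σ : ℂ) • h := by
  set e := hh.isHermitian.eigenvalues with he
  have he0 : ∀ i, 0 ≤ e i := hh.eigenvalues_nonneg
  have he1 : ∀ i, e i ≤ 1 := by
    intro i
    have h1 := l2_opNorm_mulVec h (hh.isHermitian.eigenvectorBasis i)
    rw [hh.isHermitian.mulVec_eigenvectorBasis] at h1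
    have h2 : ‖(EuclideanSpace.equiv κ ℂ).symm (e i • (hh.isHermitian.eigenvectorBasis i).ofLp)‖
        = e i := by
      have : (EuclideanSpace.equiv κ ℂ).symm (e i • (hh.isHermitian.eigenvectorBasis i).ofLp)
          = e i • hh.isHermitian.eigenvectorBasis i := by
        ext j; simp
      rw [this, norm_smul, hh.isHermitian.eigenvectorBasis.orthonormal.1 i, mul_one,
        Real.norm_eq_abs, abs_of_nonneg (he0 i)]
    rw [h2, hh.isHermitian.eigenvectorBasis.orthonormal.1 i, mul_one] at h1
    exact h1.trans hn
  set Φ := Unitary.conjStarAlgAut ℂ (Matrix κ κ ℂ) hh.isHermitian.eigenvectorUnitary with hΦ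
  have hspec : h = Φ (diagonal fun i => (e i : ℂ)) := hh.isHermitian.spectral_theorem
  have hstar : ∀ f : κ → ℝ, star (diagonal fun i => (f i : ℂ)) = diagonal fun i => (f i : ℂ) := by
    intro f
    rw [star_eq_conjTranspose, diagonal_conjTranspose]
    congr 1; ext i; simp
  refine ⟨Φ (diagonal fun i => ((√(σ * e i) : ℝ) : ℂ)), Φ (diagonal fun i => ((√(1 - σ * e i) : ℝ) : ℂ)),
    ?_, ?_, ?_, ?_, ?_⟩
  · rw [← map_star, hstar]
  · rw [← map_star, hstar]
  · rw [← map_mul, ← map_mul, diagonal_mul_diagonal, diagonal_mul_diagonal]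
    congr 2; ext i; ring
  · rw [← map_mul, diagonal_mul_diagonal, hspec, ← map_smul, ← diagonal_smul]
    congr 2; ext i
    rw [← Complex.ofReal_mul, Real.mul_self_sqrt (mul_nonneg hσ0 (he0 i))]
    simp
  · rw [← map_mul, diagonal_mul_diagonal]
    have h1 : (1 : Matrix κ κ ℂ) = Φ 1 := (map_one Φ).symm
    rw [h1, hspec, ← map_smul, ← map_sub, ← diagonal_smul, ← diagonal_one, diagonal_sub]
    congr 2; ext i
    rw [← Complex.ofReal_mul, Real.mul_self_sqrt]
    · simp
    · have := mul_le_mul hσ1 (he1 i) (he0 i) zero_le_one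
      linarith

end Encoding

/-! ### Estimates for the phases -/

section Estimates

/-- The lower bound is the square of sin x ≥ x - x³/6, whose right side is nonnegative for x² ≤ 6.
-/
lemma sq_sub_le_sin_sq {x : ℝ} (hx : 0 ≤ x) (hx1 : x ^ 2 ≤ 6) :
    x ^ 2 - x ^ 4 / 3 ≤ Real.sin x ^ 2 ∧ Real.sin x ^ 2 ≤ x ^ 2 := by
  constructor
  · have h1 := Real.sin_ge_sub_cube hx
    have h2 : 0 ≤ x - x ^ 3 / 6 := by nlinarith
    have h3 : (x - x ^ 3 / 6) ^ 2 ≤ Real.sin x ^ 2 := by gcongr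
    nlinarith [sq_nonneg (x ^ 3)]
  · rw [sq_le_sq]
    exact Real.abs_sin_le_abs

/-- For small angles, `sin² (N θ)` is close to `N² sin² θ`. -/
lemma abs_sin_sq_sub_le {y : ℝ} (hy0 : 0 ≤ y) (N : ℕ) (hN : 1 ≤ N) (hNy : (N : ℝ) ^ 2 * y ≤ 1 / 4) :
    |Real.sin (N * Real.arcsin √y) ^ 2 - (N : ℝ) ^ 2 * y| ≤ 4 * ((N : ℝ) ^ 2 * y) ^ 2 := by
  have hN1 : (1 : ℝ) ≤ N := by exact_mod_cast hN
  have hN2 : (1 : ℝ) ≤ (N : ℝ) ^ 2 := one_le_pow₀ hN1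
  have hy1 : y ≤ 1 := by nlinarith
  have hs1 : √y ≤ 1 := Real.sqrt_le_one.2 hy1
  set θ := Real.arcsin √y with hθ
  have hθ0 : 0 ≤ θ := Real.arcsin_nonneg.2 (Real.sqrt_nonneg y)
  have hsin : Real.sin θ ^ 2 = y := by
    rw [hθ, Real.sin_arcsin (by linarith [Real.sqrt_nonneg y]) hs1, Real.sq_sqrt hy0]
  -- Jordan's inequality gives θ² ≤ (π²/4) y, and π² ≤ 10.
  have hle : θ ^ 2 ≤ 5 / 2 * y := by
    have h1 := Real.mul_le_sin hθ0 (Real.arcsin_le_pi_div_two _)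
    have h2 : (2 / Real.pi * θ) ^ 2 ≤ Real.sin θ ^ 2 := by
      have : 0 ≤ 2 / Real.pi * θ := by positivity
      gcongr
    rw [hsin, mul_pow, div_pow] at h2
    have hpi : Real.pi ^ 2 ≤ 10 := by nlinarith [Real.pi_lt_d2, Real.pi_pos]
    have h3 : (2 : ℝ) ^ 2 / 10 ≤ 2 ^ 2 / Real.pi ^ 2 := by gcongr
    nlinarith [mul_le_mul_of_nonneg_right h3 (sq_nonneg θ)]
  set s := (N : ℝ) ^ 2 * y with hs
  set x := (N : ℝ) * θ with hx
  have hx0 : 0 ≤ x := by positivity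
  have hs0 : 0 ≤ s := by positivity
  have hx2 : x ^ 2 ≤ 5 / 2 * s := by
    rw [hx, mul_pow, hs]
    nlinarith
  have hx4 : x ^ 4 ≤ 25 / 4 * s ^ 2 := by
    have : (x ^ 2) ^ 2 ≤ (5 / 2 * s) ^ 2 := by gcongr
    nlinarith
  obtain ⟨h1, h2⟩ := sq_sub_le_sin_sq hx0 (by linarith)
  obtain ⟨h3, h4⟩ := sq_sub_le_sin_sq hθ0 (by linarith)
  rw [hsin] at h3 h4
  have h5 : s ≤ x ^ 2 := by
    rw [hs, hx, mul_pow]; gcongr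
  have h6 : x ^ 2 - x ^ 4 / 3 ≤ s := by
    have e1 : (N : ℝ) ^ 2 * (θ ^ 2 - θ ^ 4 / 3) ≤ s := by rw [hs]; gcongr
    have e2 : (N : ℝ) ^ 2 * θ ^ 4 ≤ x ^ 4 := by
      rw [hx, mul_pow]
      have : (N : ℝ) ^ 2 ≤ (N : ℝ) ^ 4 := pow_le_pow_right₀ hN1 (by norm_num)
      gcongr
    have e3 : (N : ℝ) ^ 2 * θ ^ 2 = x ^ 2 := by rw [hx, mul_pow]
    nlinarith
  rw [abs_le]
  constructor <;> nlinarith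

/-- The error per round of the phase that is produced by the walk. -/
lemma norm_phase_sub_le {s s₀ δ κ : ℝ} (hδ0 : 0 ≤ δ) (hδ1 : δ ≤ 1) (hs0 : 0 ≤ s) (hs1 : s ≤ 1)
    (hs₀0 : 0 ≤ s₀) (hs₀κ : s₀ ≤ κ) (hκ : κ ≤ 1 / 4) (hss : |s - s₀| ≤ 4 * s₀ ^ 2) :
    ‖1 + 2 * (Complex.exp (Complex.I * (-δ : ℝ)) - 1) * s
      - Complex.exp (Complex.I * (-(2 * δ * s₀) : ℝ))‖ ≤ 3 * δ ^ 2 + 8 * δ * κ ^ 2 := by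
  have hlin : ∀ x : ℝ, |x| ≤ 1 →
      ‖Complex.exp (Complex.I * (x : ℝ)) - 1 - Complex.I * (x : ℝ)‖ ≤ x ^ 2 := by
    intro x hx
    have hn : ‖Complex.I * (x : ℂ)‖ = |x| := by simp
    have := Complex.norm_exp_sub_one_sub_id_le (x := Complex.I * (x : ℂ)) (by rw [hn]; exact hx)
    rwa [hn, sq_abs] at this
  have h1 := hlin (-δ) (by rw [abs_neg, abs_of_nonneg hδ0]; exact hδ1)
  have hprod : 0 ≤ 2 * δ * s₀ := by positivity
  have hprod1 : 2 * δ * s₀ ≤ δ / 2 := by nlinarith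
  have h2 := hlin (-(2 * δ * s₀)) (by rw [abs_neg, abs_of_nonneg hprod]; linarith)
  -- Both exponentials are compared with their linear parts, which differ by 2δ(s - s₀) in modulus.
  have e : 1 + 2 * (Complex.exp (Complex.I * (-δ : ℝ)) - 1) * s
      - Complex.exp (Complex.I * (-(2 * δ * s₀) : ℝ))
      = (2 * s : ℝ) * (Complex.exp (Complex.I * (-δ : ℝ)) - 1 - Complex.I * (-δ : ℝ))
        - (Complex.exp (Complex.I * (-(2 * δ * s₀) : ℝ)) - 1 - Complex.I * (-(2 * δ * s₀) : ℝ))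
        + Complex.I * ((-(2 * δ) * (s - s₀) : ℝ) : ℂ) := by
    push_cast; ring
  rw [e]
  refine (norm_add_le _ _).trans ?_
  have hA : ‖((2 * s : ℝ) : ℂ) * (Complex.exp (Complex.I * (-δ : ℝ)) - 1 - Complex.I * (-δ : ℝ))‖
      ≤ 2 * δ ^ 2 := by
    rw [norm_mul, Complex.norm_real, Real.norm_eq_abs, abs_of_nonneg (by positivity)]
    rw [neg_sq] at h1
    calc 2 * s * _ ≤ 2 * 1 * δ ^ 2 := by gcongr
      _ = 2 * δ ^ 2 := by ring
  have hB : (-(2 * δ * s₀)) ^ 2 ≤ δ ^ 2 := by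
    rw [neg_sq]
    exact pow_le_pow_left₀ hprod (by linarith) 2
  have hC : ‖Complex.I * ((-(2 * δ) * (s - s₀) : ℝ) : ℂ)‖ ≤ 8 * δ * κ ^ 2 := by
    rw [norm_mul, Complex.norm_I, one_mul, Complex.norm_real, Real.norm_eq_abs, abs_mul, abs_neg,
      abs_of_nonneg (by positivity : 0 ≤ 2 * δ)]
    have : s₀ ^ 2 ≤ κ ^ 2 := pow_le_pow_left₀ hs₀0 hs₀κ 2
    calc 2 * δ * |s - s₀| ≤ 2 * δ * (4 * κ ^ 2) := by gcongr; linarith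
      _ = 8 * δ * κ ^ 2 := by ring
  have := (norm_sub_le (((2 * s : ℝ) : ℂ) *
    (Complex.exp (Complex.I * (-δ : ℝ)) - 1 - Complex.I * (-δ : ℝ)))
    (Complex.exp (Complex.I * (-(2 * δ * s₀) : ℝ)) - 1 - Complex.I * (-(2 * δ * s₀) : ℝ)))
  linarith

end Estimates

/-! ### Time evolution in the energy eigenbasis -/

section Evolution

open Matrix

variable {κ : Type} [Fintype κ] [DecidableEq κ]

lemma act_exp_of_eigen {M : Matrix κ κ ℂ} {v : EuclideanSpace ℂ κ} {μ : ℂ} (h : act M v = μ • v) :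
    act (NormedSpace.exp M) v = Complex.exp μ • v := by
  set f : Matrix κ κ ℂ →L[ℂ] EuclideanSpace ℂ κ :=
    LinearMap.toContinuousLinearMap
      ((LinearMap.applyₗ v : Module.End ℂ (EuclideanSpace ℂ κ) →ₗ[ℂ] EuclideanSpace ℂ κ) ∘ₗ
        (toEuclideanLin : Matrix κ κ ℂ ≃ₗ[ℂ] _).toLinearMap) with hf
  have hfa : ∀ A, f A = act A v := fun A => rfl
  have hpow : ∀ m : ℕ, act (M ^ m) v = μ ^ m • v := by
    intro m
    induction m with
    | zero => rw [pow_zero, pow_zero, act_one, one_smul]; rfl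
    | succ m ih => rw [pow_succ, act_mul_apply, h, map_smul, ih, smul_smul, pow_succ, mul_comm]
  have h1 := (NormedSpace.exp_series_hasSum_exp' (𝕂 := ℂ) M).mapL f
  have h2 := (NormedSpace.exp_series_hasSum_exp' (𝕂 := ℂ) μ).smul_const v
  have e : (fun m : ℕ => f (((m.factorial : ℂ)⁻¹) • M ^ m))
      = fun m : ℕ => (((m.factorial : ℂ)⁻¹) • μ ^ m) • v := by
    ext1 m
    rw [map_smul, hfa, hpow, smul_assoc]
  rw [e] at h1
  have := h1.unique h2
  rwa [hfa, ← Complex.exp_eq_exp_ℂ] at this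

variable {d n : ℕ}

lemma evolution_eigen {H : Op (spinDims d n)} {v : HilbertSp (spinDims d n)} {E : ℝ}
    (h : act H v = (E : ℂ) • v) (t : ℝ) :
    act (evolution H t) v = Complex.exp (Complex.I * (-(t * E) : ℝ)) • v := by
  rw [evolution, act_exp_of_eigen (μ := -(Complex.I * t) * E)]
  · congr 2; push_cast; ring
  · rw [act_smul_apply, h, smul_smul]

lemma act_eigenvectorBasis {A : Matrix κ κ ℂ} (hA : A.IsHermitian) (i : κ) :
    act A (hA.eigenvectorBasis i) = (hA.eigenvalues i : ℂ) • hA.eigenvectorBasis i := by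
  ext j
  have := congrFun (hA.mulVec_eigenvectorBasis i) j
  rw [toLpLin_apply]
  simpa using this

/-- A low-energy state has no component along an eigenvector of high energy. -/
lemma repr_eq_zero_of_mem_lowEnergy {H : Op (spinDims d n)} (hH : H.IsHermitian) {Δ : ℝ}
    {ψ : HilbertSp (spinDims d n)} (hψ : ψ ∈ lowEnergy H Δ) (i : Config (spinDims d n))
    (hi : hH.eigenvectorBasis.repr ψ i ≠ 0) : hH.eigenvalues i ∈ Set.Icc 0 Δ := by
  by_contra hcon
  refine hi ?_
  rw [OrthonormalBasis.repr_apply_apply]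
  have hsub : lowEnergy H Δ ≤ LinearMap.ker (innerSL ℂ (hH.eigenvectorBasis i)).toLinearMap := by
    refine iSup₂_le fun E hE φ hφ => ?_
    rw [LinearMap.mem_ker]
    change inner ℂ (hH.eigenvectorBasis i) φ = 0
    rw [Module.End.mem_eigenspace_iff] at hφ
    have h1 : inner ℂ (hH.eigenvectorBasis i) (act H φ) = inner ℂ (act H (hH.eigenvectorBasis i)) φ := by
      rw [← LinearMap.adjoint_inner_left, ← toEuclideanLin_conjTranspose_eq_adjoint, hH.eq]
    rw [act_eigenvectorBasis, show act H φ = (E : ℂ) • φ from hφ, inner_smul_right, inner_smul_left,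
      Complex.conj_ofReal] at h1
    have hne : ((E - hH.eigenvalues i : ℝ) : ℂ) ≠ 0 := by
      rw [Complex.ofReal_ne_zero, sub_ne_zero]
      rintro rfl
      exact hcon hE
    refine (mul_eq_zero.1 ?_).resolve_left hne
    push_cast
    rw [sub_mul, h1, sub_self]
  exact hsub hψ

end Evolution

/-! ### Simulation of low-energy states by a quantum walk -/

section Simulation

open Matrix

variable {d n k : ℕ} {g : ℕ∞} {K : LocalSum d n}

lemma LocalSum.exists_rotations (hK : K.IsLocal k g)
    (hpos : ∀ X ∈ K.terms, (K.h X).PosSemidef) {σ : ℝ} (hσ0 : 0 ≤ σ) (hσ1 : σ ≤ 1) :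
    ∃ a b : K.terms → Op (spinDims d n), ∀ X, star (a X) = a X ∧ star (b X) = b X ∧
      a X * b X = b X * a X ∧ a X * a X = (σ : ℂ) • extend (spinDims d n) X (K.h X) ∧
      b X * b X = 1 - (σ : ℂ) • extend (spinDims d n) X (K.h X) ∧
      ActsOn X.1 (a X) ∧ ActsOn X.1 (b X) := by
  have h := fun X : K.terms => exists_sqrt_pair (hpos X X.2) (hK.norm_le X X.2) hσ0 hσ1
  choose a b ha hb hab haa hbb using h
  refine ⟨fun X => extend _ X.1 (a X), fun X => extend _ X.1 (b X), fun X => ?_⟩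
  refine ⟨?_, ?_, ?_, ?_, ?_, actsOn_extend _ _, actsOn_extend _ _⟩
  · rw [← extend_star, ha]
  · rw [← extend_star, hb]
  · rw [← extend_mul, ← extend_mul, hab]
  · rw [← extend_mul, haa, extend_smul]
  · rw [← extend_mul, hbb, ← extend_smul, ← extend_one X.1, sub_eq_add_neg, sub_eq_add_neg,
      extend_add, ← neg_one_smul ℂ, extend_smul, neg_one_smul]

lemma inner_act_mul_self {κ : Type} [Fintype κ] [DecidableEq κ] {a : Matrix κ κ ℂ}
    (ha : star a = a) (v : EuclideanSpace ℂ κ) :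
    inner ℂ v (act (a * a) v) = ((‖act a v‖ ^ 2 : ℝ) : ℂ) := by
  rw [act_mul_apply, ← LinearMap.adjoint_inner_left, ← toEuclideanLin_conjTranspose_eq_adjoint,
    ← star_eq_conjTranspose, ha]
  change inner ℂ (act a v) (act a v) = _
  rw [inner_self_eq_norm_sq_to_K]
  push_cast
  rfl

lemma LocalSum.isHermitian_toOp (hK : K.IsLocal k g) : K.toOp.IsHermitian := by
  rw [IsHermitian, ← star_eq_conjTranspose, LocalSum.toOp, star_sum]
  refine Finset.sum_congr rfl fun X hX => ?_
  rw [← extend_star, star_eq_conjTranspose, (hK.hermitian X hX).eq]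

lemma LocalSum.toOp_eq_sum_coe : K.toOp = ∑ X : K.terms, extend (spinDims d n) X (K.h X) := by
  rw [LocalSum.toOp, ← Finset.sum_coe_sort]

/-- For σ = 1 the expectation of each term equals both ‖a v‖² and 1 - ‖b v‖², so it lies in [0, 1].
-/
lemma LocalSum.eigenvalue_mem_Icc (hK : K.IsLocal k g)
    (hpos : ∀ X ∈ K.terms, (K.h X).PosSemidef) {v : HilbertSp (spinDims d n)} (hv : ‖v‖ = 1) {E : ℝ}
    (hE : act K.toOp v = (E : ℂ) • v) : E ∈ Set.Icc 0 (K.numTerms : ℝ) := by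
  obtain ⟨a, b, h⟩ := K.exists_rotations hK hpos zero_le_one le_rfl
  have hvv : inner ℂ v v = (1 : ℂ) := by rw [inner_self_eq_norm_sq_to_K, hv]; simp
  have hX : ∀ X : K.terms, inner ℂ v (act (extend (spinDims d n) X.1 (K.h X)) v)
      = ((‖act (a X) v‖ ^ 2 : ℝ) : ℂ) := by
    intro X
    obtain ⟨ha, -, -, haa, -⟩ := h X
    rw [Complex.ofReal_one, one_smul] at haa
    rw [← haa, inner_act_mul_self ha]
  have hX' : ∀ X : K.terms, inner ℂ v (act (extend (spinDims d n) X.1 (K.h X)) v)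
      = ((1 - ‖act (b X) v‖ ^ 2 : ℝ) : ℂ) := by
    intro X
    obtain ⟨-, hb, -, -, hbb, -⟩ := h X
    rw [Complex.ofReal_one, one_smul] at hbb
    have e : extend (spinDims d n) X.1 (K.h X) = 1 - b X * b X := by rw [hbb, sub_sub_cancel]
    rw [e, act_sub, LinearMap.sub_apply, act_one, Module.End.one_apply, inner_sub_right, hvv,
      inner_act_mul_self hb]
    push_cast
    rfl
  have hsum : (E : ℂ) = ∑ X : K.terms, inner ℂ v (act (extend (spinDims d n) X.1 (K.h X)) v) := by
    rw [← inner_sum, ← LinearMap.sum_apply, ← map_sum, ← LocalSum.toOp_eq_sum_coe]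
    change _ = inner ℂ v (act K.toOp v)
    rw [hE, inner_smul_right, hvv, mul_one]
  constructor
  · have : E = ∑ X : K.terms, ‖act (a X) v‖ ^ 2 := by
      simp only [hX] at hsum
      exact_mod_cast hsum
    rw [this]
    exact Finset.sum_nonneg fun X _ => sq_nonneg _
  · have : E = ∑ X : K.terms, (1 - ‖act (b X) v‖ ^ 2) := by
      simp only [hX'] at hsum
      exact_mod_cast hsum
    rw [this]
    calc ∑ X : K.terms, (1 - ‖act (b X) v‖ ^ 2) ≤ ∑ _X : K.terms, (1 : ℝ) :=
          Finset.sum_le_sum fun X _ => by linarith [sq_nonneg ‖act (b X) v‖]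
      _ = K.numTerms := by simp [LocalSum.numTerms]

/-- A reflection that encodes the Hamiltonian, scaled by `σ / L`, in its base block. -/
lemma LocalSum.exists_reflection (hd : 1 ≤ d) (hK : K.IsLocal k g)
    (hpos : ∀ X ∈ K.terms, (K.h X).PosSemidef) {σ : ℝ} (hσ0 : 0 ≤ σ) (hσ1 : σ ≤ 1) {N : ℕ}
    (hN : ∀ (X : Finset (Fin n ⊕ Fin (K.numTerms + 1))), X.card ≤ k + 2 →
      ∀ A ∈ unitary (OpOn (regDims d n (K.numTerms + 1)) X), Len N (extend _ X A))
    (j₀ : Fin K.numTerms) :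
    ∃ B : Op (regDims d n (K.numTerms + 1)), B * B = 1 ∧
      Len (2 * (K.numTerms * N) + 2 * K.numTerms + 1) B ∧
      ∀ (v : HilbertSp (spinDims d n)) (E : ℝ), act K.toOp v = (E : ℂ) • v →
        act (krDiag d n (baseSwitch j₀ 1 0)) (act B (withAncilla (K.numTerms + 1) v))
        = ((1 - 2 * (σ * E / K.numTerms) : ℝ) : ℂ) • withAncilla (K.numTerms + 1) v := by
  obtain ⟨a, b, h⟩ := K.exists_rotations hK hpos hσ0 hσ1
  set e : Fin K.numTerms ≃ K.terms := K.terms.equivFin.symm with he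
  have hone : ∀ X, a X * a X + b X * b X = 1 := by
    intro X
    obtain ⟨-, -, -, haa, hbb, -⟩ := h X
    rw [haa, hbb, add_sub_cancel]
  have := nonempty_regConfig (n := n) (a := K.numTerms + 1) hd
  obtain ⟨B, hBB, hBlen, hB⟩ := QSim.exists_reflection hd j₀ (fun j => a (e j)) (fun j => b (e j))
    (fun j => (h (e j)).1) (fun j => (h (e j)).2.1) (fun j => (h (e j)).2.2.1)
    (fun j => hone (e j)) (N := N) (by
      intro j
      obtain ⟨ha, hb, hab, -, -, hXa, hXb⟩ := h (e j)
      obtain ⟨A, hA, hAe⟩ := (ctrlRot_actsOn j₀ j hXa hXb).exists_unitary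
        (ctrlRot_mem_unitary j₀ j ha hb hab (hone (e j)))
      rw [← hAe]
      refine hN _ ?_ A hA
      rw [Finset.card_disjSum]
      exact add_le_add (hK.card_le _ (e j).2) Finset.card_le_two)
  refine ⟨B, hBB, hBlen, fun v E hv => ?_⟩
  have hL : (K.numTerms : ℂ) ≠ 0 := by
    exact_mod_cast (Fin.pos j₀).ne'
  rw [hB]
  have hsum : ∑ j, (b (e j) * b (e j) - a (e j) * a (e j))
      = (K.numTerms : ℂ) • (1 : Op (spinDims d n)) - (2 * σ : ℂ) • K.toOp := by
    rw [e.sum_comp fun X => b X * b X - a X * a X, LocalSum.toOp_eq_sum_coe, Finset.smul_sum]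
    have : ∀ X : K.terms, b X * b X - a X * a X
        = 1 - (2 * σ : ℂ) • extend (spinDims d n) X.1 (K.h X) := by
      intro X
      obtain ⟨-, -, -, haa, hbb, -⟩ := h X
      rw [haa, hbb, mul_smul, two_smul]
      abel
    simp only [this, Finset.sum_sub_distrib]
    congr 1
    rw [Finset.sum_const, Finset.card_univ, Fintype.card_coe, ← Nat.cast_smul_eq_nsmul ℂ]
    rfl
  have hact : act ((1 / K.numTerms : ℂ) • ∑ j, (b (e j) * b (e j) - a (e j) * a (e j))) v
      = ((1 - 2 * (σ * E / K.numTerms) : ℝ) : ℂ) • v := by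
    rw [hsum, act_smul_apply, act_sub, LinearMap.sub_apply, act_smul_apply, act_smul_apply, act_one,
      Module.End.one_apply, hv, smul_smul, ← sub_smul, smul_smul]
    congr 1
    push_cast
    field_simp
  rw [hact]
  exact (ancillaIsometry d n (K.numTerms + 1)).map_smul _ v

/-- Translates the abstract walk into gates: the reflection and the phase rotations about the base
projection are all of the form `baseSwitch`. -/
lemma isWalkPair_base {L : ℕ} (hd : 1 ≤ d) (j₀ : Fin L) {B : Op (regDims d n (L + 1))}
    (hBB : B * B = 1) (hBu : B ∈ unitary (Op (regDims d n (L + 1)))) :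
    (2 * act (krDiag d n (baseSwitch j₀ 1 0)) - 1 = act (krDiag d n (baseSwitch j₀ 1 (-1)))) ∧
    (∀ z : ℂ, 1 + (z - 1) • (1 - act (krDiag d n (baseSwitch j₀ 1 0)))
      = act (krDiag d n (baseSwitch j₀ 1 z))) ∧
    IsWalkPair (act (krDiag d n (baseSwitch j₀ 1 0))) (act B) := by
  have h1 : 2 * act (krDiag d n (baseSwitch j₀ 1 0)) - 1
      = act (krDiag d n (baseSwitch j₀ 1 (-1))) := by
    have : krDiag d n (baseSwitch j₀ 1 0) + krDiag d n (baseSwitch j₀ 1 0)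
        = krDiag d n (baseSwitch j₀ 1 (-1)) + 1 := by
      rw [← krDiag_one, krDiag_add, krDiag_add]
      congr 1
      ext z
      simp only [Pi.add_apply, Pi.one_apply, baseSwitch]
      split_ifs <;> simp
    rw [two_mul, ← act_add, this, act_add, act_one, add_sub_cancel_right]
  refine ⟨h1, ?_, ?_⟩
  · intro z
    have : krDiag d n (baseSwitch j₀ 1 z)
        = 1 + (z - 1) • (1 + (-1 : ℂ) • krDiag d n (baseSwitch j₀ 1 0)) := by
      rw [← krDiag_one, krDiag_smul, krDiag_add, krDiag_smul, krDiag_add]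
      congr 1
      ext w
      simp only [Pi.add_apply, Pi.one_apply, Pi.smul_apply, baseSwitch, smul_eq_mul]
      split_ifs <;> simp
    rw [this, act_add, act_smul, act_add, act_smul, act_one, neg_one_smul,
      ← sub_eq_add_neg]
  · refine ⟨?_, ?_, ?_, ?_⟩
    · rw [← act_mul, krDiag_mul]
      congr 2
      ext z
      simp only [Pi.mul_apply, baseSwitch]
      split_ifs <;> simp
    · rw [← act_mul, hBB, act_one]
    · intro v
      rw [h1]
      exact norm_act_of_mem_unitary (len_baseSwitch hd j₀ (by simp) (by simp)).mem_unitary v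
    · exact norm_act_of_mem_unitary hBu

/-- Rδ ≤ 1/(2κ) for every R. The terms quadratic in δ thus sum to O(1/R), whereas linearising sin²
costs an amount controlled by κ alone. -/
lemma mul_round_error_le {R κ δ : ℝ} (hR : 0 < R) (hκ : 0 < κ) (hδ0 : 0 ≤ δ)
    (hδ : δ ≤ 1 / (2 * R * κ)) :
    R * (3 * δ ^ 2 + 8 * δ * κ ^ 2 + δ ^ 2) ≤ 1 / (R * κ ^ 2) + 4 * κ := by
  have hδR : R * δ ≤ 1 / (2 * κ) := by
    calc R * δ ≤ R * (1 / (2 * R * κ)) := by gcongr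
      _ = 1 / (2 * κ) := by field_simp
  have h1 : R * (3 * δ ^ 2 + 8 * δ * κ ^ 2 + δ ^ 2) = 4 * (R * δ) * δ + 8 * (R * δ) * κ ^ 2 := by ring
  rw [h1]
  have h2 : 4 * (R * δ) * δ ≤ 4 * (1 / (2 * κ)) * (1 / (2 * R * κ)) := by gcongr
  have h3 : 8 * (R * δ) * κ ^ 2 ≤ 8 * (1 / (2 * κ)) * κ ^ 2 := by gcongr
  have h4 : 4 * (1 / (2 * κ)) * (1 / (2 * R * κ)) = 1 / (R * κ ^ 2) := by field_simp; norm_num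
  have h5 : 8 * (1 / (2 * κ)) * κ ^ 2 = 4 * κ := by field_simp; norm_num
  linarith

set_option maxHeartbeats 1000000 in
/-- Simulation of the evolution of low-energy states in `R` rounds of `4 D` steps of a quantum walk,
where `D` is about `√(L T)`. -/
theorem LocalSum.exists_circuit (hd : 1 ≤ d) (hK : K.IsLocal k g)
    (hpos : ∀ X ∈ K.terms, (K.h X).PosSemidef) {N : ℕ}
    (hN : ∀ (X : Finset (Fin n ⊕ Fin (K.numTerms + 1))), X.card ≤ k + 2 →
      ∀ A ∈ unitary (OpOn (regDims d n (K.numTerms + 1)) X), Len N (extend _ X A))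
    (hL : 0 < K.numTerms) {T Δ t κ : ℝ} (hT : 0 < T) (hΔ : Δ ≤ 1 / T) (ht0 : 0 ≤ t) (htT : t ≤ T)
    (hκ0 : 0 < κ) (hκ1 : κ ≤ 1 / 4) {R D : ℕ} (hR : 1 ≤ 2 * R * κ) (hD1 : 1 ≤ D)
    (hD : √(K.numTerms * T) ≤ D) :
    ∃ V : Circuit d n,
      V.complexity ≤ R * (4 * D * (1 + (2 * (K.numTerms * N) + 2 * K.numTerms + 1)) + 2) ∧
      ∀ ψ ∈ lowEnergy K.toOp Δ,
        ‖withAncilla V.ancillas (act (evolution K.toOp t) ψ)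
          - act V.toOp (withAncilla V.ancillas ψ)‖ ≤ (1 / (R * κ ^ 2) + 4 * κ) * ‖ψ‖ := by
  set L := K.numTerms with hLdef
  have hL' : (0 : ℝ) < L := by exact_mod_cast hL
  have hD' : (0 : ℝ) < D := by exact_mod_cast hD1
  have hR' : (0 : ℝ) < R := by
    rcases Nat.eq_zero_or_pos R with h | h
    · rw [h] at hR; norm_num at hR
    · exact_mod_cast h
  have hLT : L * T ≤ (D : ℝ) ^ 2 := Real.sqrt_le_left hD'.le |>.1 hD |> fun h => h
  -- With this scale (2D)²σ/L = κT, so D walk steps turn E into the small parameter κTE.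
  set σ : ℝ := κ * (L * T) / (4 * (D : ℝ) ^ 2) with hσ
  have hσ0 : 0 ≤ σ := by positivity
  have hσ1 : σ ≤ 1 := by
    rw [hσ, div_le_one (by positivity)]
    nlinarith [mul_pos hL' hT]
  set j₀ : Fin L := ⟨0, hL⟩ with hj₀
  obtain ⟨B, hBB, hBlen, hB⟩ := K.exists_reflection hd hK hpos hσ0 hσ1 hN j₀
  obtain ⟨hS, hPh, hpair⟩ := isWalkPair_base hd j₀ hBB hBlen.mem_unitary
  set P := krDiag d n (baseSwitch j₀ 1 0) with hP
  set S := krDiag d n (baseSwitch j₀ 1 (-1)) with hSdef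
  -- Chosen so that the phase 2δ · κTE of one round is tE/R.
  set δ : ℝ := t / (2 * R * κ * T) with hδ
  have hδ0 : 0 ≤ δ := by positivity
  have hδle : δ ≤ 1 / (2 * R * κ) := by
    rw [hδ, div_le_div_iff₀ (by positivity) (by positivity)]
    nlinarith [mul_pos hR' hκ0]
  have hδ1 : δ ≤ 1 := hδle.trans (by rw [div_le_one (by positivity)]; exact hR)
  set z := Complex.exp (Complex.I * (-δ : ℝ)) with hz
  have hz1 : ‖z‖ = 1 := by rw [hz, mul_comm, Complex.norm_exp_ofReal_mul_I]
  set Ph := krDiag d n (baseSwitch j₀ 1 z) with hPhdef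
  set U := ((S * B) ^ D * Ph * (B * S) ^ D) * ((B * S) ^ D * Ph * (S * B) ^ D) with hU
  have hSlen : Len 1 S := len_baseSwitch hd j₀ (by simp) (by simp)
  have hPhlen : Len 1 Ph := len_baseSwitch hd j₀ (by simp) hz1
  have hUlen : Len (4 * D * (1 + (2 * (L * N) + 2 * L + 1)) + 2) U := by
    have h1 := (hSlen.mul hBlen).pow D
    have h2 := (hBlen.mul hSlen).pow D
    refine (((h1.mul hPhlen).mul h2).mul ((h2.mul hPhlen).mul h1)).mono (le_of_eq ?_)
    ring
  obtain ⟨l, hl, hlU⟩ := hUlen.pow R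
  refine ⟨⟨L + 1, l⟩, hl, ?_⟩
  change ∀ ψ ∈ lowEnergy K.toOp Δ, ‖withAncilla (L + 1) (act (evolution K.toOp t) ψ)
    - act (gatesOp l) (withAncilla (L + 1) ψ)‖ ≤ _
  rw [hlU]
  have hactU : act U = walkPhase (act P) (act B) D (z - 1) := by
    rw [hU, walkPhase, walk, walkInv, hS, hPh z]
    simp only [act_mul, act_pow]
    rfl
  have hUu := hUlen.mem_unitary
  set J := ancillaIsometry d n (L + 1) with hJ
  have hH := LocalSum.isHermitian_toOp hK
  set v := hH.eigenvectorBasis with hv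
  set E := hH.eigenvalues with hE
  have hvE : ∀ i, act K.toOp (v i) = (E i : ℂ) • v i := fun i => act_eigenvectorBasis hH i
  have hEL : ∀ i, E i ∈ Set.Icc 0 (L : ℝ) := fun i =>
    K.eigenvalue_mem_Icc hK hpos (v.orthonormal.1 i) (hvE i)
  set y : Config (spinDims d n) → ℝ := fun i => σ * E i / L with hy
  have hy0 : ∀ i, 0 ≤ y i := fun i => div_nonneg (mul_nonneg hσ0 (hEL i).1) hL'.le
  have hy1 : ∀ i, y i ≤ 1 := by
    intro i
    rw [hy, div_le_one hL']
    nlinarith [(hEL i).1, (hEL i).2]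
  have hη : Orthonormal ℂ fun i => J (v i) := v.orthonormal.comp_linearIsometry J
  have hη1 : ∀ i, act P (J (v i)) = J (v i) := by
    intro i
    rw [hJ, ancillaIsometry_apply, ← coded_base j₀, hP, act_base_coded, if_pos rfl]
  have hη2 : ∀ i, act P (act B (J (v i)))
      = (Real.cos (2 * Real.arcsin √(y i)) : ℂ) • J (v i) := by
    intro i
    rw [hJ, ancillaIsometry_apply, hB (v i) (E i) (hvE i), Real.cos_two_mul, Real.cos_sq',
      Real.sin_arcsin (by linarith [Real.sqrt_nonneg (y i)]) (Real.sqrt_le_one.2 (hy1 i)),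
      Real.sq_sqrt (hy0 i)]
    congr 2
    simp only [hy]
    ring
  set e : Config (spinDims d n) → ℂ := fun i => Complex.exp (Complex.I * (-(t * E i / R) : ℝ)) with he
  -- Stated for all low-energy coefficients, since multiplication by the exact phases preserves this
  -- class and the estimate can be iterated.
  have hround : ∀ α : Config (spinDims d n) → ℂ, (∀ i, α i ≠ 0 → E i ∈ Set.Icc 0 Δ) →
      ‖act U (J (∑ i, α i • v i)) - J (∑ i, (α i * e i) • v i)‖
        ≤ (3 * δ ^ 2 + 8 * δ * κ ^ 2 + δ ^ 2) * ‖J (∑ i, α i • v i)‖ := by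
    intro α hα
    have h := hpair.norm_walkPhase_sub_le hη hη1 hη2 D (z - 1) α e
      (r := 3 * δ ^ 2 + 8 * δ * κ ^ 2) (by positivity) ?_
    · have hJα : ∀ β : Config (spinDims d n) → ℂ,
          J (∑ i, β i • v i) = ∑ i, β i • J (v i) := fun β => by simp only [map_sum, map_smul]
      rw [hactU, hJα, hJα]
      refine h.trans ?_
      gcongr
      rw [hz]
      refine Real.norm_exp_I_mul_ofReal_sub_one_le.trans ?_
      rw [Real.norm_eq_abs, abs_neg, abs_of_nonneg hδ0]
    · intro i hi
      obtain ⟨hE0, hE1⟩ := hα i hi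
      have hs₀ : ((2 * D : ℕ) : ℝ) ^ 2 * y i = κ * T * E i := by
        simp only [hy, hσ]
        push_cast
        field_simp
        ring
      -- The energy cut-off enters here: it keeps the walk in the range where sin² is nearly linear
      -- in E.
      have hET : T * E i ≤ 1 := by
        calc T * E i ≤ T * (1 / T) := by gcongr; exact hE1.trans hΔ
          _ = 1 := by field_simp
      have hs₀κ : ((2 * D : ℕ) : ℝ) ^ 2 * y i ≤ κ := by rw [hs₀]; nlinarith
      have hsin := abs_sin_sq_sub_le (hy0 i) (2 * D) (by omega) (hs₀κ.trans hκ1)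
      have hkey := norm_phase_sub_le hδ0 hδ1 (sq_nonneg _) (Real.sin_sq_le_one _)
        (by have := hy0 i; positivity) hs₀κ hκ1 hsin
      have hang : (D : ℝ) * (2 * Real.arcsin √(y i)) = (2 * D : ℕ) * Real.arcsin √(y i) := by
        push_cast; ring
      have hphase : 2 * δ * (((2 * D : ℕ) : ℝ) ^ 2 * y i) = t * E i / R := by
        rw [hs₀, hδ]
        field_simp
      rw [hphase] at hkey
      rw [hang]
      convert hkey using 2
      simp only [he, hz]
      push_cast
      ring
  intro ψ hψ
  set α : Config (spinDims d n) → ℂ := fun i => v.repr ψ i with hαdef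
  have hα : ∀ i, α i ≠ 0 → E i ∈ Set.Icc 0 Δ := fun i hi =>
    repr_eq_zero_of_mem_lowEnergy hH hψ i hi
  have hψα : ψ = ∑ i, α i • v i := (v.sum_repr ψ).symm
  have he1 : ∀ i, ‖e i‖ = 1 := fun i => by
    simp only [he]
    rw [mul_comm, Complex.norm_exp_ofReal_mul_I]
  have hnorm : ∀ m : ℕ, ‖J (∑ i, (α i * e i ^ m) • v i)‖ = ‖ψ‖ := by
    intro m
    rw [J.norm_map, hψα]
    refine (sq_eq_sq₀ (norm_nonneg _) (norm_nonneg _)).1 ?_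
    rw [norm_sq_sum_smul_of_orthonormal v.orthonormal, norm_sq_sum_smul_of_orthonormal v.orthonormal]
    refine Finset.sum_congr rfl fun i _ => ?_
    rw [norm_mul, norm_pow, he1, one_pow, mul_one]
  set r := 3 * δ ^ 2 + 8 * δ * κ ^ 2 + δ ^ 2 with hr
  -- Errors add up linearly because U is an isometry and the ideal state keeps its norm.
  have hiter : ∀ m : ℕ, ‖act (U ^ m) (J ψ) - J (∑ i, (α i * e i ^ m) • v i)‖ ≤ m * r * ‖ψ‖ := by
    intro m
    induction m with
    | zero =>
      simp only [pow_zero, mul_one, ← hψα, act_one, Module.End.one_apply, sub_self, norm_zero]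
      simp
    | succ m ih =>
      have hsplit : act (U ^ (m + 1)) (J ψ) - J (∑ i, (α i * e i ^ (m + 1)) • v i)
          = act U (act (U ^ m) (J ψ) - J (∑ i, (α i * e i ^ m) • v i))
            + (act U (J (∑ i, (α i * e i ^ m) • v i))
              - J (∑ i, ((α i * e i ^ m) * e i) • v i)) := by
        rw [map_sub, pow_succ', act_mul_apply]
        simp only [pow_succ, mul_assoc]
        abel
      rw [hsplit]
      refine (norm_add_le _ _).trans ?_
      rw [norm_act_of_mem_unitary hUu]
      have h2 := hround (fun i => α i * e i ^ m) fun i hi => hα i (left_ne_zero_of_mul hi)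
      rw [hnorm m] at h2
      push_cast
      linarith
  have hfinal := hiter R
  have hevol : act (evolution K.toOp t) ψ = ∑ i, (α i * e i ^ R) • v i := by
    conv_lhs => rw [hψα]
    rw [map_sum]
    refine Finset.sum_congr rfl fun i _ => ?_
    rw [map_smul, evolution_eigen (hvE i), smul_smul]
    congr 2
    simp only [he]
    rw [← Complex.exp_nat_mul]
    congr 1
    have : (R : ℂ) ≠ 0 := by exact_mod_cast hR'.ne'
    push_cast
    field_simp
  rw [hevol, norm_sub_rev]
  refine hfinal.trans ?_
  gcongr
  exact mul_round_error_le hR' hκ0 hδ0 hδle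

end Simulation

/-! ### Complexity of the simulation -/

section Complexity

variable {d n k : ℕ} {g : ℕ∞} {K : LocalSum d n}

/-- The energies lie in [0, L], so the phases are within Lt of 1. This serves the regime where the
empty circuit is accurate enough. -/
lemma LocalSum.norm_evolution_sub_le (hK : K.IsLocal k g)
    (hpos : ∀ X ∈ K.terms, (K.h X).PosSemidef) {t : ℝ} (ht : 0 ≤ t)
    (ψ : HilbertSp (spinDims d n)) :
    ‖act (evolution K.toOp t) ψ - ψ‖ ≤ K.numTerms * t * ‖ψ‖ := by
  have hH := LocalSum.isHermitian_toOp hK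
  set v := hH.eigenvectorBasis with hv
  set E := hH.eigenvalues with hE
  have hvE : ∀ i, act K.toOp (v i) = (E i : ℂ) • v i := fun i => act_eigenvectorBasis hH i
  set α : Config (spinDims d n) → ℂ := fun i => v.repr ψ i with hα
  have hψ : ψ = ∑ i, α i • v i := (v.sum_repr ψ).symm
  set e : Config (spinDims d n) → ℂ := fun i => Complex.exp (Complex.I * (-(t * E i) : ℝ)) with he
  have hsplit : act (evolution K.toOp t) ψ - ψ = ∑ i, (α i * (e i - 1)) • v i := by
    conv_lhs => rw [hψ]
    rw [map_sum, ← Finset.sum_sub_distrib]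
    refine Finset.sum_congr rfl fun i _ => ?_
    rw [map_smul, evolution_eigen (hvE i), smul_smul, ← sub_smul, mul_sub, mul_one]
  rw [hsplit]
  refine (sq_le_sq₀ (norm_nonneg _) (by positivity)).1 ?_
  rw [mul_pow]
  conv_rhs => rw [hψ]
  rw [norm_sq_sum_smul_of_orthonormal v.orthonormal, norm_sq_sum_smul_of_orthonormal v.orthonormal,
    Finset.mul_sum]
  refine Finset.sum_le_sum fun i _ => ?_
  rw [norm_mul, mul_pow, mul_comm]
  have hEi := K.eigenvalue_mem_Icc hK hpos (v.orthonormal.1 i) (hvE i)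
  have h1 : ‖e i - 1‖ ≤ K.numTerms * t := by
    refine Real.norm_exp_I_mul_ofReal_sub_one_le.trans ?_
    rw [Real.norm_eq_abs, abs_neg, abs_of_nonneg (mul_nonneg ht hEi.1), mul_comm]
    exact mul_le_mul_of_nonneg_right hEi.2 ht
  gcongr

/-- The evolution of low-energy states of a sum of `L` positive semidefinite local terms is
simulated for times up to `T` with `O(L² √T)` gates. -/
theorem exists_simulation (d k : ℕ) (hd : 1 ≤ d) {ε : ℝ} (hε : 0 < ε) :
    ∃ C : ℝ, 0 < C ∧ ∀ (n : ℕ) (g : ℕ∞) (K : LocalSum d n) (T Δ t : ℝ), K.IsLocal k g →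
      (∀ X ∈ K.terms, (K.h X).PosSemidef) → 0 < T → Δ ≤ 1 / T → 0 ≤ t → t ≤ T →
      ∃ V : Circuit d n, (V.complexity : ℝ) ≤ C * (K.numTerms : ℝ) ^ 2 * √T ∧
        ∀ ψ ∈ lowEnergy K.toOp Δ, ‖ψ‖ = 1 →
          ‖withAncilla V.ancillas (act (evolution K.toOp t) ψ)
            - act V.toOp (withAncilla V.ancillas ψ)‖ ≤ ε := by
  obtain ⟨N, hN⟩ := exists_len_extend (k + 2) (max d 2)
  -- κ makes the linearisation error 4κ at most ε/2; below, R makes 1/(Rκ²) at most ε/2 and keeps δ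
  -- ≤ 1.
  set κ : ℝ := min (1 / 4) (ε / 8) with hκ
  have hκ0 : 0 < κ := lt_min (by norm_num) (by positivity)
  have hκ1 : κ ≤ 1 / 4 := min_le_left _ _
  have hκε : κ ≤ ε / 8 := min_le_right _ _
  obtain ⟨R, hR⟩ := exists_nat_ge (max (2 / (κ ^ 2 * ε)) (1 / (2 * κ)))
  have hR1 : 2 / (κ ^ 2 * ε) ≤ R := (le_max_left _ _).trans hR
  have hR2 : 1 ≤ 2 * R * κ := by
    have := (le_max_right _ _).trans hR
    rw [div_le_iff₀ (by positivity)] at this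
    linarith
  have hR0 : (0 : ℝ) < R := lt_of_lt_of_le (by positivity) hR1
  have herr : 1 / (R * κ ^ 2) + 4 * κ ≤ ε := by
    have : 1 / (R * κ ^ 2) ≤ ε / 2 := by
      rw [div_le_iff₀ (by positivity)] at hR1 ⊢
      linarith
    linarith
  refine ⟨R * (8 * N + 18) * (1 + 1 / √ε), by positivity,
    fun n g K T Δ t hK hpos hT hΔ ht0 htT => ?_⟩
  -- If LT is tiny, even one walk step could exceed the allowed L²√T, so no gates are used.
  rcases le_or_gt (K.numTerms * T) ε with hsmall | hlarge
  · refine ⟨⟨0, []⟩, ?_, fun ψ _ hψ1 => ?_⟩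
    · simp only [Circuit.complexity, List.length_nil, Nat.cast_zero]
      positivity
    · change ‖withAncilla 0 (act (evolution K.toOp t) ψ) - act 1 (withAncilla 0 ψ)‖ ≤ ε
      rw [act_one, Module.End.one_apply]
      change ‖ancillaIsometry d n 0 _ - ancillaIsometry d n 0 _‖ ≤ ε
      rw [← map_sub, LinearIsometry.norm_map]
      refine (LocalSum.norm_evolution_sub_le hK hpos ht0 ψ).trans ?_
      rw [hψ1, mul_one]
      exact (mul_le_mul_of_nonneg_left htT (Nat.cast_nonneg _)).trans hsmall
  · have hL : 0 < K.numTerms := by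
      rcases Nat.eq_zero_or_pos K.numTerms with h | h
      · rw [h, Nat.cast_zero, zero_mul] at hlarge
        exact absurd hlarge hε.not_gt
      · exact h
    have hL1 : (1 : ℝ) ≤ K.numTerms := by exact_mod_cast hL
    have hne := nonempty_regConfig (n := n) (a := K.numTerms + 1) hd
    have hD1 : 1 ≤ ⌈√(K.numTerms * T)⌉₊ := Nat.one_le_ceil_iff.2 (by positivity)
    obtain ⟨V, hV, hVerr⟩ := LocalSum.exists_circuit hd hK hpos
      (fun X hX A hA => hN (regDims d n (K.numTerms + 1)) X hX
        (by rintro (i | i) <;> simp) A hA) hL hT hΔ ht0 htT hκ0 hκ1 hR2 hD1 (Nat.le_ceil _)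
    refine ⟨V, ?_, fun ψ hψ hψ1 => ?_⟩
    · set D := ⌈√(K.numTerms * T)⌉₊ with hD
      set L := K.numTerms with hLdef
      have hsε : 0 < √ε := Real.sqrt_pos.2 hε
      have hsL : √ε ≤ √(L * T) := Real.sqrt_le_sqrt hlarge.le
      -- As LT > ε, the 1 lost in rounding up is at most √(LT)/√ε; and √L ≤ L.
      have hDle : (D : ℝ) ≤ L * √T * (1 + 1 / √ε) := by
        have h1 : (D : ℝ) ≤ √(L * T) + 1 := (Nat.ceil_lt_add_one (Real.sqrt_nonneg _)).le
        have h2 : 1 ≤ √(L * T) * (1 / √ε) := by rwa [mul_one_div, le_div_iff₀ hsε, one_mul]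
        have h3 : √(L * T) ≤ L * √T := by
          rw [Real.sqrt_mul (by positivity)]
          gcongr
          rw [Real.sqrt_le_left (by positivity)]
          nlinarith
        calc (D : ℝ) ≤ √(L * T) * (1 + 1 / √ε) := by linarith
          _ ≤ _ := by gcongr
      have hD1' : (1 : ℝ) ≤ D := by exact_mod_cast hD1
      have hDL : 1 ≤ (D : ℝ) * L := by nlinarith
      calc (V.complexity : ℝ)
          ≤ ((R * (4 * D * (1 + (2 * (L * N) + 2 * L + 1)) + 2) : ℕ) : ℝ) := by exact_mod_cast hV
        _ = R * (8 * N * (D * L) + 8 * (D * L) + 8 * D + 2) := by push_cast; ring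
        _ ≤ R * (8 * N * (D * L) + 8 * (D * L) + 8 * (D * L) + 2 * (D * L)) := by
            gcongr <;> nlinarith
        _ = R * (8 * N + 18) * L * D := by ring
        _ ≤ R * (8 * N + 18) * L * (L * √T * (1 + 1 / √ε)) := by gcongr
        _ = _ := by ring
    · refine (hVerr ψ hψ).trans ?_
      rw [hψ1, mul_one]
      exact herr

end Complexity

/-! ### Comparison with the no-fast-forwarding line -/

lemma ratio_le_of_le {G b : ℝ} {l : ℕ∞} (hb : 0 < b) (hl : ENNReal.ofReal b ≤ (l : ℝ≥0∞)) :
    ratio G l ≤ ENNReal.ofReal (G / b) := by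
  rw [ratio, ENNReal.ofReal_div_of_pos hb]
  exact ENNReal.div_le_div_left hl _

/-- The square of the quotient is L⁴/(n²T), which is at most 1/(c log n) because the argument of the
logarithm exceeds n. -/
lemma tendsto_sq_div_mul_sqrt {L : ℕ → ℕ} {T : ℕ → ℝ} (hT : ∀ n, 0 < T n) {c : ℝ} (hc : 0 < c)
    (h : ∀ᶠ n : ℕ in atTop,
      c * ((L n : ℝ) ^ 4 / (n : ℝ) ^ 2) * Real.log (2 + n + L n + T n) ≤ T n) :
    Tendsto (fun n : ℕ => (L n : ℝ) ^ 2 / (n * √(T n))) atTop (𝓝 0) := by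
  have hlog : Tendsto (fun n : ℕ => √(1 / (c * Real.log n))) atTop (𝓝 0) := by
    have h1 : Tendsto (fun n : ℕ => c * Real.log n) atTop atTop :=
      (Real.tendsto_log_atTop.comp tendsto_natCast_atTop_atTop).const_mul_atTop hc
    have h2 := (Real.continuous_sqrt.tendsto 0).comp h1.inv_tendsto_atTop
    rw [Real.sqrt_zero] at h2
    simpa [Function.comp_def] using h2
  refine squeeze_zero' (Eventually.of_forall fun n => by positivity) ?_ hlog
  filter_upwards [h, eventually_gt_atTop 1] with n hn hn1
  have hn0 : (0 : ℝ) < n := by exact_mod_cast (zero_lt_one.trans hn1)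
  have hlog0 : 0 < Real.log n := Real.log_pos (by exact_mod_cast hn1)
  have hmono : Real.log n ≤ Real.log (2 + n + L n + T n) :=
    Real.log_le_log hn0 (by linarith [(hT n).le, (Nat.cast_nonneg (L n) : (0 : ℝ) ≤ L n)])
  have h1 : c * ((L n : ℝ) ^ 4 / (n : ℝ) ^ 2) * Real.log n ≤ T n :=
    (mul_le_mul_of_nonneg_left hmono (by positivity)).trans hn
  refine Real.le_sqrt_of_sq_le ?_
  rw [div_pow, mul_pow, Real.sq_sqrt (hT n).le,
    div_le_div_iff₀ (mul_pos (by positivity) (hT n)) (by positivity)]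
  rw [mul_div_assoc', div_mul_eq_mul_div, div_le_iff₀ (by positivity)] at h1
  linarith

end QSim

end

/-! ### The theorem: simulation and comparison with the no-fast-forwarding line -/

theorem theorem4 (d k : ℕ) (hd : 1 ≤ d) (ε : ℝ) (hε : 0 < ε) :
    ∃ (C : ℝ) (p q : ℕ), 0 < C ∧
      ∀ (g : ℕ∞) (K : (n : ℕ) → QSim.LocalSum d n) (T Δ : ℕ → ℝ),
        (∀ n, (K n).IsLocal k g) →
        (∀ n, (K n).FrustrationFree) →
        (∀ n, 0 < T n ∧ T n ≤ (d : ℝ) ^ (2 * n)) →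
        (∀ n, Δ n ≤ 1 / T n) →
        ∃ (G : ℕ → ℝ) (V : (n : ℕ) → ℝ → QSim.Circuit d n),
          -- the circuits simulate the Hamiltonians on the low-energy subspaces
          (∀ n, QSim.Simulates (V n) (K n).toOp (QSim.lowEnergy (K n).toOp (Δ n)) (T n) ε (G n)) ∧
          -- with the claimed complexity
          (∀ n, G n ≤ C * ((K n).numTerms : ℝ) ^ 2 * √(T n)
            * Real.log (2 + (K n).numTerms + T n) ^ p) ∧
          -- and if the no-fast-forwarding line is bounded below by a multiple of `n T(n)`, then
          ((∃ c : ℝ, 0 < c ∧ ∀ᶠ n : ℕ in atTop, ENNReal.ofReal (c * (n * T n))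
              ≤ (QSim.noFFLine (QSim.localClass d k g n) (T n) ε : ℝ≥0∞)) →
            (∃ C' : ℝ, 0 < C' ∧ ∀ᶠ n : ℕ in atTop,
              QSim.ratio (G n) (QSim.noFFLine (QSim.localClass d k g n) (T n) ε)
                ≤ ENNReal.ofReal (C' * (((K n).numTerms : ℝ) ^ 2 / (n * √(T n)))
                    * Real.log (2 + (K n).numTerms + T n) ^ p)) ∧
            ((∃ c : ℝ, 0 < c ∧ ∀ᶠ n : ℕ in atTop,
                c * (((K n).numTerms : ℝ) ^ 4 / (n : ℝ) ^ 2)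
                  * Real.log (2 + n + (K n).numTerms + T n) ^ q ≤ T n) →
              QSim.FastForwards (QSim.localClass d k g) V (fun n => (K n).toOp)
                (fun n => QSim.lowEnergy (K n).toOp (Δ n)) T (fun _ => ε) G)) := by
  obtain ⟨C, hC, hsim⟩ := QSim.exists_simulation d k hd hε
  -- The gate count carries no logarithm, so p = 0; a single logarithm in the lower bound on T
  -- suffices, so q = 1.
  refine ⟨C, 0, 1, hC, fun g K T Δ hK hff hT hΔ => ?_⟩
  have hV : ∀ (n : ℕ) (t : ℝ), ∃ V : QSim.Circuit d n, 0 ≤ t → t ≤ T n →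
      (V.complexity : ℝ) ≤ C * ((K n).numTerms : ℝ) ^ 2 * √(T n) ∧
        ∀ ψ ∈ QSim.lowEnergy (K n).toOp (Δ n), ‖ψ‖ = 1 →
          ‖QSim.withAncilla V.ancillas (QSim.act (QSim.evolution (K n).toOp t) ψ)
            - QSim.act V.toOp (QSim.withAncilla V.ancillas ψ)‖ ≤ ε := by
    intro n t
    by_cases ht : 0 ≤ t ∧ t ≤ T n
    · obtain ⟨V, hV⟩ := hsim n g (K n) (T n) (Δ n) t (hK n) (hff n).1 (hT n).1 (hΔ n) ht.1 ht.2
      exact ⟨V, fun _ _ => hV⟩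
    · exact ⟨⟨0, []⟩, fun h0 h1 => absurd ⟨h0, h1⟩ ht⟩
  choose V hV using hV
  have hS : ∀ n, QSim.Simulates (V n) (K n).toOp (QSim.lowEnergy (K n).toOp (Δ n)) (T n) ε
      (C * ((K n).numTerms : ℝ) ^ 2 * √(T n)) := fun n t ht0 htT => hV n t ht0 htT
  refine ⟨fun n => C * ((K n).numTerms : ℝ) ^ 2 * √(T n), V, hS,
    fun n => by rw [pow_zero, mul_one], ?_⟩
  rintro ⟨c, hc, hl⟩
  have hratio : ∀ᶠ n : ℕ in atTop,
      QSim.ratio (C * ((K n).numTerms : ℝ) ^ 2 * √(T n))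
        (QSim.noFFLine (QSim.localClass d k g n) (T n) ε)
        ≤ ENNReal.ofReal (C / c * (((K n).numTerms : ℝ) ^ 2 / (n * √(T n)))) := by
    filter_upwards [hl, eventually_gt_atTop 0] with n hn hn0
    have hn0' : (0 : ℝ) < n := by exact_mod_cast hn0
    have hTn := (hT n).1
    refine (QSim.ratio_le_of_le (by positivity) hn).trans (le_of_eq ?_)
    congr 1
    have hs : 0 < √(T n) := Real.sqrt_pos.2 hTn
    -- Writing the T of the denominator as √T · √T cancels the √T of the numerator.
    nth_rewrite 2 [← Real.mul_self_sqrt hTn.le]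
    field_simp
  refine ⟨⟨C / c, by positivity, ?_⟩, ?_⟩
  · simpa only [pow_zero, mul_one] using hratio
  · rintro ⟨c', hc', hlow⟩
    simp only [pow_one] at hlow
    refine ⟨fun n => ⟨K n, hK n, rfl⟩, hS, ?_⟩
    have hlim := (QSim.tendsto_sq_div_mul_sqrt (fun n => (hT n).1) hc' hlow).const_mul (C / c)
    rw [mul_zero] at hlim
    have hlim' := ENNReal.tendsto_ofReal hlim
    rw [ENNReal.ofReal_zero] at hlim'
    exact tendsto_of_tendsto_of_tendsto_of_le_of_le' tendsto_const_nhds hlim'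
      (Eventually.of_forall fun _ => zero_le) hratio
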